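/- Let $\mathcal A=\langle Q,\Sigma\rangle$ be a complete deterministic finite automaton (without initial or final states). For a word $w\in\Sigma^*$ put $\mathrm{excl}(w)=Q\setminus Q\cdot w$, $\mathrm{dupl}(w)=\{p\in Q : p=q_1\cdot w=q_2\cdot w \text{ for some } q_1\ne q_2\}$, and call $|\mathrm{excl}(w)|$ the defect of $w$. The simple directed graphs $\Gamma_1(\mathcal A),\Gamma_2(\mathcal A),\dots$ are defined as follows. $\Gamma_1(\mathcal A)$ has vertex set $Q$, and its edges are the pairs $(p,q)$ with $\mathrm{excl}(w)=\{p\}$ and $\mathrm{dupl}(w)=\{q\}$ for some word $w$ of defect $1$. For $k\ge 2$, the vertices of $\Gamma_k(\mathcal A)$ are the clusters (classes of mutual reachability) of $\Gamma_{k-1}(\mathcal A)$. For a vertex $C$, let $\mathrm{lf}(C)\subseteq Q$ be the set of all states lying at the bottom of the nested set $C$. A pair $(C,C')$ of different vertices is an edge of $\Gamma_k(\mathcal A)$ if and only if some edge of $\Gamma_{k-1}(\mathcal A)$ leads from an element of $C$ to an element of $C'$, or some word $w$ of defect $k$ satisfies $\mathrm{excl}(w)\subseteq\mathrm{lf}(C)$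 and $\mathrm{dupl}(w)\cap\mathrm{lf}(C')\neq\varnothing$. Theorem. For each fixed $k\ge 1$ there is an algorithm that, given any DFA $\mathcal A$ with $n>k$ states and $m\ge 1$ input letters, builds the graph $\Gamma_k(\mathcal A)$ in time $O(m\,n^{2k}\log n)$, where the implied constant depends only on $k$. Here time is the number of elementary steps of a random access machine whose words have $O(\log(nm))$ bits; $\mathcal A$ is given by its transition table, and $\Gamma_k(\mathcal A)$ is returned as an adjacency matrix together with, for each state $q$, the vertex $C$ with $q\in\mathrm{lf}(C)$. -/

import Mathlib

universe u v

namespace ReachDFA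

/-! ## Automata -/

/-- A complete deterministic finite automaton without initial and final states: a state set `Q`,
an alphabet `S` and a total transition function. -/
structure Automaton (Q : Type u) (S : Type v) where
  step : Q → S → Q

namespace Automaton

variable {Q : Type u} {S : Type v}

/-- The action of words: `q · ε = q` and `q · (w a) = (q · w) · a`. -/
def act (A : Automaton Q S) (q : Q) (w : List S) : Q :=
  w.foldl A.step q

/-- The states outside the image `Q · w`. -/
def excl (A : Automaton Q S) (w : List S) : Set Q :=
  Set.univ \ Set.range (fun q => A.act q w)

/-- The states with at least two preimages under `w`. -/
def dupl (A : Automaton Q S) (w : List S) : Set Q :=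
  {p | ∃ q₁ q₂ : Q, q₁ ≠ q₂ ∧ A.act q₁ w = p ∧ A.act q₂ w = p}

/-- The defect of a word: the number of states outside its image. -/
noncomputable def defect (A : Automaton Q S) (w : List S) : ℕ :=
  (A.excl w).ncard

end Automaton

/-! ## Simple directed graphs, clusters and condensation -/

/-- A simple directed graph whose vertices are some elements of a type `V`:
a vertex set and a set of ordered pairs of vertices. -/
structure Graph (V : Type u) where
  verts : Set V
  edges : Set (V × V)
  edges_subset : edges ⊆ verts ×ˢ verts

namespace Graph

variable {V : Type u}

/-- There is a (possibly empty) path from `x` to `y`. -/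
def Reach (G : Graph V) : V → V → Prop :=
  Relation.ReflTransGen (fun x y => (x, y) ∈ G.edges)

/-- The clusters of a graph: the classes of mutual reachability on its vertex set. -/
def clusters (G : Graph V) : Set (Set V) :=
  {C | ∃ x ∈ G.verts, C = {y | y ∈ G.verts ∧ G.Reach x y ∧ G.Reach y x}}

/-- The condensation of a graph: its vertices are the clusters, with an edge between two different
clusters whenever some edge of the graph leads from the first to the second. -/
def condensation (G : Graph V) : Graph (Set V) where
  verts := G.clusters
  edges := {e | e.1 ∈ G.clusters ∧ e.2 ∈ G.clusters ∧ e.1 ≠ e.2 ∧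
    ∃ x ∈ e.1, ∃ y ∈ e.2, (x, y) ∈ G.edges}
  edges_subset := fun _ he => ⟨he.1, he.2.1⟩

end Graph

/-! ## The graphs `Γ₁(A), Γ₂(A), …` -/

/-- The type in which the vertices of the `k`-th graph live: states for `k = 1`, sets of states
for `k = 2`, sets of sets of states for `k = 3`, and so on (`k = 0` is a dummy value). -/
def Vtx (Q : Type u) : ℕ → Type u
  | 0 => Q
  | 1 => Q
  | k + 2 => Set (Vtx Q (k + 1))

/-- The leafage of a vertex: the set of states at the bottom of the nested set. -/
def leafage {Q : Type u} : (k : ℕ) → Vtx Q k → Set Q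
  | 0, q => {x | x = q}
  | 1, q => {x | x = q}
  | k + 2, C => {x | ∃ D ∈ (show Set (Vtx Q (k + 1)) from C), x ∈ leafage (k + 1) D}

/-- `Γ₁(A)`: all states, with an edge from `p` to `q` whenever a word of defect `1` has `p` as its
only excluded state and `q` as its only duplicate state. -/
def gammaOne {Q : Type u} {S : Type v} (A : Automaton Q S) : Graph Q where
  verts := Set.univ
  edges := {e | ∃ w : List S, A.defect w = 1 ∧ A.excl w = {e.1} ∧ A.dupl w = {e.2}}
  edges_subset := fun _ _ => ⟨trivial, trivial⟩

/-- The passage from a graph `G = Γ_{k+1}(A)` to `Γ_{k+2}(A)`: condense `G` and append the edges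
`(C, C')` forced by words of defect `k + 2`. -/
def gammaNext {Q : Type u} {S : Type v} (A : Automaton Q S) (k : ℕ)
    (G : Graph (Vtx Q (k + 1))) : Graph (Vtx Q (k + 2)) where
  verts := G.condensation.verts
  edges := G.condensation.edges ∪
    {e | e.1 ∈ G.condensation.verts ∧ e.2 ∈ G.condensation.verts ∧ e.1 ≠ e.2 ∧
      ∃ w : List S, A.defect w = k + 2 ∧
        A.excl w ⊆ leafage (k + 2) e.1 ∧ (leafage (k + 2) e.2 ∩ A.dupl w).Nonempty}
  edges_subset := Set.union_subset G.condensation.edges_subset (fun _ he => ⟨he.1, he.2.1⟩)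

/-- The graph `Γ_k(A)` for `k ≥ 1` (`k = 0` is a dummy value). The recursion is also continued
after a step at which the iterative process would already stop. -/
def gamma {Q : Type u} {S : Type v} (A : Automaton Q S) : (k : ℕ) → Graph (Vtx Q k)
  | 0 => ⟨Set.univ, ∅, Set.empty_subset _⟩
  | 1 => gammaOne A
  | k + 2 => gammaNext A k (gamma A (k + 1))

/-! ## Random access machines

A machine has registers and arrays, both numbered by natural numbers (a program mentions only
finitely many of them), whose cells hold natural numbers below a bound `B`, that is, machine words
of `log₂ B` bits. Every elementary operation takes one unit of time. -/

/-- The contents of the registers and of the arrays. -/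
structure Store where
  reg : ℕ → ℕ
  arr : ℕ → ℕ → ℕ

/-- Overwrite a register. -/
def Store.setReg (s : Store) (x v : ℕ) : Store :=
  { s with reg := Function.update s.reg x v }

/-- Overwrite a cell of an array. -/
def Store.setArr (s : Store) (a i v : ℕ) : Store :=
  { s with arr := Function.update s.arr a (Function.update (s.arr a) i v) }

/-- The elementary operations on words. -/
inductive Op where
  | add | sub | mul | div | mod | eq | lt

/-- Their values: subtraction is truncated at `0`, division by `0` has quotient `0` and remainder
the dividend, and comparisons return `1` for true and `0` for false. -/
def Op.eval : Op → ℕ → ℕ → ℕ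
  | .add, x, y => x + y
  | .sub, x, y => x - y
  | .mul, x, y => x * y
  | .div, x, y => x / y
  | .mod, x, y => x % y
  | .eq, x, y => if x = y then 1 else 0
  | .lt, x, y => if x < y then 1 else 0

/-- Expressions: constants, registers, cells of an array at a computed index, operations. -/
inductive Expr where
  | lit (c : ℕ)
  | reg (x : ℕ)
  | cell (a : ℕ) (i : Expr)
  | op (o : Op) (e₁ e₂ : Expr)

namespace Expr

/-- The value of an expression. -/
def eval (s : Store) : Expr → ℕ
  | lit c => c
  | reg x => s.reg x
  | cell a i => s.arr a (i.eval s)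
  | op o e₁ e₂ => o.eval (e₁.eval s) (e₂.eval s)

/-- Every value that occurs in the evaluation of an expression fits into a machine word. -/
def Fits (B : ℕ) (s : Store) : Expr → Prop
  | lit c => c < B
  | reg x => s.reg x < B
  | cell a i => i.Fits B s ∧ s.arr a (i.eval s) < B
  | op o e₁ e₂ => e₁.Fits B s ∧ e₂.Fits B s ∧ o.eval (e₁.eval s) (e₂.eval s) < B

/-- The number of elementary steps needed to evaluate an expression. -/
def cost : Expr → ℕ
  | lit _ => 1
  | reg _ => 1
  | cell _ i => i.cost + 1
  | op _ e₁ e₂ => e₁.cost + e₂.cost + 1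

end Expr

/-- Programs of the machine. A test succeeds if its value is not `0`. -/
inductive Prog where
  | skip
  | assign (x : ℕ) (e : Expr)
  | store (a : ℕ) (i e : Expr)
  | seq (p q : Prog)
  | ite (e : Expr) (p q : Prog)
  | loop (e : Expr) (p : Prog)

/-- `Exec B p s t s'`: on a machine whose words hold the numbers below `B`, the program `p`, started
in the store `s`, halts after exactly `t` steps in the store `s'`. A program that produces a number
`≥ B` gets stuck. `loop e p` is "while `e` do `p`". -/
inductive Exec (B : ℕ) : Prog → Store → ℕ → Store → Prop where
  | skip (s : Store) : Exec B .skip s 1 s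
  | assign (s : Store) (x : ℕ) (e : Expr) (he : e.Fits B s) :
      Exec B (.assign x e) s (e.cost + 1) (s.setReg x (e.eval s))
  | store (s : Store) (a : ℕ) (i e : Expr) (hi : i.Fits B s) (he : e.Fits B s) :
      Exec B (.store a i e) s (i.cost + e.cost + 1) (s.setArr a (i.eval s) (e.eval s))
  | seq {p q : Prog} {s s' s'' : Store} {t t' : ℕ}
      (hp : Exec B p s t s') (hq : Exec B q s' t' s'') : Exec B (.seq p q) s (t + t') s''
  | ite_true {e : Expr} {p q : Prog} {s s' : Store} {t : ℕ} (hf : e.Fits B s)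
      (he : e.eval s ≠ 0) (hp : Exec B p s t s') : Exec B (.ite e p q) s (e.cost + 1 + t) s'
  | ite_false {e : Expr} {p q : Prog} {s s' : Store} {t : ℕ} (hf : e.Fits B s)
      (he : e.eval s = 0) (hq : Exec B q s t s') : Exec B (.ite e p q) s (e.cost + 1 + t) s'
  | loop_true {e : Expr} {p : Prog} {s s' s'' : Store} {t t' : ℕ} (hf : e.Fits B s)
      (he : e.eval s ≠ 0) (hp : Exec B p s t s') (hl : Exec B (.loop e p) s' t' s'') :
      Exec B (.loop e p) s (e.cost + 1 + t + t') s''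
  | loop_false {e : Expr} {p : Prog} {s : Store} (hf : e.Fits B s)
      (he : e.eval s = 0) : Exec B (.loop e p) s (e.cost + 1) s

/-! ## Input and output -/

/-- The initial store for an automaton with states `0, …, n - 1` and letters `0, …, m - 1`:
register `0` holds `n`, register `1` holds `m`, array `0` holds the transition table
(`q · a` at index `q * m + a`), and everything else is `0`. -/
def inputStore {n m : ℕ} (A : Automaton (Fin n) (Fin m)) : Store where
  reg := fun x => if x = 0 then n else if x = 1 then m else 0
  arr := fun a i =>
    if h : a = 0 ∧ i / m < n ∧ 0 < m then
      (A.step ⟨i / m, h.2.1⟩ ⟨i % m, Nat.mod_lt _ h.2.2⟩ : ℕ)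
    else 0

open Classical in
/-- The store `s` holds the graph `G`, whose vertices are nested sets over the states
`0, …, n - 1`: for an enumeration `φ` without repetitions of the vertices by `0, …, r - 1`,
register `0` holds `r`, entry `q` of array `0` is the number of the vertex whose leafage contains
the state `q`, and array `1` holds the `r × r` adjacency matrix, row by row. -/
def Holds {n k : ℕ} (s : Store) (G : Graph (Vtx (Fin n) k)) : Prop :=
  ∃ (r : ℕ) (φ : Fin r → Vtx (Fin n) k),
    Function.Injective φ ∧ Set.range φ = G.verts ∧
    s.reg 0 = r ∧
    (∀ (q : Fin n) (i : Fin r), s.arr 0 q = i ↔ q ∈ leafage k (φ i)) ∧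
    (∀ i j : Fin r, s.arr 1 (i * r + j) = if (φ i, φ j) ∈ G.edges then 1 else 0)

end ReachDFA

open ReachDFA

/-! The algorithm does not enumerate words; it follows what a word does to a single state. To a word
`w` of defect at most `k` and a state `q` belongs a node: the set excl(w), the state q·w, and one
bit telling whether q·w lies in dupl(w). A letter `a` acts on nodes. Indeed excl(wa) consists of the
states without an `a`-preimage outside excl(w), and q·wa is duplicate for wa iff q·w was duplicate
for w or q·wa has two `a`-preimages outside excl(w) (`Automaton.excl_snoc`,
`Automaton.act_mem_dupl_snoc`). The defect of a prefix never exceeds that of the word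
(`Automaton.ncard_excl_le_snoc`), so a search from the nodes (∅, q, 0) that drops all sets of more
than `k` states still finds every pair of a set excl(w) and a state of dupl(w) with `w` of defect at
most `k` (`visitTable_of_closed`). Sets of at most `k` states are coded by numbers below (n+1)^k.
Hence there are 2n(n+1)^k nodes, and the tables and the search take O(m n^(k+1)) steps.

The nested vertices never appear on the machine. The graph Γ_j is represented by a relation F on the
states (`Generates`): F-paths between states correspond to paths between their vertices, and F-pairs
between different vertices are the edges. The vertices of Γ_(j+1) are then the classes of mutual
F-reachability. F is updated by adding, for every set of j+1 mutually reachable states found as some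
excl(w), pairs from one of these states to the duplicate states found with the set; one source
suffices because the whole set lies in one vertex (`Marks.generates_one`, `Marks.generates_succ`).

Marking a level costs O(n^(k+1)) steps and a transitive closure O(n^3). No closure follows the last
level, so a cubic term occurs only for k ≥ 2, where n^3 ≤ n^(2k). The total is O(m n^(2k)); the
factor log n is slack (`time_mainProg_le`).

Programs are verified with a weakest-precondition calculus whose loops all count up to a protected
register, so that a time bound can be read off the program text. Stored numbers stay below a bound X
and expressions have at most 20 leaves, hence words below X^20 are enough. -/

namespace ReachDFA

/-! ## Expressions: notation and a uniform word-size bound -/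

instance : Add Expr := ⟨Expr.op .add⟩
instance : Sub Expr := ⟨Expr.op .sub⟩
instance : Mul Expr := ⟨Expr.op .mul⟩
instance : Div Expr := ⟨Expr.op .div⟩
instance : Mod Expr := ⟨Expr.op .mod⟩
instance (c : ℕ) : OfNat Expr c := ⟨Expr.lit c⟩

/-- The test for equality. -/
def Expr.eq (e f : Expr) : Expr := .op .eq e f

/-- The test for strict inequality. -/
def Expr.lt (e f : Expr) : Expr := .op .lt e f

/-- The negation of a test. -/
def Expr.not (e : Expr) : Expr := .op .eq e (.lit 0)

section EvalLemmas
variable (s : Store) (e f : Expr)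

@[simp] theorem Expr.eval_zero : (0 : Expr).eval s = 0 := rfl
@[simp] theorem Expr.eval_one : (1 : Expr).eval s = 1 := rfl
@[simp] theorem Expr.eval_two : (2 : Expr).eval s = 2 := rfl
@[simp] theorem Expr.eval_reg (x : ℕ) : (Expr.reg x).eval s = s.reg x := rfl
@[simp] theorem Expr.eval_cell (a : ℕ) : (Expr.cell a e).eval s = s.arr a (e.eval s) := rfl
@[simp] theorem Expr.eval_add : (e + f).eval s = e.eval s + f.eval s := rfl
@[simp] theorem Expr.eval_sub : (e - f).eval s = e.eval s - f.eval s := rfl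
@[simp] theorem Expr.eval_mul : (e * f).eval s = e.eval s * f.eval s := rfl
@[simp] theorem Expr.eval_div : (e / f).eval s = e.eval s / f.eval s := rfl
@[simp] theorem Expr.eval_mod : (e % f).eval s = e.eval s % f.eval s := rfl
@[simp] theorem Expr.eval_eq : (e.eq f).eval s = if e.eval s = f.eval s then 1 else 0 := rfl
@[simp] theorem Expr.eval_lt : (e.lt f).eval s = if e.eval s < f.eval s then 1 else 0 := rfl
@[simp] theorem Expr.eval_not : e.not.eval s = if e.eval s = 0 then 1 else 0 := rfl

end EvalLemmas

@[simp] theorem Store.setReg_reg (s : Store) (x v y : ℕ) :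
    (s.setReg x v).reg y = if y = x then v else s.reg y := by
  simp [Store.setReg, Function.update_apply]

@[simp] theorem Store.setReg_arr (s : Store) (x v : ℕ) : (s.setReg x v).arr = s.arr := rfl

@[simp] theorem Store.setArr_reg (s : Store) (a i v : ℕ) : (s.setArr a i v).reg = s.reg := rfl

theorem Store.setArr_arr_of_ne (s : Store) {a a' : ℕ} (i v : ℕ) (h : a' ≠ a) :
    (s.setArr a i v).arr a' = s.arr a' := by
  simp [Store.setArr, h]

@[simp] theorem Store.setArr_arr (s : Store) (a i v a' : ℕ) :
    (s.setArr a i v).arr a' = if a' = a then Function.update (s.arr a) i v else s.arr a' := by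
  by_cases h : a' = a
  · subst h; simp [Store.setArr]
  · simp [Store.setArr, h]

/-- The number of leaves of an expression outside array indices, and at least that of each index. -/
def Expr.weight : Expr → ℕ
  | .lit _ => 1
  | .reg _ => 1
  | .cell _ i => i.weight
  | .op _ e f => e.weight + f.weight

/-- All literals are at most `2`. -/
def Expr.smallLits : Expr → Bool
  | .lit c => c ≤ 2
  | .reg _ => true
  | .cell _ i => i.smallLits
  | .op _ e f => e.smallLits && f.smallLits

/-- Expressions with small literals and at most `20` leaves. -/
def Expr.Ok (e : Expr) : Prop := (e.smallLits && e.weight ≤ 20) = true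

/-- All registers and cells hold numbers below `X`. -/
def Store.Bdd (X : ℕ) (s : Store) : Prop := (∀ x, s.reg x < X) ∧ ∀ a i, s.arr a i < X

theorem Store.Bdd.setReg {X : ℕ} {s : Store} (h : s.Bdd X) {x v : ℕ} (hv : v < X) :
    (s.setReg x v).Bdd X := by
  refine ⟨fun y => ?_, h.2⟩
  rw [Store.setReg_reg]; split_ifs
  · exact hv
  · exact h.1 y

theorem Store.Bdd.setArr {X : ℕ} {s : Store} (h : s.Bdd X) {a i v : ℕ} (hv : v < X) :
    (s.setArr a i v).Bdd X := by
  refine ⟨h.1, fun a' j => ?_⟩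
  rw [Store.setArr_arr]; split_ifs
  · rw [Function.update_apply]; split_ifs
    · exact hv
    · exact h.2 a j
  · exact h.2 a' j

theorem Expr.weight_pos (e : Expr) : 1 ≤ e.weight := by
  induction e with
  | lit => exact le_rfl
  | reg => exact le_rfl
  | cell a i ih => exact ih
  | op o e f ihe ihf => exact le_add_right ihe

/-- Multiplication is the worst operation, so upper bounds multiply and exponents add along an
expression. The condition `2 ≤ u` is there for comparisons, whose value `1` must stay below the
product. -/
theorem Op.eval_lt_mul (o : Op) {x y u v : ℕ} (hx : x < u) (hy : y < v) (h : 2 ≤ u) :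
    o.eval x y < u * v := by
  have huv : u ≤ u * v := Nat.le_mul_of_pos_right _ (by omega)
  cases o with
  | add => simp only [Op.eval]; nlinarith
  | sub => simp only [Op.eval]; omega
  | mul => exact Nat.mul_lt_mul'' hx hy
  | div => exact (Nat.div_le_self x y).trans_lt (by omega)
  | mod => exact (Nat.mod_le x y).trans_lt (by omega)
  | eq => simp only [Op.eval]; split_ifs <;> omega
  | lt => simp only [Op.eval]; split_ifs <;> omega

theorem Expr.eval_lt_pow {X : ℕ} (hX : 2 < X) {s : Store} (hs : s.Bdd X) (e : Expr)
    (h : e.smallLits = true) : e.eval s < X ^ e.weight := by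
  induction e with
  | lit c =>
    simp only [smallLits, decide_eq_true_eq] at h
    simp only [eval, weight, pow_one]; omega
  | reg x => simpa [eval, weight] using hs.1 x
  | cell a i ih => exact (hs.2 a _).trans_le (Nat.le_self_pow (i.weight_pos.trans_lt' one_pos).ne' X)
  | op o e f ihe ihf =>
    simp only [smallLits, Bool.and_eq_true] at h
    simp only [eval, weight, pow_add]
    refine o.eval_lt_mul (ihe h.1) (ihf h.2) ?_
    exact hX.le.trans (Nat.le_self_pow (e.weight_pos.trans_lt' one_pos).ne' X)

theorem Expr.fits_of_bdd {X B W : ℕ} (hX : 2 < X) (hB : X ^ W ≤ B) {s : Store} (hs : s.Bdd X)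
    (e : Expr) (h : e.smallLits = true) (hw : e.weight ≤ W) : e.Fits B s := by
  have key : ∀ f : Expr, f.smallLits = true → f.weight ≤ W → f.eval s < B := fun f hf hfw =>
    (f.eval_lt_pow hX hs hf).trans_le ((Nat.pow_le_pow_right (by omega) hfw).trans hB)
  induction e with
  | lit c => exact key _ h hw
  | reg x => exact key _ h hw
  | cell a i ih => exact ⟨ih h hw, key (.cell a i) h hw⟩
  | op o e f ihe ihf =>
    have h' := h
    simp only [smallLits, Bool.and_eq_true] at h'
    have hw' : e.weight + f.weight ≤ W := hw
    exact ⟨ihe h'.1 (by omega), ihf h'.2 (by omega), key _ h hw⟩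

/-! ## Frames -/

/-- The registers written by a program. -/
def Prog.writesReg : Prog → ℕ → Prop
  | .skip, _ => False
  | .assign x _, y => y = x
  | .store _ _ _, _ => False
  | .seq p q, y => p.writesReg y ∨ q.writesReg y
  | .ite _ p q, y => p.writesReg y ∨ q.writesReg y
  | .loop _ p, y => p.writesReg y

/-- The arrays written by a program. -/
def Prog.writesArr : Prog → ℕ → Prop
  | .skip, _ => False
  | .assign _ _, _ => False
  | .store a _ _, b => b = a
  | .seq p q, b => p.writesArr b ∨ q.writesArr b
  | .ite _ p q, b => p.writesArr b ∨ q.writesArr b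
  | .loop _ p, b => p.writesArr b

/-- Two stores differ only where the program writes. -/
def Frame (p : Prog) (s s' : Store) : Prop :=
  (∀ x, ¬ p.writesReg x → s'.reg x = s.reg x) ∧ ∀ a, ¬ p.writesArr a → s'.arr a = s.arr a

/-- What a program leaves alone is read off its text. Specifications therefore describe only the
changes, and every other register or array is transported by `simp` on the write sets. -/
theorem Exec.frame {B : ℕ} {p : Prog} {s s' : Store} {t : ℕ} (h : Exec B p s t s') :
    Frame p s s' := by
  induction h with
  | skip s => exact ⟨fun _ _ => rfl, fun _ _ => rfl⟩
  | assign s x e he =>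
    refine ⟨fun y hy => ?_, fun _ _ => rfl⟩
    rw [Store.setReg_reg, if_neg (show ¬ y = x from hy)]
  | store s a i e hi he =>
    exact ⟨fun _ _ => rfl, fun b hb => s.setArr_arr_of_ne _ _ hb⟩
  | seq hp hq ihp ihq =>
    refine ⟨fun x hx => ?_, fun a ha => ?_⟩
    · rw [ihq.1 x (fun h => hx (Or.inr h)), ihp.1 x (fun h => hx (Or.inl h))]
    · rw [ihq.2 a (fun h => ha (Or.inr h)), ihp.2 a (fun h => ha (Or.inl h))]
  | ite_true hf he hp ih =>
    exact ⟨fun x hx => ih.1 x (fun h => hx (Or.inl h)), fun a ha => ih.2 a (fun h => ha (Or.inl h))⟩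
  | ite_false hf he hp ih =>
    exact ⟨fun x hx => ih.1 x (fun h => hx (Or.inr h)), fun a ha => ih.2 a (fun h => ha (Or.inr h))⟩
  | loop_true hf he hp hl ihp ihl =>
    exact ⟨fun x hx => (ihl.1 x hx).trans (ihp.1 x hx), fun a ha => (ihl.2 a ha).trans (ihp.2 a ha)⟩
  | loop_false hf he => exact ⟨fun _ _ => rfl, fun _ _ => rfl⟩

/-! ## Weakest preconditions with time bounds -/

/-- The value in `β` of the register that bounds a loop counter. -/
def Expr.bound (β : ℕ → ℕ) : Expr → ℕ
  | .op .lt _ (.reg b) => β b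
  -- A junk value for tests of any other shape. It is harmless, since `WP` includes a proof that the
  -- running time obeys `Prog.time`.
  | _ => 0

/-- A bound on the running time of programs all of whose loops are counting loops,
where `β` holds the values of the bounding registers. -/
def Prog.time (β : ℕ → ℕ) : Prog → ℕ
  | .skip => 1
  | .assign _ e => e.cost + 1
  | .store _ i e => i.cost + e.cost + 1
  | .seq p q => p.time β + q.time β
  | .ite e p q => e.cost + 1 + (p.time β + q.time β)
  | .loop e p => e.bound β * (p.time β + (e.cost + 1)) + (e.cost + 1)

/-- The setting of a verification: word bound, bound on stored numbers, and the constant values of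
the registers below `lo`. -/
structure Setting where
  B : ℕ
  X : ℕ
  lo : ℕ
  β : ℕ → ℕ
  two_lt : 2 < X
  pow_le : X ^ 20 ≤ B

/-- Stores with bounded contents and the prescribed constants. -/
def Setting.WF (Γ : Setting) (s : Store) : Prop :=
  s.Bdd Γ.X ∧ ∀ x < Γ.lo, s.reg x = Γ.β x

/-- From a well-formed store `s`, the program `p` halts within its time bound in a well-formed store
that satisfies `Q`. -/
def WP (Γ : Setting) (p : Prog) (s : Store) (Q : Store → Prop) : Prop :=
  Γ.WF s → ∃ t s', Exec Γ.B p s t s' ∧ t ≤ p.time Γ.β ∧ Γ.WF s' ∧ Q s'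

section Rules
variable {Γ : Setting} {s : Store} {Q : Store → Prop} {p q : Prog} {e : Expr}

/-- Word size is never discussed again in individual programs: `Expr.Ok` is a Boolean equation and
is settled by `rfl` for each concrete expression. -/
theorem Setting.fits (hs : Γ.WF s) (he : e.Ok) : e.Fits Γ.B s := by
  simp only [Expr.Ok, Bool.and_eq_true, decide_eq_true_eq] at he
  exact e.fits_of_bdd Γ.two_lt Γ.pow_le hs.1 he.1 he.2

/-- The rule for composing specifications: besides the proved postcondition, the frame of the run is
made available to the continuation. -/
theorem wp_mono {Q' : Store → Prop} (h : WP Γ p s Q')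
    (hQ : ∀ s', Γ.WF s' → Frame p s s' → Q' s' → Q s') : WP Γ p s Q := by
  intro hs
  obtain ⟨t, s', he, ht, hw, hq⟩ := h hs
  exact ⟨t, s', he, ht, hw, hQ s' hw he.frame hq⟩

theorem wp_skip (hQ : Q s) : WP Γ .skip s Q := fun hs => ⟨1, s, .skip s, le_rfl, hs, hQ⟩

theorem wp_assign {x : ℕ} (he : e.Ok) (hx : Γ.lo ≤ x) (hv : Γ.WF s → e.eval s < Γ.X)
    (hQ : Q (s.setReg x (e.eval s))) : WP Γ (.assign x e) s Q := by
  intro hs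
  refine ⟨_, _, .assign s x e (Setting.fits hs he), le_rfl, ⟨hs.1.setReg (hv hs), ?_⟩, hQ⟩
  intro y hy
  rw [Store.setReg_reg, if_neg (by omega), hs.2 y hy]

theorem wp_store {a : ℕ} {i : Expr} (hi : i.Ok) (he : e.Ok) (hv : Γ.WF s → e.eval s < Γ.X)
    (hQ : Q (s.setArr a (i.eval s) (e.eval s))) : WP Γ (.store a i e) s Q :=
  fun hs => ⟨_, _, .store s a i e (Setting.fits hs hi) (Setting.fits hs he), le_rfl,
    ⟨hs.1.setArr (hv hs), hs.2⟩, hQ⟩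

theorem wp_seq (h : WP Γ p s (fun s' => WP Γ q s' Q)) : WP Γ (.seq p q) s Q := by
  intro hs
  obtain ⟨t, s', he, ht, hw, hq⟩ := h hs
  obtain ⟨t', s'', he', ht', hw', hq'⟩ := hq hw
  exact ⟨_, _, .seq he he', Nat.add_le_add ht ht', hw', hq'⟩

theorem wp_ite (he : e.Ok) (hp : e.eval s ≠ 0 → WP Γ p s Q) (hq : e.eval s = 0 → WP Γ q s Q) :
    WP Γ (.ite e p q) s Q := by
  intro hs
  by_cases h : e.eval s = 0
  · obtain ⟨t, s', hex, ht, hw, hQ⟩ := hq h hs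
    exact ⟨_, _, .ite_false (Setting.fits hs he) h hex, by simp only [Prog.time]; omega, hw, hQ⟩
  · obtain ⟨t, s', hex, ht, hw, hQ⟩ := hp h hs
    exact ⟨_, _, .ite_true (Setting.fits hs he) h hex, by simp only [Prog.time]; omega, hw, hQ⟩

/-- `if e then p`. -/
def Prog.whenever (e : Expr) (p : Prog) : Prog := .ite e p .skip

theorem wp_whenever (he : e.Ok) (hp : e.eval s ≠ 0 → WP Γ p s Q) (hq : e.eval s = 0 → Q s) :
    WP Γ (.whenever e p) s Q :=
  wp_ite he hp (fun h => wp_skip (hq h))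

/-- `for i = 0, …, b - 1 do p`, where `i` and `b` are registers. -/
def Prog.forTo (i b : ℕ) (p : Prog) : Prog :=
  .seq (.assign i (.lit 0))
    (.loop ((Expr.reg i).lt (.reg b)) (.seq p (.assign i (Expr.reg i + 1))))

/-- The rule for counting loops: `I j` holds whenever the counter is `j`. -/
theorem wp_forTo {i b : ℕ} (I : ℕ → Store → Prop) (hb : b < Γ.lo) (hi : Γ.lo ≤ i)
    (hpi : ¬ p.writesReg i)
    (h0 : I 0 (s.setReg i 0))
    (hstep : ∀ j < Γ.β b, ∀ s', Γ.WF s' → s'.reg i = j → Frame (.forTo i b p) s s' → I j s' →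
      WP Γ p s' (fun s'' => I (j + 1) (s''.setReg i (j + 1))))
    (hQ : ∀ s', Γ.WF s' → Frame (.forTo i b p) s s' → I (Γ.β b) s' → Q s') :
    WP Γ (.forTo i b p) s Q := by
  have hX := Γ.two_lt
  have loop : ∀ r j s', j + r = Γ.β b → s'.reg i = j → Γ.WF s' → Frame (.forTo i b p) s s' →
      I j s' → ∃ t s'', Exec Γ.B (.loop ((Expr.reg i).lt (.reg b))
        (.seq p (.assign i (Expr.reg i + 1)))) s' t s'' ∧
        t ≤ r * (p.time Γ.β + 4 + 4) + 4 ∧ Γ.WF s'' ∧ Frame (.forTo i b p) s s'' ∧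
        I (Γ.β b) s'' := by
    intro r
    induction r with
    | zero =>
      intro j s' hj hij hw hf hI
      refine ⟨_, s', .loop_false (Setting.fits hw (by rfl)) ?_, ?_, hw, hf, ?_⟩
      · simp only [Expr.eval_lt, Expr.eval_reg, hij, hw.2 b hb]
        rw [if_neg (by omega)]
      · simp only [Expr.lt, Expr.cost]; omega
      · rwa [← hj]
    | succ r ih =>
      intro j s' hj hij hw hf hI
      obtain ⟨t, s₁, he, ht, hw₁, hI₁⟩ := hstep j (by omega) s' hw hij hf hI hw
      have hij₁ : s₁.reg i = j := by rw [he.frame.1 i hpi, hij]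
      have hw₂ : Γ.WF (s₁.setReg i (j + 1)) := by
        refine ⟨hw₁.1.setReg ?_, fun y hy => ?_⟩
        -- The incremented counter is at most the content of register `b`, which is itself below
        -- `X`.
        · have := hw₁.1.1 b
          rw [hw₁.2 b hb] at this
          omega
        · rw [Store.setReg_reg, if_neg (by omega), hw₁.2 y hy]
      have hass : Exec Γ.B (.assign i (Expr.reg i + 1)) s₁ 4 (s₁.setReg i (j + 1)) := by
        have := Exec.assign (B := Γ.B) s₁ i (Expr.reg i + 1) (Setting.fits hw₁ (by rfl))
        rw [Expr.eval_add, Expr.eval_reg, Expr.eval_one, hij₁] at this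
        exact this
      have hf₂ : Frame (.forTo i b p) s (s₁.setReg i (j + 1)) := by
        have hfl : Frame (.seq p (.assign i (Expr.reg i + 1))) s' (s₁.setReg i (j + 1)) :=
          (Exec.seq he hass).frame
        refine ⟨fun x hx => ?_, fun a ha => ?_⟩
        · rw [hfl.1 x (fun h => hx (Or.inr h)), hf.1 x hx]
        · rw [hfl.2 a (fun h => ha (Or.inr h)), hf.2 a ha]
      obtain ⟨t', s'', he', ht', hw', hf', hI'⟩ :=
        ih (j + 1) _ (by omega) (by simp) hw₂ hf₂ hI₁
      refine ⟨_, s'', .loop_true (Setting.fits hw (by rfl)) ?_ (.seq he hass) he', ?_, hw', hf', hI'⟩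
      · simp only [Expr.eval_lt, Expr.eval_reg, hij, hw.2 b hb]
        rw [if_pos (by omega)]; exact one_ne_zero
      · have : (r + 1) * (p.time Γ.β + 4 + 4) = r * (p.time Γ.β + 4 + 4) + (p.time Γ.β + 4 + 4) := by
          ring
        simp only [Expr.lt, Expr.cost]; omega
  intro hs
  have hass : Exec Γ.B (.assign i (.lit 0)) s 2 (s.setReg i 0) :=
    Exec.assign (B := Γ.B) s i (.lit 0) (Setting.fits hs (by rfl))
  have hw₀ : Γ.WF (s.setReg i 0) := by
    refine ⟨hs.1.setReg (by omega), fun y hy => ?_⟩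
    rw [Store.setReg_reg, if_neg (by omega), hs.2 y hy]
  obtain ⟨t, s', he, ht, hw, hf, hI⟩ := loop (Γ.β b) 0 (s.setReg i 0) (by simp) (by simp) hw₀
    ⟨fun x hx => hass.frame.1 x (fun h => hx (Or.inl h)), fun a _ => rfl⟩ h0
  refine ⟨_, s', .seq hass he, ?_, hw, hQ s' hw hf hI⟩
  have hT : (Prog.forTo i b p).time Γ.β = 2 + (Γ.β b * (p.time Γ.β + 4 + 4) + 4) := rfl
  omega

end Rules

open Prog

/-! ## Double loops -/

/-- The two counters are merged into the row-major index `y * β b' + z`, so one invariant serves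
both loops. `hI` asks that it ignore the counter registers, which are rewritten between its uses. -/
theorem wp_forTo₂ {Γ : Setting} {s : Store} {Q : Store → Prop} {p : Prog} {i b i' b' : ℕ}
    (I : ℕ → Store → Prop) (hb : b < Γ.lo) (hi : Γ.lo ≤ i) (hb' : b' < Γ.lo) (hi' : Γ.lo ≤ i')
    (hii : i ≠ i') (hpi : ¬ p.writesReg i) (hpi' : ¬ p.writesReg i')
    (hI : ∀ j s x v, x = i ∨ x = i' → I j s → I j (s.setReg x v))
    (h0 : I 0 s)
    (hstep : ∀ y < Γ.β b, ∀ z < Γ.β b', ∀ s', Γ.WF s' → s'.reg i = y → s'.reg i' = z →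
      Frame (.forTo i b (.forTo i' b' p)) s s' → I (y * Γ.β b' + z) s' →
      WP Γ p s' (fun s'' => I (y * Γ.β b' + z + 1) s''))
    (hQ : ∀ s', Γ.WF s' → Frame (.forTo i b (.forTo i' b' p)) s s' → I (Γ.β b * Γ.β b') s' → Q s') :
    WP Γ (.forTo i b (.forTo i' b' p)) s Q := by
  refine wp_forTo (fun j => I (j * Γ.β b')) hb hi ?_ ?_ ?_ hQ
  · rintro (h | h | h)
    · exact hii h
    · exact hpi h
    · exact hii h
  · rw [Nat.zero_mul]; exact hI _ _ _ _ (Or.inl rfl) h0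
  · intro y hy s₁ hw₁ hr₁ hf₁ hI₁
    refine wp_forTo (fun j => I (y * Γ.β b' + j)) hb' hi' hpi' ?_ ?_ ?_
    · exact hI _ _ _ _ (Or.inr rfl) hI₁
    · intro z hz s₂ hw₂ hr₂ hf₂ hI₂
      refine wp_mono (hstep y hy z hz s₂ hw₂ ?_ hr₂ ?_ hI₂) ?_
      · rw [hf₂.1 i, hr₁]
        rintro (h | h | h)
        · exact hii h
        · exact hpi h
        · exact hii h
      · refine ⟨fun x hx => ?_, fun a ha => ?_⟩
        · rw [hf₂.1 x, hf₁.1 x hx]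
          exact fun h => hx (Or.inr (Or.inl h))
        · rw [hf₂.2 a, hf₁.2 a ha]
          exact fun h => ha (Or.inr (Or.inl h))
      · intro s₃ _ _ h₃
        exact hI _ _ _ _ (Or.inr rfl) h₃
    · intro s₂ _ _ h₂
      rw [show (y + 1) * Γ.β b' = y * Γ.β b' + Γ.β b' by ring]
      exact hI _ _ _ _ (Or.inl rfl) h₂

theorem row_major_inj {n y z y' z' : ℕ} (hz : z < n) (hz' : z' < n)
    (h : y * n + z = y' * n + z') : y = y' ∧ z = z' := by
  have h1 : (y * n + z) / n = y := by
    rw [mul_comm, Nat.mul_add_div (by omega), Nat.div_eq_of_lt hz, add_zero]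
  have h2 : (y' * n + z') / n = y' := by
    rw [mul_comm, Nat.mul_add_div (by omega), Nat.div_eq_of_lt hz', add_zero]
  have : y = y' := by rw [← h1, ← h2, h]
  subst this
  exact ⟨rfl, by omega⟩

theorem row_major_lt {n N y z : ℕ} (hz : z < n) (hy : y < N) : y * n + z < N * n := by
  have : (y + 1) * n ≤ N * n := Nat.mul_le_mul_right n hy
  rw [add_mul] at this
  omega

theorem row_major_div {n y z : ℕ} (hz : z < n) : (y * n + z) / n = y := by
  rw [mul_comm, Nat.mul_add_div (by omega), Nat.div_eq_of_lt hz, add_zero]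

theorem row_major_mod {n y z : ℕ} (hz : z < n) : (y * n + z) % n = z := by
  rw [mul_comm, Nat.mul_add_mod, Nat.mod_eq_of_lt hz]

/-! ## The registers of constants -/

/-- The constants in the registers `0, …, 9`. -/
def consts (n m k : ℕ) : ℕ → ℕ
  | 0 => n
  | 1 => m
  | 2 => k
  | 3 => n + 1
  | 4 => (n + 1) ^ k
  | 5 => (n + 1) ^ k * (n + 1)
  | 6 => (n + 1) ^ k * m
  | 7 => (n + 1) ^ k * m * n
  | 8 => (n + 1) ^ k * n * 2
  | 9 => k - 1
  | _ => 0

/-- The setting in which the registers `0, …, 9` hold the constants. -/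
structure Setting.Std (Γ : Setting) (n m k : ℕ) : Prop where
  lo : Γ.lo = 10
  β : Γ.β = consts n m k
  n_pos : 0 < n
  lt₇ : (n + 1) ^ k * m * n + 1 < Γ.X
  lt₈ : (n + 1) ^ k * n * 2 + 1 < Γ.X

namespace Setting.Std
variable {Γ : Setting} {n m k : ℕ} (h : Γ.Std n m k) {s : Store} (hs : Γ.WF s)
include h hs

theorem reg₀ : s.reg 0 = n := by rw [hs.2 0 (by rw [h.lo]; omega), h.β]; rfl
theorem reg₁ : s.reg 1 = m := by rw [hs.2 1 (by rw [h.lo]; omega), h.β]; rfl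
theorem reg₂ : s.reg 2 = k := by rw [hs.2 2 (by rw [h.lo]; omega), h.β]; rfl
theorem reg₃ : s.reg 3 = n + 1 := by rw [hs.2 3 (by rw [h.lo]; omega), h.β]; rfl

end Setting.Std

/-! ## The tables -/

/-- Membership table: cell `c * (n + 1) + d` of array `2` tells whether `d` is a digit of `c`. -/
def memProg : Prog :=
  .forTo 10 5 (.whenever
    ((Expr.reg 10 / .reg 3) * (((Expr.reg 10 / .reg 3) % .reg 3).eq (.reg 10 % .reg 3) +
      .cell 2 (Expr.reg 10 / .reg 3 / .reg 3 * .reg 3 + .reg 10 % .reg 3)))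
    (.store 2 (.reg 10) 1))

/-- Dynamic programming on the code `c = x / (n + 1)`: a digit of `c ≠ 0` is its last digit or a
digit of `c / (n + 1)`. The factor `c` in the test excludes `c = 0`, which has no digits. -/
theorem wp_memProg {Γ : Setting} {n m k : ℕ} (h : Γ.Std n m k) {s : Store}
    (hs : ∀ i, s.arr 2 i = 0) :
    WP Γ memProg s (fun s' => ∀ x < (n + 1) ^ k * (n + 1),
      s'.arr 2 x ≠ 0 ↔ x % (n + 1) ∈ Nat.digits (n + 1) (x / (n + 1))) := by
  have hn := h.n_pos
  refine wp_forTo (fun j s' => (∀ x < j, s'.arr 2 x ≠ 0 ↔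
    x % (n + 1) ∈ Nat.digits (n + 1) (x / (n + 1))) ∧ ∀ x, j ≤ x → s'.arr 2 x = 0)
    (by rw [h.lo]; omega) h.lo.le (by simp [whenever, writesReg])
    ⟨by simp, fun x _ => hs x⟩ ?_ (fun s' _ _ hI => by simpa [h.β, consts] using hI.1)
  rintro j hj s₁ hw hr - ⟨hI, hI'⟩
  have hj0 := hI' j le_rfl
  have key : ((Expr.reg 10 / .reg 3) * (((Expr.reg 10 / .reg 3) % .reg 3).eq (.reg 10 % .reg 3) +
      .cell 2 (Expr.reg 10 / .reg 3 / .reg 3 * .reg 3 + .reg 10 % .reg 3))).eval s₁ ≠ 0 ↔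
      j % (n + 1) ∈ Nat.digits (n + 1) (j / (n + 1)) := by
    simp only [Expr.eval_mul, Expr.eval_div, Expr.eval_reg, hr, h.reg₃ hw, Expr.eval_add,
      Expr.eval_eq, Expr.eval_mod, Expr.eval_cell]
    rcases Nat.eq_zero_or_pos (j / (n + 1)) with h0 | h0
    · simp [h0]
    · rw [Nat.digits_def' (by omega) h0, List.mem_cons, mul_ne_zero_iff]
      -- The table cell consulted for the shorter code has a smaller index, so it has been filled
      -- already.
      have hlt : j / (n + 1) / (n + 1) * (n + 1) + j % (n + 1) < j := by
        have h1 : j / (n + 1) / (n + 1) < j / (n + 1) := Nat.div_lt_self h0 (by omega)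
        have h2 := Nat.div_add_mod j (n + 1)
        have h3 : j / (n + 1) / (n + 1) * (n + 1) < j / (n + 1) * (n + 1) :=
          Nat.mul_lt_mul_of_pos_right h1 (by omega)
        rw [mul_comm] at h2
        omega
      have h4 := hI _ hlt
      rw [row_major_mod (Nat.mod_lt _ (by omega)), row_major_div (Nat.mod_lt _ (by omega))] at h4
      rw [← h4, eq_comm (a := j % (n + 1))]
      by_cases h5 : j / (n + 1) % (n + 1) = j % (n + 1) <;>
        simp [h5, h0.ne', -Nat.div_eq_zero_iff]
  refine wp_whenever (by rfl) (fun he => wp_store (by rfl) (by rfl) (fun _ => ?_) ⟨?_, ?_⟩)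
    (fun he => ⟨?_, ?_⟩)
  · have := Γ.two_lt
    simp; omega
  · intro x hx
    simp only [Store.setReg_arr, Store.setArr_arr, if_true, Expr.eval_reg, hr, Expr.eval_one,
      Function.update_apply]
    split_ifs with hxj
    · subst hxj; simpa using key.1 he
    · exact hI x (by omega)
  · intro x hx
    simp only [Store.setReg_arr, Store.setArr_arr, if_true, Expr.eval_reg, hr,
      Function.update_apply]
    rw [if_neg (by omega)]
    exact hI' x (by omega)
  · intro x hx
    simp only [Store.setReg_arr]
    rcases Nat.lt_succ_iff_lt_or_eq.1 hx with h1 | h1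
    · exact hI x h1
    · subst h1
      rw [← key]; simp [he, hj0]
  · exact fun x hx => hI' x (by omega)

/-- Counting table: cell `(c * m + a) * n + p` of array `3` is the number of states `q` with
`q · a = p` whose successor is not a digit of `c`. -/
def cntProg : Prog :=
  .forTo 10 7 (.whenever
    (Expr.not (.cell 2 (Expr.reg 10 / .reg 0 / .reg 1 * .reg 3 + .reg 10 % .reg 0 + 1)))
    (.store 3 (Expr.reg 10 / .reg 0 * .reg 0 +
        .cell 0 (Expr.reg 10 % .reg 0 * .reg 1 + Expr.reg 10 / .reg 0 % .reg 1))
      (.cell 3 (Expr.reg 10 / .reg 0 * .reg 0 +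
        .cell 0 (Expr.reg 10 % .reg 0 * .reg 1 + Expr.reg 10 / .reg 0 % .reg 1)) + 1)))

/-- The counter `x = (c * m + a) * n + q` runs through all triples, and each one with `q` outside
`c` adds one to the cell of `q · a` in the same row. The specification is left as a raw cardinality
over these indices; its meaning is extracted in `cntTable_of_card`. -/
theorem wp_cntProg {Γ : Setting} {n m k : ℕ} (h : Γ.Std n m k) {s : Store}
    (hs : ∀ i, s.arr 3 i = 0) :
    WP Γ cntProg s (fun s' => ∀ y, s'.arr 3 y =
      ((Finset.range ((n + 1) ^ k * m * n)).filter (fun x =>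
        s.arr 2 (x / n / m * (n + 1) + x % n + 1) = 0 ∧
        x / n * n + s.arr 0 (x % n * m + x / n % m) = y)).card) := by
  have hn := h.n_pos
  refine wp_forTo (fun j s' => ∀ y, s'.arr 3 y =
      ((Finset.range j).filter (fun x =>
        s.arr 2 (x / n / m * (n + 1) + x % n + 1) = 0 ∧
        x / n * n + s.arr 0 (x % n * m + x / n % m) = y)).card)
    (by rw [h.lo]; omega) h.lo.le (by simp [whenever, writesReg])
    (by simpa using hs) ?_ (fun s' _ _ hI => by simpa [h.β, consts] using hI)
  intro j hj s₁ hw hr hf hI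
  have h2 : s₁.arr 2 = s.arr 2 := hf.2 2 (by simp [forTo, whenever, writesArr])
  have h0 : s₁.arr 0 = s.arr 0 := hf.2 0 (by simp [forTo, whenever, writesArr])
  refine wp_whenever (by rfl) (fun he => wp_store (by rfl) (by rfl) (fun _ => ?_) ?_)
    (fun he => ?_)
  · simp only [Expr.eval_add, Expr.eval_cell, Expr.eval_one, hI]
    -- An entry counts some of the first `j` indices, so the incremented value still lies below `X`.
    have hc := Finset.card_filter_le (Finset.range j) (fun x =>
        s.arr 2 (x / n / m * (n + 1) + x % n + 1) = 0 ∧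
        x / n * n + s.arr 0 (x % n * m + x / n % m) =
        Expr.eval s₁ (Expr.reg 10 / .reg 0 * .reg 0) +
        s₁.arr 0 (Expr.eval s₁ (Expr.reg 10 % .reg 0 * .reg 1) +
          Expr.eval s₁ (Expr.reg 10 / .reg 0 % .reg 1)))
    rw [Finset.card_range] at hc
    have := h.lt₇
    simp only [h.β, consts] at hj
    omega
  · intro y
    simp only [Expr.eval_not, Expr.eval_add, Expr.eval_mul, Expr.eval_div, Expr.eval_mod,
      Expr.eval_cell, Expr.eval_reg, Expr.eval_one, hr, h.reg₀ hw, h.reg₁ hw, h.reg₃ hw, h2,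
      h0] at he ⊢
    simp only [Store.setReg_arr, Store.setArr_arr, if_true, Function.update_apply]
    rw [Finset.range_add_one, Finset.filter_insert]
    split_ifs at he with hm
    · split_ifs with hy hy' hy'
      · rw [Finset.card_insert_of_notMem (by simp), hI, hy]
      · exact absurd ⟨hm, hy.symm⟩ hy'
      · exact absurd hy'.2.symm hy
      · exact hI y
    · exact absurd rfl he
  · intro y
    simp only [Expr.eval_not, Expr.eval_add, Expr.eval_mul, Expr.eval_div, Expr.eval_mod,
      Expr.eval_cell, Expr.eval_reg, Expr.eval_one, hr, h.reg₀ hw, h.reg₁ hw, h.reg₃ hw, h2] at he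
    split_ifs at he with hm
    rw [Store.setReg_arr, Finset.range_add_one, Finset.filter_insert, if_neg (fun h => hm h.1), hI y]

/-- Successor table: if at most `k` cells of the row `y` of array `3` vanish, then cell `y` of
array `4` is the successor of a number with exactly the indices of these cells, increased by one,
as digits; otherwise it is `0`. -/
def nextProg : Prog :=
  .forTo 10 6 (.seq (.assign 12 0) (.seq (.assign 13 0) (.seq
    (.forTo 11 0 (.whenever (Expr.not (.cell 3 (Expr.reg 10 * .reg 0 + .reg 11)))
      (.seq (.whenever ((Expr.reg 13).lt (.reg 2))
          (.assign 12 (Expr.reg 12 * .reg 3 + (.reg 11 + 1))))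
        (.assign 13 (Expr.reg 13 + 1)))))
    (.whenever ((Expr.reg 13).lt (.reg 2 + 1)) (.store 4 (.reg 10) (.reg 12 + 1))))))

/-- The contents of a cell of the successor table. -/
def NextSpec (n k : ℕ) (row : ℕ → ℕ) (v : ℕ) : Prop :=
  (((Finset.range n).filter (fun p => row p = 0)).card ≤ k → ∃ e < (n + 1) ^ k, v = e + 1 ∧
    ∀ d, d ∈ Nat.digits (n + 1) e ↔ ∃ p < n, row p = 0 ∧ d = p + 1) ∧
  (k < ((Finset.range n).filter (fun p => row p = 0)).card → v = 0)

/-- Row `y` belongs to a code and a letter, and its zero cells are the next excluded states.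
Register `13` counts them all, while the code in register `12` stops growing after `k` of them and
so stays below `(n + 1) ^ k`; it is used only if the count shows that nothing was omitted. Storing
the code plus one leaves `0` to mean that there is no successor. -/
theorem wp_nextProg {Γ : Setting} {n m k : ℕ} (h : Γ.Std n m k) {s : Store}
    (hs : ∀ i, s.arr 4 i = 0) :
    WP Γ nextProg s (fun s' => ∀ y < (n + 1) ^ k * m,
      NextSpec n k (fun p => s.arr 3 (y * n + p)) (s'.arr 4 y)) := by
  have hn := h.n_pos
  have hX := Γ.two_lt
  refine wp_forTo (fun j s' => (∀ y < j,
      NextSpec n k (fun p => s.arr 3 (y * n + p)) (s'.arr 4 y)) ∧ ∀ y, j ≤ y → s'.arr 4 y = 0)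
    (by rw [h.lo]; omega) h.lo.le (by simp [whenever, writesReg, forTo])
    (by simpa using hs) ?_ (fun s' _ _ hI => by simpa [h.β, consts] using hI.1)
  rintro j hj s₁ hw hr hf ⟨hI, hI'⟩
  have h3 : s₁.arr 3 = s.arr 3 := hf.2 3 (by simp [forTo, whenever, writesArr])
  have hX4 : (n + 1) ^ k + 1 < Γ.X := by
    have := h.lt₈
    have : (n + 1) ^ k ≤ (n + 1) ^ k * n := Nat.le_mul_of_pos_right _ hn
    omega
  refine wp_seq (wp_assign (by rfl) (by rw [h.lo]; omega) (fun _ => by simp; omega) ?_)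
  refine wp_seq (wp_assign (by rfl) (by rw [h.lo]; omega) (fun _ => by simp; omega) ?_)
  refine wp_seq ?_
  let Z : ℕ → Finset ℕ := fun i => (Finset.range i).filter (fun p => s.arr 3 (j * n + p) = 0)
  refine wp_forTo (fun i s' => s'.reg 13 = (Z i).card ∧ ((Z i).card ≤ k →
      s'.reg 12 < (n + 1) ^ (Z i).card ∧
      ∀ d, d ∈ Nat.digits (n + 1) (s'.reg 12) ↔ ∃ p ∈ Z i, d = p + 1))
    (by rw [h.lo]; omega) (by rw [h.lo]; omega) (by simp [whenever, writesReg])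
    (by simp [Z]) ?_ ?_
  · rintro i hi s₂ hw₂ hr₂ hf₂ ⟨hc, hd⟩
    have hi' : i < n := by simpa [h.β, consts] using hi
    have h3' : s₂.arr 3 = s.arr 3 := by
      rw [hf₂.2 3 (by simp [forTo, whenever, writesArr])]; simpa using h3
    have h10 : s₂.reg 10 = j := by
      rw [hf₂.1 10 (by simp [forTo, whenever, writesReg])]; simpa using hr
    have hZ : Z (i + 1) = if s.arr 3 (j * n + i) = 0 then insert i (Z i) else Z i := by
      simp only [Z]
      rw [Finset.range_add_one, Finset.filter_insert]
    have hiZ : i ∉ Z i := by simp [Z]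
    have hZi : (Z i).card ≤ i := by
      simpa using Finset.card_filter_le (Finset.range i) (fun p => s.arr 3 (j * n + p) = 0)
    refine wp_whenever (by rfl) (fun he => ?_) (fun he => ?_)
    · have he' : s.arr 3 (j * n + i) = 0 := by
        simp [h10, h.reg₀ hw₂, hr₂, h3'] at he; exact he
      rw [if_pos he'] at hZ
      have hZc : (Z (i + 1)).card = (Z i).card + 1 := by
        rw [hZ, Finset.card_insert_of_notMem hiZ]
      have hc1 : (Z i).card + 1 < Γ.X := by
        have := hw₂.1.1 0
        rw [h.reg₀ hw₂] at this
        omega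
      refine wp_seq (wp_whenever (by rfl) (fun hlt => ?_) (fun hge => ?_))
      · have hlt' : (Z i).card < k := by
          simp [hc, h.reg₂ hw₂] at hlt; exact hlt
        obtain ⟨hd1, hd2⟩ := hd hlt'.le
        have hnew : s₂.reg 12 * (n + 1) + (i + 1) < (n + 1) ^ ((Z i).card + 1) := by
          rw [pow_succ]; exact row_major_lt (by omega) hd1
        have hle : (n + 1) ^ ((Z i).card + 1) ≤ (n + 1) ^ k :=
          Nat.pow_le_pow_right (by omega) hlt'
        refine wp_assign (by rfl) (by rw [h.lo]; omega) (fun _ => ?_) ?_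
        · simp only [Expr.eval_add, Expr.eval_mul, Expr.eval_reg, Expr.eval_one, h.reg₃ hw₂, hr₂]
          omega
        refine wp_assign (by rfl) (by rw [h.lo]; omega) (fun _ => ?_) ⟨?_, fun _ => ?_⟩
        · simp only [Expr.eval_add, Expr.eval_reg, Expr.eval_one, Store.setReg_reg]
          simpa [hc] using hc1
        · simp [hc, hZc]
        · simp only [Expr.eval_add, Expr.eval_mul, Expr.eval_reg, Expr.eval_one, h.reg₃ hw₂, hr₂,
            Store.setReg_reg]
          norm_num
          refine ⟨by rw [hZc]; exact hnew, fun d => ?_⟩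
          -- The new state becomes the lowest digit. The shift to `i + 1` makes this digit nonzero,
          -- so it is present even when the previous code is `0`.
          rw [add_comm (s₂.reg 12 * (n + 1)), mul_comm,
            Nat.digits_add (n + 1) (by omega) (i + 1) _ (by omega) (by omega), List.mem_cons, hd2,
            hZ]
          simp
      · have hge' : k ≤ (Z i).card := by
          simp [hc, h.reg₂ hw₂] at hge; exact hge
        refine wp_assign (by rfl) (by rw [h.lo]; omega) (fun _ => ?_) ⟨?_, fun hle => ?_⟩
        · simpa [hc] using hc1
        · simp [hc, hZc]
        · omega
    · have he' : s.arr 3 (j * n + i) ≠ 0 := by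
        simp [h10, h.reg₀ hw₂, hr₂, h3'] at he; exact he
      rw [if_neg he'] at hZ
      rw [hZ]
      simpa using ⟨hc, hd⟩
  · rintro s₂ hw₂ hf₂ ⟨hc, hd⟩
    have h4 : s₂.arr 4 = s₁.arr 4 := hf₂.2 4 (by simp [forTo, whenever, writesArr])
    have h10 : s₂.reg 10 = j := by
      rw [hf₂.1 10 (by simp [forTo, whenever, writesReg])]; simpa using hr
    have hβ : Γ.β 0 = n := by rw [h.β]; rfl
    rw [hβ] at hc hd
    refine wp_whenever (by rfl) (fun he => ?_) (fun he => ?_)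
    · have hle : (Z n).card ≤ k := by
        simp [hc, h.reg₂ hw₂] at he; omega
      obtain ⟨hd1, hd2⟩ := hd hle
      have hd3 : s₂.reg 12 < (n + 1) ^ k :=
        hd1.trans_le (Nat.pow_le_pow_right (by omega) hle)
      refine wp_store (by rfl) (by rfl) (fun _ => ?_) ⟨fun y hy => ?_, fun y hy => ?_⟩
      · simp; omega
      · simp only [Store.setReg_arr, Store.setArr_arr, if_true, Function.update_apply,
          Expr.eval_reg, h10, Expr.eval_add, Expr.eval_one]
        split_ifs with hyj
        · subst hyj
          refine ⟨fun _ => ⟨s₂.reg 12, hd3, rfl, fun d => ?_⟩, fun hlt => absurd hle (not_le.2 hlt)⟩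
          rw [hd2]
          simp only [Z, Finset.mem_filter, Finset.mem_range, and_assoc]
        · rw [h4]; exact hI y (by omega)
      · simp only [Store.setReg_arr, Store.setArr_arr, if_true, Function.update_apply,
          Expr.eval_reg, h10]
        rw [if_neg (by omega), h4]
        exact hI' y (by omega)
    · have hlt : k < (Z n).card := by
        simp [hc, h.reg₂ hw₂] at he; omega
      refine ⟨fun y hy => ?_, fun y hy => ?_⟩
      · simp only [Store.setReg_arr, h4]
        rcases Nat.lt_succ_iff_lt_or_eq.1 hy with h1 | h1
        · exact hI y h1
        · subst h1
          exact ⟨fun hle => absurd hlt (not_lt.2 hle), fun _ => hI' y le_rfl⟩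
      · simp only [Store.setReg_arr, h4]
        exact hI' y (by omega)

/-! ## Graph search -/

/-- The state of a search over the nodes below `M`: `V` marks the visited nodes, which are listed
in `Q 0, …, Q (t - 1)`. -/
structure SearchInv (M : ℕ) (Good : ℕ → Prop) (V Q : ℕ → ℕ) (t : ℕ) : Prop where
  inj : ∀ i < t, ∀ j < t, Q i = Q j → i = j
  lt : ∀ i < t, Q i < M
  vis : ∀ i < t, V (Q i) ≠ 0
  good : ∀ i < t, Good (Q i)
  surj : ∀ u, V u ≠ 0 → ∃ i < t, Q i = u

namespace SearchInv
variable {M : ℕ} {Good : ℕ → Prop} {V Q : ℕ → ℕ} {t : ℕ}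

/-- The queue has no repetitions. This bounds its end pointer and shows that `M` rounds are enough
to process it. -/
theorem le (h : SearchInv M Good V Q t) : t ≤ M := by
  have := Finset.card_le_card_of_injOn (s := Finset.range t) (t := Finset.range M) Q
    (fun i hi => by simpa using h.lt i (by simpa using hi))
    (fun i hi j hj hij => h.inj i (by simpa using hi) j (by simpa using hj) hij)
  simpa using this

theorem push (h : SearchInv M Good V Q t) {v : ℕ} (hv : v < M) (hg : Good v) (h0 : V v = 0) :
    SearchInv M Good (Function.update V v 1) (Function.update Q t v) (t + 1) := by
  have hne : ∀ i < t, Q i ≠ v := fun i hi hiv => h.vis i hi (by rw [hiv, h0])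
  refine ⟨?_, ?_, ?_, ?_, ?_⟩
  · intro i hi j hj hij
    simp only [Function.update_apply] at hij
    split_ifs at hij with h1 h2 h2
    · omega
    · exact absurd hij.symm (hne j (by omega))
    · exact absurd hij (hne i (by omega))
    · exact h.inj i (by omega) j (by omega) hij
  · intro i hi
    simp only [Function.update_apply]
    split_ifs with h1
    · exact hv
    · exact h.lt i (by omega)
  · intro i hi
    by_cases h1 : i = t
    · simp [h1]
    · simp only [Function.update_apply, if_neg h1]
      split_ifs
      · exact one_ne_zero
      · exact h.vis i (by omega)
  · intro i hi
    simp only [Function.update_apply]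
    split_ifs with h1
    · exact hg
    · exact h.good i (by omega)
  · intro u hu
    by_cases huv : u = v
    · exact ⟨t, by omega, by simp [huv]⟩
    · rw [Function.update_of_ne huv] at hu
      obtain ⟨i, hi, rfl⟩ := h.surj u hu
      exact ⟨i, by omega, by rw [Function.update_of_ne (by omega)]⟩

end SearchInv

/-- Mark the node in register `16` and append it to the queue, unless it is marked. -/
def pushProg : Prog :=
  .whenever (Expr.not (.cell 6 (.reg 16)))
    (.seq (.store 6 (.reg 16) 1) (.seq (.store 7 (.reg 11) (.reg 16))
      (.assign 11 (Expr.reg 11 + 1))))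

/-- Stated for an arbitrary continuation `Q`: both the seeding and the search need that marks
persist, and the search also needs that the queue only grows at its end. -/
theorem wp_pushProg {Γ : Setting} {n m k : ℕ} (h : Γ.Std n m k) {s : Store} {M : ℕ}
    (hM : M + 1 < Γ.X) {Good : ℕ → Prop}
    (hI : SearchInv M Good (s.arr 6) (s.arr 7) (s.reg 11)) (hv : s.reg 16 < M)
    (hg : Good (s.reg 16)) {Q : Store → Prop}
    (hQ : ∀ s', Frame pushProg s s' → SearchInv M Good (s'.arr 6) (s'.arr 7) (s'.reg 11) →
      s'.arr 6 (s.reg 16) ≠ 0 → (∀ u, s.arr 6 u ≠ 0 → s'.arr 6 u ≠ 0) →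
      s.reg 11 ≤ s'.reg 11 → (∀ i < s.reg 11, s'.arr 7 i = s.arr 7 i) → Q s') :
    WP Γ pushProg s Q := by
  have hX := Γ.two_lt
  refine wp_mono (Q' := fun s' => SearchInv M Good (s'.arr 6) (s'.arr 7) (s'.reg 11) ∧
      s'.arr 6 (s.reg 16) ≠ 0 ∧ (∀ u, s.arr 6 u ≠ 0 → s'.arr 6 u ≠ 0) ∧
      s.reg 11 ≤ s'.reg 11 ∧ (∀ i < s.reg 11, s'.arr 7 i = s.arr 7 i)) ?_
    (fun s' _ hf ⟨h1, h2, h3, h4, h5⟩ => hQ s' hf h1 h2 h3 h4 h5)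
  refine wp_whenever (by rfl) (fun he => ?_) (fun he => ?_)
  · have he' : s.arr 6 (s.reg 16) = 0 := by by_contra hne; simp [hne] at he
    -- The invariant after the push bounds the new end of the queue by `M` before the program writes
    -- it.
    have hle := (hI.push hv hg he').le
    refine wp_seq (wp_store (by rfl) (by rfl) (fun _ => by simp; omega) ?_)
    refine wp_seq (wp_store (by rfl) (by rfl) (fun _ => by simp; omega) ?_)
    refine wp_assign (by rfl) (by rw [h.lo]; omega) (fun _ => by simp; omega) ?_
    simp only [Store.setReg_arr, Store.setArr_arr, Store.setArr_reg, Store.setReg_reg,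
      Expr.eval_reg, Expr.eval_one, Expr.eval_add]
    norm_num
    refine ⟨hI.push hv hg he', fun u hu => ?_, fun i hi => ?_⟩
    · rw [Function.update_apply]; split_ifs <;> simp [hu]
    · rw [Function.update_of_ne (by omega)]
  · have he' : s.arr 6 (s.reg 16) ≠ 0 := by intro hne; simp [hne] at he
    exact ⟨hI, he', fun _ h => h, le_rfl, fun _ _ => rfl⟩

/-- The number of the node reached from the node `u` by the letter `a`. -/
def succNode (n m : ℕ) (T C S : ℕ → ℕ) (u a : ℕ) : ℕ :=
  ((S (u / 2 / n * m + a) - 1) * n + T (u / 2 % n * m + a)) * 2 +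
    if 0 < u % 2 + (if 1 < C ((u / 2 / n * m + a) * n + T (u / 2 % n * m + a)) then 1 else 0)
    then 1 else 0

/-- Put the nodes `2 * q` for the states `q` into the queue. -/
def seedProg : Prog :=
  .seq (.assign 11 0) (.forTo 10 0 (.seq (.assign 16 (Expr.reg 10 * 2)) pushProg))

/-- The number `q * 2` encodes code `0`, state `q` and bit `0`: the node of the empty word. -/
theorem wp_seedProg {Γ : Setting} {n m k : ℕ} (h : Γ.Std n m k) {s : Store} {Good : ℕ → Prop}
    (hs : ∀ i, s.arr 6 i = 0) (hg : ∀ q < n, Good (q * 2)) :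
    WP Γ seedProg s (fun s' =>
      SearchInv ((n + 1) ^ k * n * 2) Good (s'.arr 6) (s'.arr 7) (s'.reg 11) ∧
      ∀ q < n, s'.arr 6 (q * 2) ≠ 0) := by
  have hX := Γ.two_lt
  refine wp_seq (wp_assign (by rfl) (by rw [h.lo]; omega) (fun _ => by simp; omega) ?_)
  refine wp_forTo (fun j s' => SearchInv ((n + 1) ^ k * n * 2) Good (s'.arr 6) (s'.arr 7)
      (s'.reg 11) ∧ ∀ q < j, s'.arr 6 (q * 2) ≠ 0)
    (by rw [h.lo]; omega) h.lo.le (by simp [whenever, writesReg, pushProg]) ?_ ?_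
    (fun s' _ _ hI => by simpa [h.β, consts] using hI)
  · exact ⟨by constructor <;> simp [hs], by simp⟩
  · rintro j hj s₁ hw hr - ⟨hI, hI'⟩
    have hj' : j < n := by simpa [h.β, consts] using hj
    have hjM : j * 2 < (n + 1) ^ k * n * 2 := by
      have : n ≤ (n + 1) ^ k * n := Nat.le_mul_of_pos_left _ (by positivity)
      omega
    refine wp_seq (wp_assign (by rfl) (by rw [h.lo]; omega) (fun _ => ?_) ?_)
    · have := h.lt₈
      simp [hr]; omega
    · refine wp_pushProg (Good := Good) h h.lt₈ ?_ ?_ ?_ ?_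
      · simpa using hI
      · simpa [hr] using hjM
      · simpa [hr] using hg j hj'
      · intro s₂ hf₂ h1 h2 h3 _ _
        simp only [Store.setReg_reg, Store.setReg_arr] at h1 h2 h3 ⊢
        simp [hr] at h2
        refine ⟨h1, fun q hq => ?_⟩
        rcases Nat.lt_succ_iff_lt_or_eq.1 hq with h4 | h4
        · exact h3 _ (hI' q h4)
        · rw [h4]; exact h2

/-- Visit all nodes that can be reached from the nodes in the queue. -/
def searchProg : Prog :=
  .forTo 10 8 (.whenever ((Expr.reg 10).lt (.reg 11)) (.seq (.assign 12 (.cell 7 (.reg 10)))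
    (.forTo 13 1 (.seq (.assign 14 (Expr.reg 12 / 2 / .reg 0 * .reg 1 + .reg 13))
      (.whenever (.cell 4 (.reg 14))
        (.seq (.assign 15 (.cell 0 (Expr.reg 12 / 2 % .reg 0 * .reg 1 + .reg 13)))
          (.seq (.assign 16 (((Expr.cell 4 (.reg 14) - 1) * .reg 0 + .reg 15) * 2 +
              (0 : Expr).lt (Expr.reg 12 % 2 +
                (1 : Expr).lt (.cell 3 (Expr.reg 14 * .reg 0 + .reg 15)))))
            pushProg)))))))

/-- Breadth-first search written as a counting loop: round `j` processes entry `j` of the queue if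
there is one. Once a round finds the queue exhausted, no later round can extend it. `Good` records
soundness and the last conjunct closure under successors. -/
theorem wp_searchProg {Γ : Setting} {n m k : ℕ} (h : Γ.Std n m k) {s : Store} {Good : ℕ → Prop}
    (hlt : ∀ u < (n + 1) ^ k * n * 2, ∀ a < m, s.arr 4 (u / 2 / n * m + a) ≠ 0 →
      succNode n m (s.arr 0) (s.arr 3) (s.arr 4) u a < (n + 1) ^ k * n * 2)
    (hgood : ∀ u < (n + 1) ^ k * n * 2, ∀ a < m, s.arr 4 (u / 2 / n * m + a) ≠ 0 → Good u →
      Good (succNode n m (s.arr 0) (s.arr 3) (s.arr 4) u a))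
    (hI : SearchInv ((n + 1) ^ k * n * 2) Good (s.arr 6) (s.arr 7) (s.reg 11)) :
    WP Γ searchProg s (fun s' =>
      (∀ u, s.arr 6 u ≠ 0 → s'.arr 6 u ≠ 0) ∧ (∀ u, s'.arr 6 u ≠ 0 → Good u) ∧
      (∀ u < (n + 1) ^ k * n * 2, s'.arr 6 u ≠ 0 → ∀ a < m, s.arr 4 (u / 2 / n * m + a) ≠ 0 →
        s'.arr 6 (succNode n m (s.arr 0) (s.arr 3) (s.arr 4) u a) ≠ 0)) := by
  have hX := Γ.two_lt
  set M := (n + 1) ^ k * n * 2 with hM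
  set nd := succNode n m (s.arr 0) (s.arr 3) (s.arr 4) with hnd
  refine wp_forTo (fun j s' => SearchInv M Good (s'.arr 6) (s'.arr 7) (s'.reg 11) ∧
      (∀ u, s.arr 6 u ≠ 0 → s'.arr 6 u ≠ 0) ∧
      (∀ i < j, i < s'.reg 11 → ∀ a < m, s.arr 4 (s'.arr 7 i / 2 / n * m + a) ≠ 0 →
        s'.arr 6 (nd (s'.arr 7 i) a) ≠ 0))
    (by rw [h.lo]; omega) h.lo.le (by simp [whenever, writesReg, pushProg, forTo])
    ⟨by simpa using hI, fun _ h => h, by simp⟩ ?_ ?_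
  · rintro j hj s₁ hw hr hf ⟨hI₁, hmono, hcl⟩
    have hj' : j < M := by simpa [h.β, consts] using hj
    have h0 : s₁.arr 0 = s.arr 0 := hf.2 0 (by simp [forTo, whenever, writesArr, pushProg])
    have h3 : s₁.arr 3 = s.arr 3 := hf.2 3 (by simp [forTo, whenever, writesArr, pushProg])
    have h4 : s₁.arr 4 = s.arr 4 := hf.2 4 (by simp [forTo, whenever, writesArr, pushProg])
    refine wp_whenever (by rfl) (fun he => ?_) (fun he => ?_)
    · have hjt : j < s₁.reg 11 := by simpa [hr] using he
      set u := s₁.arr 7 j with hu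
      have huM : u < M := hI₁.lt j hjt
      refine wp_seq (wp_assign (by rfl) (by rw [h.lo]; omega) (fun hw' => hw'.1.2 _ _) ?_)
      refine wp_forTo (fun b s' => SearchInv M Good (s'.arr 6) (s'.arr 7) (s'.reg 11) ∧
          (∀ u, s.arr 6 u ≠ 0 → s'.arr 6 u ≠ 0) ∧ j < s'.reg 11 ∧ s'.arr 7 j = u ∧
          (∀ i < j, ∀ a < m, s.arr 4 (s'.arr 7 i / 2 / n * m + a) ≠ 0 →
            s'.arr 6 (nd (s'.arr 7 i) a) ≠ 0) ∧
          ∀ a < b, s.arr 4 (u / 2 / n * m + a) ≠ 0 → s'.arr 6 (nd u a) ≠ 0)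
        (by rw [h.lo]; omega) (by rw [h.lo]; omega) (by simp [whenever, writesReg, pushProg])
        ?_ ?_ ?_
      -- As `j` lies inside the queue, so does every earlier index; the closure property of all
      -- processed entries becomes unconditional.
      · simpa using ⟨hI₁, hmono, hjt, hu.symm, fun i hi => hcl i hi (by omega)⟩
      · rintro a ha s₂ hw₂ hr₂ hf₂ ⟨hI₂, hmono₂, hjt₂, hu₂, hcl₂, hcl₂'⟩
        have ha' : a < m := by simpa [h.β, consts] using ha
        have h0' : s₂.arr 0 = s.arr 0 := by
          rw [hf₂.2 0 (by simp [forTo, whenever, writesArr, pushProg])]; simpa using h0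
        have h3' : s₂.arr 3 = s.arr 3 := by
          rw [hf₂.2 3 (by simp [forTo, whenever, writesArr, pushProg])]; simpa using h3
        have h4' : s₂.arr 4 = s.arr 4 := by
          rw [hf₂.2 4 (by simp [forTo, whenever, writesArr, pushProg])]; simpa using h4
        have h12 : s₂.reg 12 = u := by
          rw [hf₂.1 12 (by simp [forTo, whenever, writesReg, pushProg])]; simp [hr, hu]
        refine wp_seq (wp_assign (by rfl) (by rw [h.lo]; omega) (fun _ => ?_) ?_)
        · simp only [Expr.eval_add, Expr.eval_mul, Expr.eval_div, Expr.eval_reg, Expr.eval_two,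
            h12, h.reg₀ hw₂, h.reg₁ hw₂, hr₂]
          have h5 : u / 2 / n < (n + 1) ^ k := by
            rw [Nat.div_div_eq_div_mul]
            refine Nat.div_lt_of_lt_mul ?_
            rw [hM] at huM
            calc u < _ := huM
              _ = _ := by ring
          have h6 := row_major_lt ha' h5
          have h7 : (n + 1) ^ k * m ≤ (n + 1) ^ k * m * n := Nat.le_mul_of_pos_right _ h.n_pos
          have := h.lt₇
          omega
        simp only [Expr.eval_add, Expr.eval_mul, Expr.eval_div, Expr.eval_reg, Expr.eval_two,
            h12, h.reg₀ hw₂, h.reg₁ hw₂, hr₂]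
        refine wp_whenever (by rfl) (fun he₂ => ?_) (fun he₂ => ?_)
        · have he₃ : s.arr 4 (u / 2 / n * m + a) ≠ 0 := by simpa [h4'] using he₂
          have hnext := hlt u huM a ha' he₃
          refine wp_seq (wp_assign (by rfl) (by rw [h.lo]; omega) (fun hw' => hw'.1.2 _ _) ?_)
          have hval : (((Expr.cell 4 (.reg 14) - 1) * .reg 0 + .reg 15) * 2 +
              (0 : Expr).lt (Expr.reg 12 % 2 +
                (1 : Expr).lt (.cell 3 (Expr.reg 14 * .reg 0 + .reg 15)))).eval
              ((s₂.setReg 14 (u / 2 / n * m + a)).setReg 15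
                ((Expr.cell 0 (Expr.reg 12 / 2 % .reg 0 * .reg 1 + .reg 13)).eval
                  (s₂.setReg 14 (u / 2 / n * m + a)))) = nd u a := by
            simp only [Expr.eval_add, Expr.eval_mul, Expr.eval_div, Expr.eval_mod, Expr.eval_sub,
              Expr.eval_lt, Expr.eval_cell, Expr.eval_reg, Expr.eval_two, Expr.eval_zero,
              Expr.eval_one, Store.setReg_reg, Store.setReg_arr, h4', h3', h0']
            norm_num
            simp only [h12, h.reg₀ hw₂, h.reg₁ hw₂, hr₂]
            rw [hnd]
            simp only [succNode, Nat.add_pos_iff_pos_or_pos]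
          refine wp_seq (wp_assign (by rfl) (by rw [h.lo]; omega) (fun _ => ?_) ?_)
          · rw [hval]
            have := h.lt₈
            omega
          rw [hval]
          refine wp_pushProg (Good := Good) h h.lt₈ ?_ ?_ ?_ ?_
          · simpa using hI₂
          · simpa using hnext
          · simpa using hgood u huM a ha' he₃ (hu₂ ▸ hI₂.good j hjt₂)
          · intro s₃ hf₃ h5 h6 h7 h8 h9
            simp at h6 h7 h8 h9
            refine ⟨by simpa using h5, fun u hu => h7 u (hmono₂ u hu), ?_, ?_, ?_, ?_⟩
            · simp; omega
            · simp only [Store.setReg_arr]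
              rw [h9 j hjt₂, hu₂]
            · intro i hi a ha hS
              simp only [Store.setReg_arr] at hS ⊢
              rw [h9 i (by omega)] at hS ⊢
              exact h7 _ (hcl₂ i hi a ha hS)
            · intro a' ha' hS
              simp only [Store.setReg_arr]
              rcases Nat.lt_succ_iff_lt_or_eq.1 ha' with h10 | h10
              · exact h7 _ (hcl₂' a' h10 hS)
              · rw [h10]; exact h6
        · have he₃ : s.arr 4 (u / 2 / n * m + a) = 0 := by simpa [h4'] using he₂
          refine ⟨by simpa using hI₂, hmono₂, by simpa using hjt₂, hu₂, hcl₂, ?_⟩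
          intro a' ha' hS
          rcases Nat.lt_succ_iff_lt_or_eq.1 ha' with h10 | h10
          · exact hcl₂' a' h10 hS
          · rw [h10] at hS; exact absurd he₃ hS
      · rintro s₂ hw₂ hf₂ ⟨hI₂, hmono₂, hjt₂, hu₂, hcl₂, hcl₂'⟩
        refine ⟨by simpa using hI₂, hmono₂, ?_⟩
        intro i hi _ a ha hS
        rcases Nat.lt_succ_iff_lt_or_eq.1 hi with h10 | h10
        · exact hcl₂ i h10 a ha hS
        · simp only [Store.setReg_arr] at hS ⊢
          rw [h10, hu₂] at hS ⊢
          refine hcl₂' a ?_ hS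
          simpa [h.β, consts] using ha
    · have hjt : s₁.reg 11 ≤ j := by simpa [hr] using he
      refine ⟨by simpa using hI₁, hmono, ?_⟩
      intro i _ hi
      simp at hi
      exact hcl i (by omega) hi
  · rintro s' hw hf ⟨hI', hmono, hcl⟩
    have hβ : Γ.β 8 = M := by rw [h.β]; rfl
    rw [hβ] at hcl
    refine ⟨hmono, fun u hu => ?_, fun u _ hu a ha hS => ?_⟩
    · obtain ⟨i, hi, rfl⟩ := hI'.surj u hu
      exact hI'.good i hi
    · obtain ⟨i, hi, rfl⟩ := hI'.surj u hu
      -- The queue has at most `M` entries, so all of them were processed during the `M` rounds.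
      exact hcl i (hi.trans_le hI'.le) hi a ha hS

/-! ## Reachability on the states -/

theorem Setting.Std.sq_lt {Γ : Setting} {n m k : ℕ} (h : Γ.Std n m k) : n + 1 < Γ.X := by
  have := h.lt₈
  have : n ≤ (n + 1) ^ k * n := Nat.le_mul_of_pos_left _ (by positivity)
  have := h.n_pos
  omega

/-- Put the identity relation into array `9`. -/
def idProg : Prog := .forTo 10 0 (.store 9 (Expr.reg 10 * .reg 0 + .reg 10) 1)

theorem wp_idProg {Γ : Setting} {n m k : ℕ} (h : Γ.Std n m k) {s : Store}
    (hs : ∀ i, s.arr 9 i = 0) :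
    WP Γ idProg s (fun s' => ∀ y < n, ∀ z < n, s'.arr 9 (y * n + z) ≠ 0 ↔ y = z) := by
  have hX := Γ.two_lt
  refine wp_forTo (fun j s' => ∀ y < n, ∀ z < n, s'.arr 9 (y * n + z) ≠ 0 ↔ y = z ∧ y < j)
    (by rw [h.lo]; omega) h.lo.le (by simp [writesReg]) (by simp [hs]) ?_ ?_
  · rintro j hj s₁ hw hr - hI
    have hj' : j < n := by simpa [h.β, consts] using hj
    refine wp_store (by rfl) (by rfl) (fun _ => by simp; omega) fun y hy z hz => ?_
    simp only [Store.setReg_arr, Store.setArr_arr, if_true, Function.update_apply, Expr.eval_add,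
      Expr.eval_mul, Expr.eval_reg, hr, h.reg₀ hw, Expr.eval_one]
    split_ifs with h1
    · obtain ⟨rfl, rfl⟩ := row_major_inj hz hj' h1
      simp
    · rw [hI y hy z hz]
      constructor
      · rintro ⟨h2, h3⟩; exact ⟨h2, by omega⟩
      · rintro ⟨rfl, h3⟩
        refine ⟨rfl, lt_of_le_of_ne (by omega) fun h4 => h1 ?_⟩
        rw [h4]
  · intro s' _ _ hI y hy z hz
    rw [hI y hy z hz, show Γ.β 0 = n by rw [h.β]; rfl]
    exact ⟨fun h => h.1, fun h => ⟨h, hy⟩⟩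

/-- Add the relation in array `8` to the relation in array `9`. -/
def copyProg : Prog :=
  .forTo 10 0 (.forTo 11 0 (.whenever (.cell 8 (Expr.reg 10 * .reg 0 + .reg 11))
    (.store 9 (Expr.reg 10 * .reg 0 + .reg 11) 1)))

theorem wp_copyProg {Γ : Setting} {n m k : ℕ} (h : Γ.Std n m k) {s : Store} :
    WP Γ copyProg s (fun s' => ∀ y < n, ∀ z < n, s'.arr 9 (y * n + z) ≠ 0 ↔
      s.arr 9 (y * n + z) ≠ 0 ∨ s.arr 8 (y * n + z) ≠ 0) := by
  have hX := Γ.two_lt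
  have hβ : Γ.β 0 = n := by rw [h.β]; rfl
  refine wp_forTo₂ (fun j s' => ∀ e, s'.arr 9 e ≠ 0 ↔
      s.arr 9 e ≠ 0 ∨ (e < j ∧ s.arr 8 e ≠ 0))
    (by rw [h.lo]; omega) h.lo.le (by rw [h.lo]; omega) (by rw [h.lo]; omega) (by omega)
    (by simp [writesReg, whenever]) (by simp [writesReg, whenever])
    (fun _ _ _ _ _ h => h) (by simp) ?_ ?_
  · intro y hy z hz s₁ hw hr hr' hf hI
    rw [hβ] at hI hy hz ⊢
    have h8 : s₁.arr 8 = s.arr 8 := hf.2 8 (by simp [forTo, whenever, writesArr])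
    refine wp_whenever (by rfl) (fun he => wp_store (by rfl) (by rfl) (fun _ => by simp; omega) ?_)
      (fun he => ?_)
    · simp only [Expr.eval_cell, Expr.eval_add, Expr.eval_mul, Expr.eval_reg, hr, hr', h.reg₀ hw,
        Store.setArr_arr, if_true, Function.update_apply, h8, Expr.eval_one] at he ⊢
      intro e
      split_ifs with h1
      · subst h1; simp [he]
      · rw [hI]
        have : e < y * n + z + 1 ↔ e < y * n + z := by omega
        rw [this]
    · simp only [Expr.eval_cell, Expr.eval_add, Expr.eval_mul, Expr.eval_reg, hr, hr', h.reg₀ hw,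
        h8] at he ⊢
      intro e
      rw [hI]
      rcases eq_or_ne e (y * n + z) with rfl | h1
      · simp [he]
      · have : e < y * n + z + 1 ↔ e < y * n + z := by omega
        rw [this]
  · intro s' _ _ hI y hy z hz
    rw [hI, hβ]
    simp [row_major_lt hz hy]

/-- Make the relation in array `9` transitive. -/
def transProg : Prog :=
  .forTo 12 0 (.forTo 10 0 (.forTo 11 0 (.whenever
    (Expr.cell 9 (Expr.reg 10 * .reg 0 + .reg 12) * .cell 9 (Expr.reg 12 * .reg 0 + .reg 11))
    (.store 9 (Expr.reg 10 * .reg 0 + .reg 11) 1))))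

/-- Warshall's algorithm: after round `x` the relation is closed under composition through all
states up to `x`. Minimality is expressed by an arbitrary transitive `S` containing the initial
relation, so paths need not be mentioned. -/
theorem wp_transProg {Γ : Setting} {n m k : ℕ} (h : Γ.Std n m k) {s : Store}
    (S : ℕ → ℕ → Prop) (hS : ∀ x y z, S x y → S y z → S x z)
    (hs : ∀ y < n, ∀ z < n, s.arr 9 (y * n + z) ≠ 0 → S y z) :
    WP Γ transProg s (fun s' =>
      (∀ e, s.arr 9 e ≠ 0 → s'.arr 9 e ≠ 0) ∧
      (∀ y < n, ∀ z < n, s'.arr 9 (y * n + z) ≠ 0 → S y z) ∧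
      (∀ y < n, ∀ x < n, ∀ z < n, s'.arr 9 (y * n + x) ≠ 0 → s'.arr 9 (x * n + z) ≠ 0 →
        s'.arr 9 (y * n + z) ≠ 0)) := by
  have hX := Γ.two_lt
  have hβ : Γ.β 0 = n := by rw [h.β]; rfl
  refine wp_forTo (fun j s' => (∀ e, s.arr 9 e ≠ 0 → s'.arr 9 e ≠ 0) ∧
      (∀ y < n, ∀ z < n, s'.arr 9 (y * n + z) ≠ 0 → S y z) ∧
      (∀ y < n, ∀ x < n, ∀ z < n, x < j → s'.arr 9 (y * n + x) ≠ 0 → s'.arr 9 (x * n + z) ≠ 0 →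
        s'.arr 9 (y * n + z) ≠ 0))
    (by rw [h.lo]; omega) (by rw [h.lo]; omega) (by simp [writesReg, whenever, forTo])
    ⟨fun _ h => h, hs, by simp⟩ ?_ ?_
  · rintro x hx s₁ hw hr hf ⟨hmono, hsub, htr⟩
    rw [hβ] at hx
    refine wp_forTo₂ (fun c s' => (∀ e, s₁.arr 9 e ≠ 0 → s'.arr 9 e ≠ 0) ∧
        (∀ y < n, ∀ z < n, s'.arr 9 (y * n + z) ≠ 0 → s₁.arr 9 (y * n + z) ≠ 0 ∨
          (s₁.arr 9 (y * n + x) ≠ 0 ∧ s₁.arr 9 (x * n + z) ≠ 0)) ∧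
        (∀ y < n, ∀ z < n, y * n + z < c → s₁.arr 9 (y * n + x) ≠ 0 → s₁.arr 9 (x * n + z) ≠ 0 →
          s'.arr 9 (y * n + z) ≠ 0))
      (by rw [h.lo]; omega) h.lo.le (by rw [h.lo]; omega) (by rw [h.lo]; omega) (by omega)
      (by simp [writesReg, whenever]) (by simp [writesReg, whenever])
      (fun _ _ _ _ _ h => h) ⟨fun _ h => h, fun _ _ _ _ h => Or.inl h, by simp⟩ ?_ ?_
    · rintro y hy z hz s₂ hw₂ hr₂ hr₂' hf₂ ⟨h1, h2, h3⟩
      rw [hβ] at hy hz h3 ⊢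
      have h12 : s₂.reg 12 = x := by
        rw [hf₂.1 12 (by simp [forTo, whenever, writesReg]), hr]
      -- The update is in place, but in round `x` neither column `x` nor row `x` changes its truth
      -- values: a new pair ending or starting at `x` would require that same pair already.
      have hyx : s₂.arr 9 (y * n + x) ≠ 0 ↔ s₁.arr 9 (y * n + x) ≠ 0 :=
        ⟨fun h => (h2 y hy x hx h).elim id (fun h => h.1), h1 _⟩
      have hxz : s₂.arr 9 (x * n + z) ≠ 0 ↔ s₁.arr 9 (x * n + z) ≠ 0 :=
        ⟨fun h => (h2 x hx z hz h).elim id (fun h => h.2), h1 _⟩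
      refine wp_whenever (by rfl)
        (fun he => wp_store (by rfl) (by rfl) (fun _ => by simp; omega) ?_) (fun he => ?_)
      · simp only [Expr.eval_cell, Expr.eval_add, Expr.eval_mul, Expr.eval_reg, hr₂, hr₂', h12,
          h.reg₀ hw₂, Store.setArr_arr, if_true, Function.update_apply, Expr.eval_one,
          mul_ne_zero_iff, hyx, hxz] at he ⊢
        refine ⟨fun e he' => ?_, fun y' hy' z' hz' h4 => ?_, fun y' hy' z' hz' hlt h4 h5 => ?_⟩
        · split_ifs
          · exact one_ne_zero
          · exact h1 e he'
        · split_ifs at h4 with h5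
          · obtain ⟨rfl, rfl⟩ := row_major_inj hz' hz h5
            exact Or.inr he
          · exact h2 y' hy' z' hz' h4
        · split_ifs with h6
          · exact one_ne_zero
          · exact h3 y' hy' z' hz' (by omega) h4 h5
      · simp only [Expr.eval_cell, Expr.eval_add, Expr.eval_mul, Expr.eval_reg, hr₂, hr₂', h12,
          h.reg₀ hw₂] at he
        refine ⟨h1, h2, fun y' hy' z' hz' hlt h4 h5 => ?_⟩
        rcases eq_or_ne (y' * n + z') (y * n + z) with h6 | h6
        · obtain ⟨rfl, rfl⟩ := row_major_inj hz' hz h6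
          exact absurd he (mul_ne_zero (hyx.2 h4) (hxz.2 h5))
        · exact h3 y' hy' z' hz' (by omega) h4 h5
    · rintro s₂ _ _ ⟨h1, h2, h3⟩
      rw [hβ] at h3
      simp only [Store.setReg_arr]
      have h3' : ∀ y < n, ∀ z < n, s₁.arr 9 (y * n + x) ≠ 0 → s₁.arr 9 (x * n + z) ≠ 0 →
          s₂.arr 9 (y * n + z) ≠ 0 := fun y hy z hz =>
        h3 y hy z hz (row_major_lt hz hy)
      refine ⟨fun e he => h1 e (hmono e he), fun y hy z hz h4 => ?_,
        fun y hy w hwn z hz hwx h4 h5 => ?_⟩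
      · rcases h2 y hy z hz h4 with h5 | ⟨h5, h6⟩
        · exact hsub y hy z hz h5
        · exact hS _ _ _ (hsub y hy x hx h5) (hsub x hx z hz h6)
      · rcases Nat.lt_succ_iff_lt_or_eq.1 hwx with h6 | rfl
        · rcases h2 y hy w hwn h4 with h7 | ⟨h7, h8⟩ <;>
            rcases h2 w hwn z hz h5 with h9 | ⟨h9, h10⟩
          · exact h1 _ (htr y hy w hwn z hz h6 h7 h9)
          · exact h3' y hy z hz (htr y hy w hwn x hx h6 h7 h9) h10
          · exact h3' y hy z hz h7 (htr x hx w hwn z hz h6 h8 h9)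
          · exact h3' y hy z hz h7 h10
        · refine h3' y hy z hz ?_ ?_
          · exact (h2 y hy w hwn h4).elim id (fun h => h.1)
          · exact (h2 w hwn z hz h5).elim id (fun h => h.2)
  · rintro s' _ _ ⟨h1, h2, h3⟩
    rw [hβ] at h3
    exact ⟨h1, h2, fun y hy x hx z hz => h3 y hy x hx z hz hx⟩

/-! ## Marking edges -/

/-- The states listed as members of the code `c` in the membership table `M`. -/
def members (n : ℕ) (M : ℕ → ℕ) (c : ℕ) : Finset ℕ :=
  (Finset.range n).filter (fun p => M (c * (n + 1) + p + 1) ≠ 0)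

/-- For each code with as many members as register `15` says, all of them mutually related in
array `9`, add to array `8` an edge from a member to each state that is visited together with the
code. -/
def markProg : Prog :=
  .forTo 10 4 (.seq (.assign 12 0) (.seq (.assign 13 0) (.seq (.assign 14 0) (.seq
    (.forTo 11 0 (.whenever (.cell 2 (Expr.reg 10 * .reg 3 + .reg 11 + 1))
      (.seq (.assign 12 (Expr.reg 12 + 1)) (.assign 13 (.reg 11)))))
    (.seq (.forTo 11 0 (.whenever (Expr.cell 2 (Expr.reg 10 * .reg 3 + .reg 11 + 1) *
        (Expr.not (.cell 9 (Expr.reg 13 * .reg 0 + .reg 11)) +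
          Expr.not (.cell 9 (Expr.reg 11 * .reg 0 + .reg 13))))
      (.assign 14 1)))
    (.forTo 11 0 (.whenever ((Expr.reg 12).eq (.reg 15) * Expr.not (.reg 14) *
        .cell 6 ((Expr.reg 10 * .reg 0 + .reg 11) * 2 + 1))
      (.store 8 (Expr.reg 13 * .reg 0 + .reg 11) 1))))))))

/-- Only relatedness to one member `f`, the last one found, is tested, and only `f` receives edges;
this keeps the work per code linear in `n`. Hence soundness speaks of the relation to the source,
and completeness promises an unspecified source. As `J ≥ 1`, a code of the right size does have a
member `f`. -/
theorem wp_markProg {Γ : Setting} {n m k : ℕ} (h : Γ.Std n m k) {s : Store} {J : ℕ}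
    (hJ : 1 ≤ J) (hsJ : s.reg 15 = J) :
    WP Γ markProg s (fun s' =>
      (∀ e, s.arr 8 e ≠ 0 → s'.arr 8 e ≠ 0) ∧
      (∀ p < n, ∀ d < n, s'.arr 8 (p * n + d) ≠ 0 → s.arr 8 (p * n + d) ≠ 0 ∨
        ∃ c < (n + 1) ^ k, (members n (s.arr 2) c).card = J ∧ p ∈ members n (s.arr 2) c ∧
          (∀ q ∈ members n (s.arr 2) c, s.arr 9 (p * n + q) ≠ 0 ∧ s.arr 9 (q * n + p) ≠ 0) ∧
          s.arr 6 ((c * n + d) * 2 + 1) ≠ 0) ∧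
      (∀ c < (n + 1) ^ k, (members n (s.arr 2) c).card = J →
        (∀ p ∈ members n (s.arr 2) c, ∀ q ∈ members n (s.arr 2) c, s.arr 9 (p * n + q) ≠ 0) →
        ∃ p ∈ members n (s.arr 2) c, ∀ d < n, s.arr 6 ((c * n + d) * 2 + 1) ≠ 0 →
          s'.arr 8 (p * n + d) ≠ 0)) := by
  have hX := Γ.two_lt
  have hβ : Γ.β 0 = n := by rw [h.β]; rfl
  have hβ4 : Γ.β 4 = (n + 1) ^ k := by rw [h.β]; rfl
  refine wp_forTo (fun j s' =>
      (∀ e, s.arr 8 e ≠ 0 → s'.arr 8 e ≠ 0) ∧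
      (∀ p < n, ∀ d < n, s'.arr 8 (p * n + d) ≠ 0 → s.arr 8 (p * n + d) ≠ 0 ∨
        ∃ c < (n + 1) ^ k, (members n (s.arr 2) c).card = J ∧ p ∈ members n (s.arr 2) c ∧
          (∀ q ∈ members n (s.arr 2) c, s.arr 9 (p * n + q) ≠ 0 ∧ s.arr 9 (q * n + p) ≠ 0) ∧
          s.arr 6 ((c * n + d) * 2 + 1) ≠ 0) ∧
      (∀ c < j, (members n (s.arr 2) c).card = J →
        (∀ p ∈ members n (s.arr 2) c, ∀ q ∈ members n (s.arr 2) c, s.arr 9 (p * n + q) ≠ 0) →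
        ∃ p ∈ members n (s.arr 2) c, ∀ d < n, s.arr 6 ((c * n + d) * 2 + 1) ≠ 0 →
          s'.arr 8 (p * n + d) ≠ 0))
    (by rw [h.lo]; omega) h.lo.le (by simp [writesReg, whenever, forTo])
    ⟨fun _ h => h, fun _ _ _ _ h => Or.inl h, by simp⟩ ?_ (fun s' _ _ hI => by
      rw [hβ4] at hI; exact hI)
  rintro c hc s₁ hw hr hf ⟨hmono, hsound, hcompl⟩
  rw [hβ4] at hc
  have h2 : s₁.arr 2 = s.arr 2 := hf.2 2 (by simp [forTo, whenever, writesArr])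
  have h6 : s₁.arr 6 = s.arr 6 := hf.2 6 (by simp [forTo, whenever, writesArr])
  have h9 : s₁.arr 9 = s.arr 9 := hf.2 9 (by simp [forTo, whenever, writesArr])
  have h15 : s₁.reg 15 = J := by
    rw [hf.1 15 (by simp [forTo, whenever, writesReg]), hsJ]
  refine wp_seq (wp_assign (by rfl) (by rw [h.lo]; omega) (fun _ => by simp; omega) ?_)
  refine wp_seq (wp_assign (by rfl) (by rw [h.lo]; omega) (fun _ => by simp; omega) ?_)
  refine wp_seq (wp_assign (by rfl) (by rw [h.lo]; omega) (fun _ => by simp; omega) ?_)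
  set s₂ := ((s₁.setReg 12 ((0 : Expr).eval s₁)).setReg 13
    ((0 : Expr).eval (s₁.setReg 12 ((0 : Expr).eval s₁)))).setReg 14
    ((0 : Expr).eval ((s₁.setReg 12 ((0 : Expr).eval s₁)).setReg 13
    ((0 : Expr).eval (s₁.setReg 12 ((0 : Expr).eval s₁))))) with hs₂
  have h10₂ : s₂.reg 10 = c := by simp [hs₂, hr]
  have h12₂ : s₂.reg 12 = 0 := by simp [hs₂]
  have h13₂ : s₂.reg 13 = 0 := by simp [hs₂]
  have h14₂ : s₂.reg 14 = 0 := by simp [hs₂]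
  have h15₂ : s₂.reg 15 = J := by simp [hs₂, h15]
  have harr₂ : s₂.arr = s₁.arr := by simp [hs₂]
  clear_value s₂
  let mem : ℕ → Prop := fun p => s.arr 2 (c * (n + 1) + p + 1) ≠ 0
  have hmem : ∀ p, p ∈ members n (s.arr 2) c ↔ p < n ∧ mem p := fun p => by
    simp [members, mem]
  refine wp_seq (wp_forTo (fun i s' =>
      s'.reg 12 = ((Finset.range i).filter (fun p => mem p)).card ∧
      (0 < s'.reg 12 → s'.reg 13 < n ∧ mem (s'.reg 13)))
    (by rw [h.lo]; omega) (by rw [h.lo]; omega) (by simp [writesReg, whenever])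
    (by simp [h12₂]) ?_ ?_)
  · rintro i hi s₃ hw₃ hr₃ hf₃ ⟨h1, h1'⟩
    rw [hβ] at hi
    have h2' : s₃.arr 2 = s.arr 2 := by
      rw [hf₃.2 2 (by simp [forTo, whenever, writesArr]), harr₂, h2]
    have h10 : s₃.reg 10 = c := by
      rw [hf₃.1 10 (by simp [forTo, whenever, writesReg]), h10₂]
    have hle := Finset.card_filter_le (Finset.range i) (fun p => mem p)
    rw [Finset.card_range] at hle
    have hXn := h.sq_lt
    refine wp_whenever (by rfl) (fun he => ?_) (fun he => ?_)
    · have he' : mem i := by simpa [h10, h.reg₃ hw₃, hr₃, h2'] using he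
      refine wp_seq (wp_assign (by rfl) (by rw [h.lo]; omega) (fun _ => by simp; omega) ?_)
      refine wp_assign (by rfl) (by rw [h.lo]; omega) (fun _ => by simp [hr₃]; omega) ?_
      rw [Finset.range_add_one, Finset.filter_insert, if_pos he',
        Finset.card_insert_of_notMem (by simp)]
      simp [h1, hr₃, hi, he']
    · have he' : ¬ mem i := by simpa [mem, h10, h.reg₃ hw₃, hr₃, h2'] using he
      rw [Finset.range_add_one, Finset.filter_insert, if_neg he']
      simpa using ⟨h1, h1'⟩
  rintro s₃ hw₃ hf₃ ⟨h12₃, h13₃⟩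
  rw [hβ] at h12₃
  have h10₃ : s₃.reg 10 = c := by
    rw [hf₃.1 10 (by simp [forTo, whenever, writesReg]), h10₂]
  have h14₃ : s₃.reg 14 = 0 := by
    rw [hf₃.1 14 (by simp [forTo, whenever, writesReg]), h14₂]
  have h15₃ : s₃.reg 15 = J := by
    rw [hf₃.1 15 (by simp [forTo, whenever, writesReg]), h15₂]
  have harr₃ : s₃.arr = s₁.arr := by
    funext a
    rw [hf₃.2 a (by simp [forTo, whenever, writesArr]), harr₂]
  clear hf₃
  set f := s₃.reg 13 with hf13
  refine wp_seq (wp_forTo (fun i s' => s'.reg 14 = 0 ↔ ∀ p < i, mem p →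
      s.arr 9 (f * n + p) ≠ 0 ∧ s.arr 9 (p * n + f) ≠ 0)
    (by rw [h.lo]; omega) (by rw [h.lo]; omega) (by simp [writesReg, whenever])
    (by simp [h14₃]) ?_ ?_)
  · rintro i hi s₄ hw₄ hr₄ hf₄ h1
    rw [hβ] at hi
    have harr₄ : s₄.arr = s₁.arr := by
      funext a
      rw [hf₄.2 a (by simp [forTo, whenever, writesArr]), harr₃]
    have h10 : s₄.reg 10 = c := by
      rw [hf₄.1 10 (by simp [forTo, whenever, writesReg]), h10₃]
    have h13 : s₄.reg 13 = f := hf₄.1 13 (by simp [forTo, whenever, writesReg])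
    have key : (Expr.cell 2 (Expr.reg 10 * .reg 3 + .reg 11 + 1) *
        (Expr.not (.cell 9 (Expr.reg 13 * .reg 0 + .reg 11)) +
          Expr.not (.cell 9 (Expr.reg 11 * .reg 0 + .reg 13)))).eval s₄ = 0 ↔
        (mem i → s.arr 9 (f * n + i) ≠ 0 ∧ s.arr 9 (i * n + f) ≠ 0) := by
      simp only [Expr.eval_cell, Expr.eval_add, Expr.eval_mul, Expr.eval_reg, Expr.eval_not,
        Expr.eval_one, harr₄, h10, h13, hr₄, h.reg₀ hw₄, h.reg₃ hw₄, h2, h9, mem]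
      by_cases ha : s.arr 2 (c * (n + 1) + i + 1) = 0 <;>
        by_cases hb : s.arr 9 (f * n + i) = 0 <;>
        by_cases hd : s.arr 9 (i * n + f) = 0 <;> simp [ha, hb, hd]
    refine wp_whenever (by rfl) (fun he => ?_) (fun he => ?_)
    · rw [ne_eq, key] at he
      refine wp_assign (by rfl) (by rw [h.lo]; omega) (fun _ => by simp; omega) ?_
      refine ⟨fun h1 => by simp at h1, fun h1 => absurd (h1 i (by omega)) he⟩
    · rw [key] at he
      simp only [Store.setReg_reg]
      norm_num
      rw [h1]
      refine ⟨fun h3 p hp hpm => ?_, fun h3 p hp => h3 p (by omega)⟩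
      rcases lt_or_eq_of_le (show p ≤ i by omega) with h4 | rfl
      · exact h3 p h4 hpm
      · exact he hpm
  rintro s₄ hw₄ hf₄ h14₄
  rw [hβ] at h14₄
  have h10₄ : s₄.reg 10 = c := by
    rw [hf₄.1 10 (by simp [forTo, whenever, writesReg]), h10₃]
  have h12₄ : s₄.reg 12 = s₃.reg 12 := hf₄.1 12 (by simp [forTo, whenever, writesReg])
  have h13₄ : s₄.reg 13 = f := hf₄.1 13 (by simp [forTo, whenever, writesReg])
  have h15₄ : s₄.reg 15 = J := by
    rw [hf₄.1 15 (by simp [forTo, whenever, writesReg]), h15₃]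
  have harr₄ : s₄.arr = s₁.arr := by
    funext a
    rw [hf₄.2 a (by simp [forTo, whenever, writesArr]), harr₃]
  clear hf₄
  have hcard : s₃.reg 12 = (members n (s.arr 2) c).card := h12₃
  let cond : Prop := (members n (s.arr 2) c).card = J ∧ s₄.reg 14 = 0
  refine wp_forTo (fun i s' =>
      (∀ e, s₁.arr 8 e ≠ 0 → s'.arr 8 e ≠ 0) ∧
      (∀ p < n, ∀ d < n, s'.arr 8 (p * n + d) ≠ 0 → s₁.arr 8 (p * n + d) ≠ 0 ∨
        (cond ∧ p = f ∧ s.arr 6 ((c * n + d) * 2 + 1) ≠ 0)) ∧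
      (cond → ∀ d < i, s.arr 6 ((c * n + d) * 2 + 1) ≠ 0 → s'.arr 8 (f * n + d) ≠ 0))
    (by rw [h.lo]; omega) (by rw [h.lo]; omega) (by simp [writesReg, whenever])
    ⟨by simp [harr₄], fun p _ d _ h => Or.inl (by simpa [harr₄] using h), by simp⟩ ?_ ?_
  · rintro i hi s₅ hw₅ hr₅ hf₅ ⟨h1, h3, h4⟩
    rw [hβ] at hi
    have h10 : s₅.reg 10 = c := by
      rw [hf₅.1 10 (by simp [forTo, whenever, writesReg]), h10₄]
    have h12 : s₅.reg 12 = (members n (s.arr 2) c).card := by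
      rw [hf₅.1 12 (by simp [forTo, whenever, writesReg]), h12₄, hcard]
    have h13 : s₅.reg 13 = f := by
      rw [hf₅.1 13 (by simp [forTo, whenever, writesReg]), h13₄]
    have h14 : s₅.reg 14 = s₄.reg 14 := hf₅.1 14 (by simp [forTo, whenever, writesReg])
    have h15 : s₅.reg 15 = J := by
      rw [hf₅.1 15 (by simp [forTo, whenever, writesReg]), h15₄]
    have h6' : s₅.arr 6 = s.arr 6 := by
      rw [hf₅.2 6 (by simp [forTo, whenever, writesArr]), harr₄, h6]
    have key : ((Expr.reg 12).eq (.reg 15) * Expr.not (.reg 14) *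
        .cell 6 ((Expr.reg 10 * .reg 0 + .reg 11) * 2 + 1)).eval s₅ ≠ 0 ↔
        cond ∧ s.arr 6 ((c * n + i) * 2 + 1) ≠ 0 := by
      simp only [Expr.eval_cell, Expr.eval_add, Expr.eval_mul, Expr.eval_reg, Expr.eval_not,
        Expr.eval_one, Expr.eval_two, Expr.eval_eq, h10, h12, h14, h15, hr₅, h.reg₀ hw₅, h6',
        cond, mul_ne_zero_iff]
      simp
    refine wp_whenever (by rfl) (fun he => ?_) (fun he => ?_)
    · rw [key] at he
      refine wp_store (by rfl) (by rfl) (fun _ => by simp; omega) ?_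
      simp only [Store.setReg_arr, Store.setArr_arr, if_true, Function.update_apply, Expr.eval_add,
        Expr.eval_mul, Expr.eval_reg, hr₅, h.reg₀ hw₅, Expr.eval_one, h13]
      refine ⟨fun e he' => ?_, fun p hp d hd h5 => ?_, fun hc d hd h5 => ?_⟩
      · split_ifs
        · exact one_ne_zero
        · exact h1 e he'
      · split_ifs at h5 with h7
        · obtain ⟨rfl, rfl⟩ := row_major_inj hd hi h7
          exact Or.inr ⟨he.1, rfl, he.2⟩
        · exact h3 p hp d hd h5
      · split_ifs with h7
        · exact one_ne_zero
        · rcases Nat.lt_succ_iff_lt_or_eq.1 hd with h8 | rfl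
          · exact h4 hc d h8 h5
          · exact absurd rfl h7
    · refine ⟨h1, h3, fun hc d hd h5 => ?_⟩
      rcases Nat.lt_succ_iff_lt_or_eq.1 hd with h8 | rfl
      · exact h4 hc d h8 h5
      · exact absurd he (key.2 ⟨hc, h5⟩)
  rintro s₅ hw₅ hf₅ ⟨h1, h3, h4⟩
  rw [hβ] at h4
  simp only [Store.setReg_arr]
  refine ⟨fun e he => h1 e (hmono e he), fun p hp d hd h5 => ?_, fun c' hc' hcJ hR => ?_⟩
  · rcases h3 p hp d hd h5 with h7 | ⟨⟨h7, h8⟩, rfl, h10⟩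
    · exact hsound p hp d hd h7
    · have hfm := h13₃ (by omega)
      refine Or.inr ⟨c, hc, h7, (hmem _).2 hfm, fun q hq => ?_, h10⟩
      obtain ⟨hq1, hq2⟩ := (hmem q).1 hq
      exact h14₄.1 h8 q hq1 hq2
  · rcases Nat.lt_succ_iff_lt_or_eq.1 hc' with h8 | rfl
    · obtain ⟨p, hp, hp'⟩ := hcompl c' h8 hcJ hR
      exact ⟨p, hp, fun d hd hv => h1 _ (hp' d hd hv)⟩
    · have hfm := (hmem _).2 (h13₃ (by omega))
      refine ⟨f, hfm, fun d hd hv => h4 ⟨hcJ, h14₄.2 fun p hp hpm => ?_⟩ d hd hv⟩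
      have hpm' := (hmem p).2 ⟨hp, hpm⟩
      exact ⟨hR f hfm p hpm', hR p hpm' f hfm⟩

/-! ## Output -/

/-- Number the classes of mutual relatedness in array `9`; put the number of the class of each state
into array `0` and the number of classes into register `12`. -/
def classProg : Prog :=
  .seq (.assign 12 0) (.forTo 10 0 (.seq (.assign 13 0) (.seq
    (.forTo 11 0 (.whenever ((Expr.reg 11).lt (.reg 10) *
        .cell 9 (Expr.reg 11 * .reg 0 + .reg 10) * .cell 9 (Expr.reg 10 * .reg 0 + .reg 11))
      (.seq (.assign 13 1) (.store 0 (.reg 10) (.cell 0 (.reg 11))))))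
    (.whenever (Expr.not (.reg 13))
      (.seq (.store 0 (.reg 10) (.reg 12)) (.assign 12 (Expr.reg 12 + 1)))))))

/-- Each state copies the number of an earlier related state, or opens a new class if there is none.
Transitivity makes the choice irrelevant. Array `0` may be overwritten because the search no longer
needs the transition table. -/
theorem wp_classProg {Γ : Setting} {n m k : ℕ} (h : Γ.Std n m k) {s : Store}
    (hrefl : ∀ y < n, s.arr 9 (y * n + y) ≠ 0)
    (htr : ∀ y < n, ∀ x < n, ∀ z < n, s.arr 9 (y * n + x) ≠ 0 → s.arr 9 (x * n + z) ≠ 0 →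
        s.arr 9 (y * n + z) ≠ 0) :
    WP Γ classProg s (fun s' =>
      (∀ p < n, ∀ q < n, s'.arr 0 p = s'.arr 0 q ↔
        s.arr 9 (p * n + q) ≠ 0 ∧ s.arr 9 (q * n + p) ≠ 0) ∧
      (∀ p < n, s'.arr 0 p < s'.reg 12) ∧ ∀ i < s'.reg 12, ∃ p < n, s'.arr 0 p = i) := by
  have hX := Γ.two_lt
  have hβ : Γ.β 0 = n := by rw [h.β]; rfl
  let E : ℕ → ℕ → Prop := fun p q => s.arr 9 (p * n + q) ≠ 0 ∧ s.arr 9 (q * n + p) ≠ 0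
  have hEs : ∀ p q, E p q → E q p := fun p q h => ⟨h.2, h.1⟩
  have hEt : ∀ p < n, ∀ q < n, ∀ r < n, E p q → E q r → E p r := fun p hp q hq r hr h1 h2 =>
    ⟨htr p hp q hq r hr h1.1 h2.1, htr r hr q hq p hp h2.2 h1.2⟩
  refine wp_seq (wp_assign (by rfl) (by rw [h.lo]; omega) (fun _ => by simp; omega) ?_)
  refine wp_forTo (fun j s' => (∀ p < j, ∀ q < j, s'.arr 0 p = s'.arr 0 q ↔ E p q) ∧
      (∀ p < j, s'.arr 0 p < s'.reg 12) ∧ (∀ i < s'.reg 12, ∃ p < j, s'.arr 0 p = i) ∧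
      s'.reg 12 ≤ j)
    (by rw [h.lo]; omega) h.lo.le (by simp [writesReg, whenever, forTo])
    (by simp) ?_ ?_
  · rintro q hq s₁ hw hr hf ⟨hI1, hI2, hI3, hI4⟩
    rw [hβ] at hq
    have h9 : s₁.arr 9 = s.arr 9 := by
      rw [hf.2 9 (by simp [forTo, whenever, writesArr])]; simp
    refine wp_seq (wp_assign (by rfl) (by rw [h.lo]; omega) (fun _ => by simp; omega) ?_)
    refine wp_seq (wp_forTo (fun i s' => (∀ p, p ≠ q → s'.arr 0 p = s₁.arr 0 p) ∧
        (s'.reg 13 = 0 → ∀ p < i, p < q → ¬ E p q) ∧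
        (s'.reg 13 ≠ 0 → ∃ p < q, E p q ∧ s'.arr 0 q = s₁.arr 0 p))
      (by rw [h.lo]; omega) (by rw [h.lo]; omega) (by simp [writesReg, whenever])
      (by simp) ?_ ?_)
    · rintro i hi s₂ hw₂ hr₂ hf₂ ⟨h1, h2, h3⟩
      rw [hβ] at hi
      have h9' : s₂.arr 9 = s.arr 9 := by
        rw [hf₂.2 9 (by simp [forTo, whenever, writesArr])]; simpa using h9
      have h10 : s₂.reg 10 = q := by
        rw [hf₂.1 10 (by simp [forTo, whenever, writesReg])]; simpa using hr
      have key : ((Expr.reg 11).lt (.reg 10) * .cell 9 (Expr.reg 11 * .reg 0 + .reg 10) *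
          .cell 9 (Expr.reg 10 * .reg 0 + .reg 11)).eval s₂ ≠ 0 ↔ i < q ∧ E i q := by
        simp only [Expr.eval_mul, Expr.eval_lt, Expr.eval_reg, Expr.eval_cell, Expr.eval_add, hr₂,
          h10, h.reg₀ hw₂, h9', mul_ne_zero_iff, E]
        simp [and_assoc]
      refine wp_whenever (by rfl) (fun he => ?_) (fun he => ?_)
      · rw [key] at he
        refine wp_seq (wp_assign (by rfl) (by rw [h.lo]; omega) (fun _ => by simp; omega) ?_)
        refine wp_store (by rfl) (by rfl) (fun hw' => hw'.1.2 _ _) ?_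
        simp only [Store.setReg_arr, Store.setArr_arr, if_true, Function.update_apply,
          Expr.eval_reg, Expr.eval_cell, Store.setReg_reg, Store.setArr_reg, Expr.eval_one]
        norm_num
        simp only [h10, hr₂, if_true]
        refine ⟨fun p hp => ?_, i, he.1, he.2, h1 i (by omega)⟩
        rw [if_neg hp, h1 p hp]
      · refine ⟨h1, fun h0 p hp hpq => ?_, ?_⟩
        · rcases Nat.lt_succ_iff_lt_or_eq.1 hp with h8 | rfl
          · exact h2 (by simpa using h0) p h8 hpq
          · exact fun hE => absurd he (key.2 ⟨hpq, hE⟩)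
        · simpa using h3
    · rintro s₂ hw₂ hf₂ ⟨h1, h2, h3⟩
      rw [hβ] at h2
      have h10 : s₂.reg 10 = q := by
        rw [hf₂.1 10 (by simp [forTo, whenever, writesReg])]; simpa using hr
      have h12 : s₂.reg 12 = s₁.reg 12 := by
        rw [hf₂.1 12 (by simp [forTo, whenever, writesReg])]; simp
      have hEqq : E q q := ⟨hrefl q hq, hrefl q hq⟩
      refine wp_whenever (by rfl) (fun he => ?_) (fun he => ?_)
      · have h13 : s₂.reg 13 = 0 := by by_contra hne; simp [hne] at he
        have hno : ∀ p < q, ¬ E p q := fun p hp => h2 h13 p (by omega) hp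
        refine wp_seq (wp_store (by rfl) (by rfl) (fun hw' => hw'.1.1 _) ?_)
        have hXn := h.sq_lt
        refine wp_assign (by rfl) (by rw [h.lo]; omega) (fun _ => by simp; omega) ?_
        simp only [Store.setReg_arr, Store.setArr_arr, if_true, Function.update_apply,
          Expr.eval_reg, Expr.eval_add, Store.setReg_reg, Store.setArr_reg, Expr.eval_one]
        norm_num
        simp only [h10, h12]
        have hval : ∀ p < q, (if p = q then s₁.reg 12 else s₂.arr 0 p) = s₁.arr 0 p := by
          intro p hp
          rw [if_neg (by omega), h1 p (by omega)]
        refine ⟨fun p hp p' hp' => ?_, fun p hp => ?_, fun i hi => ?_, hI4⟩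
        · rcases lt_or_eq_of_le (show p ≤ q by omega) with hp | rfl <;>
            rcases lt_or_eq_of_le hp' with hp' | rfl
          · rw [hval p hp, hval p' hp', hI1 p hp p' hp']
          · rw [hval p hp, if_pos rfl]
            exact ⟨fun h4 => absurd (hI2 p hp) (by omega), fun h4 => absurd h4 (hno p hp)⟩
          · rw [hval p' hp', if_pos rfl]
            exact ⟨fun h4 => absurd (hI2 p' hp') (by omega), fun h4 => absurd (hEs _ _ h4) (hno p' hp')⟩
          · simp [hEqq]
        · rcases lt_or_eq_of_le (show p ≤ q by omega) with hp | rfl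
          · rw [hval p hp]; exact (hI2 p hp).le
          · rw [if_pos rfl]
        · rcases lt_or_eq_of_le (show i ≤ s₁.reg 12 by omega) with hi | rfl
          · obtain ⟨p, hp, rfl⟩ := hI3 i hi
            exact ⟨p, by omega, hval p hp⟩
          · exact ⟨q, by omega, if_pos rfl⟩
      · have h13 : s₂.reg 13 ≠ 0 := by intro hne; simp [hne] at he
        obtain ⟨r, hrq, hrE, hrv⟩ := h3 h13
        simp only [Store.setReg_arr, Store.setReg_reg]
        norm_num
        rw [h12]
        have hval : ∀ p < q, s₂.arr 0 p = s₁.arr 0 p := fun p hp => h1 p (by omega)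
        refine ⟨fun p hp p' hp' => ?_, fun p hp => ?_, fun i hi => ?_, by omega⟩
        · rcases lt_or_eq_of_le (show p ≤ q by omega) with hp | rfl <;>
            rcases lt_or_eq_of_le hp' with hp' | rfl
          · rw [hval p hp, hval p' hp', hI1 p hp p' hp']
          · rw [hval p hp, hrv, hI1 p hp r hrq]
            exact ⟨fun h4 => hEt p (by omega) r (by omega) p' hq h4 hrE,
              fun h4 => hEt p (by omega) p' hq r (by omega) h4 (hEs _ _ hrE)⟩
          · rw [hval p' hp', hrv, hI1 r hrq p' hp']
            exact ⟨fun h4 => hEt p hq r (by omega) p' (by omega) (hEs _ _ hrE) h4,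
              fun h4 => hEt r (by omega) p hq p' (by omega) hrE h4⟩
          · simp [hEqq]
        · rcases lt_or_eq_of_le (show p ≤ q by omega) with hp | rfl
          · rw [hval p hp]; exact hI2 p hp
          · rw [hrv]; exact hI2 r hrq
        · obtain ⟨p, hp, rfl⟩ := hI3 i hi
          exact ⟨p, by omega, hval p hp⟩
  · rintro s' _ _ ⟨h1, h2, h3, -⟩
    rw [hβ] at h1 h2 h3
    exact ⟨h1, h2, h3⟩

/-- Write the adjacency matrix of the classes into array `1`. -/
def adjProg : Prog :=
  .forTo 10 0 (.forTo 11 0 (.whenever (Expr.cell 8 (Expr.reg 10 * .reg 0 + .reg 11) *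
      Expr.not ((Expr.cell 0 (.reg 10)).eq (.cell 0 (.reg 11))))
    (.store 1 (Expr.cell 0 (.reg 10) * .reg 12 + .cell 0 (.reg 11)) 1)))

open Classical in
theorem wp_adjProg {Γ : Setting} {n m k : ℕ} (h : Γ.Std n m k) {s : Store}
    (hs : ∀ i, s.arr 1 i = 0) :
    WP Γ adjProg s (fun s' => ∀ e, s'.arr 1 e =
      if ∃ p < n, ∃ q < n, s.arr 8 (p * n + q) ≠ 0 ∧ s.arr 0 p ≠ s.arr 0 q ∧
        e = s.arr 0 p * s.reg 12 + s.arr 0 q then 1 else 0) := by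
  have hX := Γ.two_lt
  have hβ : Γ.β 0 = n := by rw [h.β]; rfl
  refine wp_forTo₂ (fun j s' => ∀ e, s'.arr 1 e =
      if ∃ p < n, ∃ q < n, p * n + q < j ∧ s.arr 8 (p * n + q) ≠ 0 ∧ s.arr 0 p ≠ s.arr 0 q ∧
        e = s.arr 0 p * s.reg 12 + s.arr 0 q then 1 else 0)
    (by rw [h.lo]; omega) h.lo.le (by rw [h.lo]; omega) (by rw [h.lo]; omega) (by omega)
    (by simp [writesReg, whenever]) (by simp [writesReg, whenever])
    (fun _ _ _ _ _ h => h) (by simp [hs]) ?_ ?_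
  · intro y hy z hz s₁ hw hr hr' hf hI
    rw [hβ] at hI hy hz ⊢
    have h8 : s₁.arr 8 = s.arr 8 := hf.2 8 (by simp [forTo, whenever, writesArr])
    have h0 : s₁.arr 0 = s.arr 0 := hf.2 0 (by simp [forTo, whenever, writesArr])
    have h12 : s₁.reg 12 = s.reg 12 := hf.1 12 (by simp [forTo, whenever, writesReg])
    have key : (Expr.cell 8 (Expr.reg 10 * .reg 0 + .reg 11) *
        Expr.not ((Expr.cell 0 (.reg 10)).eq (.cell 0 (.reg 11)))).eval s₁ ≠ 0 ↔
        s.arr 8 (y * n + z) ≠ 0 ∧ s.arr 0 y ≠ s.arr 0 z := by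
      simp only [Expr.eval_mul, Expr.eval_reg, Expr.eval_cell, Expr.eval_add, Expr.eval_not,
        Expr.eval_eq, hr, hr', h.reg₀ hw, h8, h0, mul_ne_zero_iff]
      simp
    refine wp_whenever (by rfl) (fun he => wp_store (by rfl) (by rfl) (fun _ => by simp; omega) ?_)
      (fun he => ?_)
    · rw [key] at he
      simp only [Expr.eval_cell, Expr.eval_add, Expr.eval_mul, Expr.eval_reg, hr, hr',
        Store.setArr_arr, if_true, Function.update_apply, h0, h12, Expr.eval_one]
      intro e
      split_ifs with h1 h2 h2
      · rfl
      · exact absurd ⟨y, hy, z, hz, by omega, he.1, he.2, h1⟩ h2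
      · obtain ⟨p, hp, q, hq, h3, h4, h5, h6⟩ := h2
        rw [hI, if_pos]
        refine ⟨p, hp, q, hq, lt_of_le_of_ne (by omega) fun h7 => h1 ?_, h4, h5, h6⟩
        obtain ⟨rfl, rfl⟩ := row_major_inj hq hz h7
        exact h6
      · rw [hI, if_neg]
        rintro ⟨p, hp, q, hq, h3, h4⟩
        exact h2 ⟨p, hp, q, hq, by omega, h4⟩
    · intro e
      rw [hI]
      refine if_congr ?_ rfl rfl
      constructor
      · rintro ⟨p, hp, q, hq, h3, h4⟩
        exact ⟨p, hp, q, hq, by omega, h4⟩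
      · rintro ⟨p, hp, q, hq, h3, h4, h5, h6⟩
        refine ⟨p, hp, q, hq, lt_of_le_of_ne (by omega) fun h7 => ?_, h4, h5, h6⟩
        obtain ⟨rfl, rfl⟩ := row_major_inj hq hz h7
        exact absurd he (key.2 ⟨h4, h5⟩)
  · intro s' _ _ hI e
    rw [hI, hβ]
    refine if_congr ?_ rfl rfl
    constructor
    · rintro ⟨p, hp, q, hq, -, h4⟩
      exact ⟨p, hp, q, hq, h4⟩
    · rintro ⟨p, hp, q, hq, h4⟩
      exact ⟨p, hp, q, hq, row_major_lt hq hp, h4⟩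

/-! ## Words -/

namespace Automaton

variable {Q : Type u} {S : Type v} (A : Automaton Q S)

@[simp] theorem act_nil (q : Q) : A.act q [] = q := rfl

theorem act_snoc (q : Q) (w : List S) (a : S) : A.act q (w ++ [a]) = A.step (A.act q w) a := by
  simp [act]

theorem mem_excl {w : List S} {p : Q} : p ∈ A.excl w ↔ ∀ q, A.act q w ≠ p := by
  simp [excl]

theorem excl_nil : A.excl [] = ∅ := by
  ext p; simp [mem_excl]

theorem dupl_nil : A.dupl [] = ∅ := by
  ext p
  simp only [dupl, act_nil, Set.mem_ofPred_eq, Set.mem_empty_iff_false, iff_false]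
  rintro ⟨q₁, q₂, hne, rfl, rfl⟩
  exact hne rfl

/-- The new excluded set depends on the word only through its old one, so a code is a sufficient
state for the search. -/
theorem excl_snoc (w : List S) (a : S) :
    A.excl (w ++ [a]) = {p | ∀ q ∉ A.excl w, A.step q a ≠ p} := by
  ext p
  simp only [mem_excl, act_snoc, Set.mem_ofPred_eq, not_forall, not_not]
  constructor
  · rintro h q ⟨q', rfl⟩
    exact h q'
  · intro h q
    exact h _ ⟨q, rfl⟩

/-- Two states merged at q·wa were merged by `w` at q·w, or reached different states before `a`. In
the latter case q·wa has two `a`-preimages in the image of `w`, a condition visible in the counting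
table. -/
theorem act_mem_dupl_snoc (q : Q) (w : List S) (a : S) :
    A.act q (w ++ [a]) ∈ A.dupl (w ++ [a]) ↔ A.act q w ∈ A.dupl w ∨
      ∃ q₁ q₂, q₁ ≠ q₂ ∧ (q₁ ∉ A.excl w ∧ A.step q₁ a = A.step (A.act q w) a) ∧
        q₂ ∉ A.excl w ∧ A.step q₂ a = A.step (A.act q w) a := by
  have hmem : ∀ x, A.act x w ∉ A.excl w := fun x hx => A.mem_excl.1 hx x rfl
  constructor
  · rintro ⟨x, y, hne, hx, hy⟩
    simp only [act_snoc] at hx hy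
    by_cases h1 : A.act x w = A.act q w
    · by_cases h2 : A.act y w = A.act q w
      · exact Or.inl ⟨x, y, hne, h1, h2⟩
      · exact Or.inr ⟨_, _, h2, ⟨hmem y, hy⟩, hmem q, rfl⟩
    · exact Or.inr ⟨_, _, h1, ⟨hmem x, hx⟩, hmem q, rfl⟩
  · rintro (⟨x, y, hne, hx, hy⟩ | ⟨q₁, q₂, hne, ⟨h1, h1'⟩, h2, h2'⟩)
    · exact ⟨x, y, hne, by rw [act_snoc, act_snoc, hx], by rw [act_snoc, act_snoc, hy]⟩
    · simp only [mem_excl, not_forall, not_not] at h1 h2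
      obtain ⟨x, rfl⟩ := h1
      obtain ⟨y, rfl⟩ := h2
      exact ⟨x, y, fun h => hne (by rw [h]), by rw [act_snoc, act_snoc, h1'],
        by rw [act_snoc, act_snoc, h2']⟩

/-- The image of `wa` is an image of the image of `w`, so it is no larger. Discarding words of
defect above `k` thus loses no word of defect at most `k`. -/
theorem ncard_excl_le_snoc [Finite Q] (w : List S) (a : S) :
    (A.excl w).ncard ≤ (A.excl (w ++ [a])).ncard := by
  have h1 : ∀ w, (A.excl w).ncard + (Set.range (fun q => A.act q w)).ncard = Nat.card Q := by
    intro w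
    have := Set.ncard_add_ncard_compl (Set.range (fun q => A.act q w))
    rw [excl, ← Set.compl_eq_univ_sdiff]
    omega
  have h2 : (Set.range (fun q => A.act q (w ++ [a]))).ncard ≤
      (Set.range (fun q => A.act q w)).ncard := by
    have : Set.range (fun q => A.act q (w ++ [a])) =
        (fun q => A.step q a) '' Set.range (fun q => A.act q w) := by
      rw [← Set.range_comp]
      congr 1
      funext q
      exact A.act_snoc q w a
    rw [this]
    exact Set.ncard_image_le (Set.toFinite _)
  have := h1 w
  have := h1 (w ++ [a])
  omega

/-- If there were two duplicate states, one preimage of each could be removed from `Q` without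
shrinking the image. Then the |Q| - 1 states other than `p` would be covered by |Q| - 2 states. -/
theorem dupl_eq_singleton [Finite Q] {w : List S} {p q : Q} (hp : A.excl w = {p})
    (hq : q ∈ A.dupl w) : A.dupl w = {q} := by
  refine Set.eq_singleton_iff_unique_mem.2 ⟨hq, fun q' hq' => ?_⟩
  by_contra hne
  obtain ⟨x, y, hxy, hx, hy⟩ := hq
  obtain ⟨x', y', hxy', hx', hy'⟩ := hq'
  have hxx : x ≠ x' := by
    rintro rfl; exact hne (hx'.symm.trans hx)
  have hsub : Set.univ \ {p} ⊆ (fun z => A.act z w) '' (Set.univ \ {x, x'}) := by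
    rintro z ⟨-, hz⟩
    rw [← hp, mem_excl] at hz
    push Not at hz
    obtain ⟨u, rfl⟩ := hz
    by_cases h1 : u = x
    · refine ⟨y, ⟨trivial, ?_⟩, by simp only [hy, h1, hx]⟩
      rintro (h | h)
      · exact hxy h.symm
      · rw [Set.mem_singleton_iff] at h
        exact hne (by rw [← hx', ← h, hy])
    · by_cases h2 : u = x'
      · refine ⟨y', ⟨trivial, ?_⟩, by simp only [hy', h2, hx']⟩
        rintro (h | h)
        · exact hne (by rw [← hy', h, hx])
        · exact hxy' (Set.mem_singleton_iff.1 h).symm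
      · exact ⟨u, ⟨trivial, by simp [h1, h2]⟩, rfl⟩
  have h1 := (Set.ncard_le_ncard hsub (Set.toFinite _)).trans (Set.ncard_image_le (Set.toFinite _))
  rw [Set.ncard_sdiff (Set.subset_univ _), Set.ncard_sdiff (Set.subset_univ _), Set.ncard_singleton,
    Set.ncard_pair hxx] at h1
  have h2 : ({x, x'} : Set Q).ncard ≤ (Set.univ : Set Q).ncard :=
    Set.ncard_le_ncard (Set.subset_univ _) (Set.toFinite _)
  rw [Set.ncard_pair hxx] at h2
  omega

end Automaton

/-! ## Vertices over states -/

section Vertices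

variable {Q : Type u} {S : Type v} (A : Automaton Q S)

/-- The vertex of the `k`-th graph whose leafage contains a given state. -/
def vertexOf : (k : ℕ) → Q → Vtx Q k
  | 0, q => q
  | 1, q => q
  | k + 2, q => {D | D ∈ (gamma A (k + 1)).verts ∧
      (gamma A (k + 1)).Reach (vertexOf (k + 1) q) D ∧
      (gamma A (k + 1)).Reach D (vertexOf (k + 1) q)}

theorem verts_gamma (k : ℕ) : (gamma A (k + 1)).verts = Set.range (vertexOf A (k + 1)) := by
  induction k with
  | zero => exact Set.range_id.symm
  | succ k ih =>
    change (gamma A (k + 1)).clusters = _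
    ext C
    simp only [Graph.clusters, ih, Set.mem_ofPred_eq, Set.mem_range, exists_exists_eq_and]
    refine exists_congr fun q => ?_
    rw [eq_comm]
    simp only [vertexOf, ih, Set.mem_range]
    exact Iff.rfl

theorem vertexOf_mem_verts (k : ℕ) (q : Q) : vertexOf A (k + 1) q ∈ (gamma A (k + 1)).verts := by
  rw [verts_gamma]; exact ⟨q, rfl⟩

theorem vertexOf_mem_vertexOf {k : ℕ} {p q : Q} :
    vertexOf A (k + 1) p ∈ (show Set (Vtx Q (k + 1)) from vertexOf A (k + 2) q) ↔
      (gamma A (k + 1)).Reach (vertexOf A (k + 1) q) (vertexOf A (k + 1) p) ∧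
      (gamma A (k + 1)).Reach (vertexOf A (k + 1) p) (vertexOf A (k + 1) q) :=
  ⟨fun h => h.2, fun h => ⟨vertexOf_mem_verts A k p, h⟩⟩

theorem vertexOf_eq_iff {k : ℕ} {p q : Q} :
    vertexOf A (k + 2) p = vertexOf A (k + 2) q ↔
      (gamma A (k + 1)).Reach (vertexOf A (k + 1) p) (vertexOf A (k + 1) q) ∧
      (gamma A (k + 1)).Reach (vertexOf A (k + 1) q) (vertexOf A (k + 1) p) := by
  constructor
  · intro h
    have h1 : vertexOf A (k + 1) p ∈ (show Set (Vtx Q (k + 1)) from vertexOf A (k + 2) p) :=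
      (vertexOf_mem_vertexOf A).2 ⟨.refl, .refl⟩
    rw [h, vertexOf_mem_vertexOf] at h1
    exact h1.symm
  · rintro ⟨h1, h2⟩
    refine Set.ext fun D => ?_
    exact ⟨fun ⟨h3, h4, h5⟩ => ⟨h3, h2.trans h4, h5.trans h1⟩,
      fun ⟨h3, h4, h5⟩ => ⟨h3, h1.trans h4, h5.trans h2⟩⟩

/-- This removes nested sets from the argument: every vertex is some `vertexOf`, and its leafage is
the fibre of `vertexOf` through it. -/
theorem mem_leafage_vertexOf {k : ℕ} {p q : Q} :
    p ∈ leafage (k + 1) (vertexOf A (k + 1) q) ↔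
      vertexOf A (k + 1) p = vertexOf A (k + 1) q := by
  induction k generalizing p q with
  | zero => exact Iff.rfl
  | succ k ih =>
    constructor
    · rintro ⟨D, hD, hp⟩
      have hD' : D ∈ (gamma A (k + 1)).verts := hD.1
      rw [verts_gamma] at hD'
      obtain ⟨r, rfl⟩ := hD'
      rw [ih] at hp
      rw [← hp] at hD
      exact (vertexOf_eq_iff A).2 ((vertexOf_mem_vertexOf A).1 hD).symm
    · intro h
      exact ⟨vertexOf A (k + 1) p,
        (vertexOf_mem_vertexOf A).2 ((vertexOf_eq_iff A).1 h).symm, ih.2 rfl⟩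

/-! ## Relations that generate the graphs -/

open Relation

/-- The relation `F` on the states generates the `k`-th graph. -/
structure Generates (k : ℕ) (F : Q → Q → Prop) : Prop where
  reach : ∀ p q, (gamma A k).Reach (vertexOf A k p) (vertexOf A k q) ↔ ReflTransGen F p q
  edges : ∀ p q, (vertexOf A k p, vertexOf A k q) ∈ (gamma A k).edges ↔
    vertexOf A k p ≠ vertexOf A k q ∧
    ∃ p' q', vertexOf A k p' = vertexOf A k p ∧ vertexOf A k q' = vertexOf A k q ∧ F p' q'

variable {A}

/-- The path condition follows from the edge condition once states of the same vertex are joined by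
F-paths. A path of the graph lifts edge by edge, with these inner paths bridging the gaps;
conversely an F-pair is an edge or stays within one vertex. -/
theorem Generates.of_edges {k : ℕ} {F : Q → Q → Prop}
    (hF : ∀ p q, vertexOf A (k + 1) p = vertexOf A (k + 1) q → ReflTransGen F p q)
    (h : ∀ p q, (vertexOf A (k + 1) p, vertexOf A (k + 1) q) ∈ (gamma A (k + 1)).edges ↔
      vertexOf A (k + 1) p ≠ vertexOf A (k + 1) q ∧ ∃ p' q', vertexOf A (k + 1) p' =
        vertexOf A (k + 1) p ∧ vertexOf A (k + 1) q' = vertexOf A (k + 1) q ∧ F p' q') :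
    Generates A (k + 1) F := by
  refine ⟨fun p q => ⟨fun hr => ?_, fun hr => ?_⟩, h⟩
  · have key : ∀ C, (gamma A (k + 1)).Reach (vertexOf A (k + 1) p) C →
        ∀ q, C = vertexOf A (k + 1) q → ReflTransGen F p q := by
      intro C hC
      induction hC with
      | refl => exact fun q hq => hF p q hq
      | @tail D C' _ hDC ih =>
        rintro q rfl
        have hD := ((gamma A (k + 1)).edges_subset hDC).1
        rw [verts_gamma] at hD
        obtain ⟨r, rfl⟩ := hD
        obtain ⟨-, p', q', hp', hq', hF'⟩ := (h r q).1 hDC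
        exact (ih r rfl).trans ((hF r p' hp'.symm).trans ((ReflTransGen.single hF').trans
          (hF q' q hq')))
    exact key _ hr q rfl
  · induction hr with
    | refl => exact .refl
    | @tail x y _ hxy ih =>
      by_cases hne : vertexOf A (k + 1) x = vertexOf A (k + 1) y
      · rwa [← hne]
      · exact ih.tail ((h x y).2 ⟨hne, x, y, rfl, rfl, hxy⟩)

variable (A)

/-- The relation `F'` arises from `F` by adding, for the words `w` of defect `J` whose excluded
states are mutually related by `R`, pairs from an excluded state to each duplicate state. -/
structure Marks (J : ℕ) (R F F' : Q → Q → Prop) : Prop where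
  mono : ∀ p q, F p q → F' p q
  sound : ∀ p q, F' p q → F p q ∨ ∃ w, A.defect w = J ∧ p ∈ A.excl w ∧
    (∀ r ∈ A.excl w, R p r ∧ R r p) ∧ q ∈ A.dupl w
  complete : ∀ w, A.defect w = J → (∀ p ∈ A.excl w, ∀ q ∈ A.excl w, R p q) →
    ∀ q ∈ A.dupl w, ∃ p ∈ A.excl w, F' p q

variable {A}

/-- For defect `1` the relatedness condition reduces to reflexivity, and the source of a mark is
forced. A loop cannot arise because an excluded state has no preimage and a duplicate state has one.
-/
theorem Marks.generates_one [Finite Q] {R F F' : Q → Q → Prop} (h : Marks A 1 R F F')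
    (hR : ∀ p, R p p) (hF : ∀ p q, ¬ F p q) : Generates A 1 F' := by
  refine Generates.of_edges (k := 0) (fun p q (hpq : p = q) => hpq ▸ .refl) fun p q => ?_
  constructor
  · rintro ⟨w, hw, hp, hq⟩
    change A.excl w = {p} at hp
    change A.dupl w = {q} at hq
    obtain ⟨p', hp', hF'⟩ := h.complete w hw (by rw [hp]; rintro x rfl y rfl; exact hR _) q
      (by rw [hq]; rfl)
    rw [hp] at hp'
    obtain rfl : p' = p := hp'
    refine ⟨?_, p', q, rfl, rfl, hF'⟩
    rintro (rfl : p' = q)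
    have h1 : p' ∈ A.excl w := by rw [hp]; rfl
    have h2 : p' ∈ A.dupl w := by rw [hq]; rfl
    obtain ⟨x, _, _, hx, _⟩ := h2
    exact A.mem_excl.1 h1 x hx
  · rintro ⟨hne, p', q', (rfl : p' = p), (rfl : q' = q), hF'⟩
    obtain h1 | ⟨w, hw, hp, -, hq⟩ := h.sound p' q' hF'
    · exact absurd h1 (hF _ _)
    · obtain ⟨x, hx⟩ := Set.ncard_eq_one.1 hw
      rw [hx] at hp
      obtain rfl : p' = x := hp
      exact ⟨w, hw, hx, A.dupl_eq_singleton hx hq⟩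

/-- Two states have the same new vertex iff they are mutually F-reachable, so the words admitted by
`Marks` are those whose excluded states lie in one vertex. Old pairs give the edges of the
condensation and new marks the forced edges. Keeping the old pairs is what joins the states inside a
vertex. -/
theorem Marks.generates_succ {k : ℕ} {F F' : Q → Q → Prop}
    (h : Marks A (k + 2) (ReflTransGen F) F F') (hF : Generates A (k + 1) F) :
    Generates A (k + 2) F' := by
  have hN : ∀ p q, vertexOf A (k + 2) p = vertexOf A (k + 2) q ↔
      ReflTransGen F p q ∧ ReflTransGen F q p := fun p q => by
    rw [vertexOf_eq_iff, hF.reach, hF.reach]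
  have hN' : ∀ p q, vertexOf A (k + 1) p = vertexOf A (k + 1) q →
      vertexOf A (k + 2) p = vertexOf A (k + 2) q := fun p q hpq => by
    rw [vertexOf_eq_iff, hpq]; exact ⟨.refl, .refl⟩
  refine Generates.of_edges (k := k + 1)
    (fun p q hpq => ReflTransGen.mono h.mono _ _ ((hN p q).1 hpq).1) fun p q => ?_
  have hmem : ∀ (x : Vtx Q (k + 1)) p,
      x ∈ (show Set (Vtx Q (k + 1)) from vertexOf A (k + 2) p) →
      ∃ p', x = vertexOf A (k + 1) p' ∧ vertexOf A (k + 2) p' = vertexOf A (k + 2) p := by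
    intro x p hx
    have hx' : x ∈ (gamma A (k + 1)).verts := hx.1
    rw [verts_gamma] at hx'
    obtain ⟨p', rfl⟩ := hx'
    exact ⟨p', rfl, (vertexOf_eq_iff A).2 ((vertexOf_mem_vertexOf A).1 hx).symm⟩
  constructor
  · rintro (⟨-, -, hne, x, hx, y, hy, hxy⟩ | ⟨-, -, hne, w, hw, hp, d, hd, hdw⟩)
    · refine ⟨hne, ?_⟩
      obtain ⟨p', rfl, hp'⟩ := hmem x p hx
      obtain ⟨q', rfl, hq'⟩ := hmem y q hy
      obtain ⟨-, p'', q'', hp'', hq'', hF'⟩ := (hF.edges p' q').1 hxy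
      exact ⟨p'', q'', (hN' _ _ hp'').trans hp', (hN' _ _ hq'').trans hq', h.mono _ _ hF'⟩
    · refine ⟨hne, ?_⟩
      have hp' : ∀ x ∈ A.excl w, vertexOf A (k + 2) x = vertexOf A (k + 2) p := fun x hx =>
        (mem_leafage_vertexOf A).1 (hp hx)
      obtain ⟨x, hx, hF'⟩ := h.complete w hw (fun x hx y hy =>
        ((hN x y).1 ((hp' x hx).trans (hp' y hy).symm)).1) d hdw
      exact ⟨x, d, hp' x hx, (mem_leafage_vertexOf A).1 hd, hF'⟩
  · rintro ⟨hne, p', q', hp', hq', hF'⟩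
    obtain h1 | ⟨w, hw, hp, hr, hq⟩ := h.sound p' q' hF'
    · refine Or.inl ⟨vertexOf_mem_verts A (k + 1) p, vertexOf_mem_verts A (k + 1) q, hne,
        vertexOf A (k + 1) p', ?_, vertexOf A (k + 1) q', ?_, ?_⟩
      · exact (vertexOf_mem_vertexOf A).2 ((vertexOf_eq_iff A).1 hp').symm
      · exact (vertexOf_mem_vertexOf A).2 ((vertexOf_eq_iff A).1 hq').symm
      · refine (hF.edges p' q').2 ⟨fun heq => hne ?_, p', q', rfl, rfl, h1⟩
        rw [← hp', ← hq', hN' _ _ heq]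
    · refine Or.inr ⟨vertexOf_mem_verts A (k + 1) p, vertexOf_mem_verts A (k + 1) q, hne, w, hw,
        fun x hx => ?_, q', ?_, hq⟩
      · rw [mem_leafage_vertexOf, ← hp', hN]
        exact (hr x hx).symm
      · exact (mem_leafage_vertexOf A).2 hq'

end Vertices

/-- Stores that hold a generated graph. -/
theorem Generates.holds {n m k : ℕ} {A : Automaton (Fin n) (Fin m)} {F : Fin n → Fin n → Prop}
    (h : Generates A (k + 1) F) {s : Store}
    (hcl : ∀ p q : Fin n, s.arr 0 p = s.arr 0 q ↔
      vertexOf A (k + 1) p = vertexOf A (k + 1) q)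
    (hlt : ∀ p : Fin n, s.arr 0 p < s.reg 0)
    (hsurj : ∀ i < s.reg 0, ∃ p : Fin n, s.arr 0 p = i)
    (hone : ∀ e, (∃ p q : Fin n, F p q ∧ s.arr 0 p ≠ s.arr 0 q ∧
      e = s.arr 0 p * s.reg 0 + s.arr 0 q) → s.arr 1 e = 1)
    (hzero : ∀ e, (¬ ∃ p q : Fin n, F p q ∧ s.arr 0 p ≠ s.arr 0 q ∧
      e = s.arr 0 p * s.reg 0 + s.arr 0 q) → s.arr 1 e = 0) :
    Holds s (gamma A (k + 1)) := by
  choose rep hrep using fun i : Fin (s.reg 0) => hsurj i i.2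
  refine ⟨s.reg 0, fun i => vertexOf A (k + 1) (rep i), fun i j hij => ?_, ?_, rfl, fun q i => ?_,
    fun i j => ?_⟩
  · have := (hcl _ _).2 hij
    rw [hrep, hrep] at this
    exact Fin.ext this
  · rw [verts_gamma]
    ext C
    constructor
    · rintro ⟨i, rfl⟩; exact ⟨_, rfl⟩
    · rintro ⟨q, rfl⟩
      exact ⟨⟨s.arr 0 q, hlt q⟩, (hcl _ _).1 (hrep _)⟩
  · rw [mem_leafage_vertexOf, ← hcl, hrep]
  · have key : (∃ p q : Fin n, F p q ∧ s.arr 0 p ≠ s.arr 0 q ∧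
        (i : ℕ) * s.reg 0 + j = s.arr 0 p * s.reg 0 + s.arr 0 q) ↔
        (vertexOf A (k + 1) (rep i), vertexOf A (k + 1) (rep j)) ∈ (gamma A (k + 1)).edges := by
      rw [h.edges]
      constructor
      · rintro ⟨p, q, hF, hne, he⟩
        obtain ⟨h1, h2⟩ := row_major_inj j.2 (hlt q) he
        refine ⟨?_, p, q, ?_, ?_, hF⟩
        · rw [ne_eq, ← hcl, hrep, hrep, h1, h2]; exact hne
        · rw [← hcl, hrep, h1]
        · rw [← hcl, hrep, h2]
      · rintro ⟨hne, p, q, hp, hq, hF⟩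
        rw [← hcl, hrep] at hp hq
        refine ⟨p, q, hF, ?_, by rw [hp, hq]⟩
        rw [hp, hq]
        rwa [ne_eq, ← hcl, hrep, hrep] at hne
    split_ifs with h1
    · exact hone _ (key.2 h1)
    · exact hzero _ (fun h2 => h1 (key.1 h2))

open Relation

/-! ## The tables of an automaton -/

/-- The set of states coded by a number: `p` belongs to it if `p + 1` is a digit in base `n + 1`. -/
def decode (n c : ℕ) : Set (Fin n) := {p | (p : ℕ) + 1 ∈ Nat.digits (n + 1) c}

theorem card_filter_range_eq_ncard (n : ℕ) (P : ℕ → Prop) [DecidablePred P] :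
    ((Finset.range n).filter P).card = {p : Fin n | P p}.ncard := by
  rw [← Set.ncard_image_of_injective _ Fin.val_injective, ← Set.ncard_coe_finset]
  congr 1
  ext p
  simp only [Finset.coe_filter, Finset.mem_range, Set.mem_ofPred_eq, Set.mem_image]
  constructor
  · rintro ⟨h1, h2⟩; exact ⟨⟨p, h1⟩, h2, rfl⟩
  · rintro ⟨q, h1, rfl⟩; exact ⟨q.2, h1⟩

/-- The table `M` lists the members of the codes below `(n + 1) ^ k`. -/
def MemTable (n k : ℕ) (M : ℕ → ℕ) : Prop :=
  ∀ c < (n + 1) ^ k, ∀ p : Fin n, M (c * (n + 1) + p + 1) ≠ 0 ↔ p ∈ decode n c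

theorem memTable_of_digits {n k : ℕ} {M : ℕ → ℕ}
    (h : ∀ x < (n + 1) ^ k * (n + 1),
      M x ≠ 0 ↔ x % (n + 1) ∈ Nat.digits (n + 1) (x / (n + 1))) : MemTable n k M := by
  intro c hc p
  have hp : (p : ℕ) + 1 < n + 1 := by omega
  rw [add_assoc, h _ (row_major_lt hp hc), row_major_mod hp, row_major_div hp]
  exact Iff.rfl

namespace MemTable
variable {n k : ℕ} {M : ℕ → ℕ} (h : MemTable n k M) {c : ℕ} (hc : c < (n + 1) ^ k)
include h hc

theorem mem_members (p : Fin n) : (p : ℕ) ∈ members n M c ↔ p ∈ decode n c := by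
  rw [← h c hc p]
  simp [members]

theorem card_members : (members n M c).card = (decode n c).ncard := by
  rw [members, card_filter_range_eq_ncard]
  congr 1
  ext p
  exact h c hc p

end MemTable

/-- The table of an automaton that array `0` holds. -/
def StepTable {n m : ℕ} (A : Automaton (Fin n) (Fin m)) (T : ℕ → ℕ) : Prop :=
  ∀ (q : Fin n) (a : Fin m), T (q * m + a) = A.step q a

section Tables

variable {n m k : ℕ} {A : Automaton (Fin n) (Fin m)} {T M C S : ℕ → ℕ}

/-- The counted indices of the cell for `c`, `a`, `p` correspond to the states outside `c` sent to
`p` by `a`; cardinality zero or above one thus says that `p` becomes excluded or is hit twice. -/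
theorem mem_cnt_filter (hT : StepTable A T) (hM : MemTable n k M) {c : ℕ} (hc : c < (n + 1) ^ k)
    (a : Fin m) (p : Fin n) (x : ℕ) :
    x ∈ (Finset.range ((n + 1) ^ k * m * n)).filter (fun x =>
        M (x / n / m * (n + 1) + x % n + 1) = 0 ∧
        x / n * n + T (x % n * m + x / n % m) = (c * m + a) * n + p) ↔
      ∃ q : Fin n, (q ∉ decode n c ∧ A.step q a = p) ∧ x = (c * m + a) * n + q := by
  rw [Finset.mem_filter, Finset.mem_range]
  have hn : 0 < n := p.pos
  constructor
  · rintro ⟨hx, h1, h2⟩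
    have hq : x % n < n := Nat.mod_lt _ hn
    have ha : x / n % m < m := Nat.mod_lt _ a.pos
    rw [hT ⟨x % n, hq⟩ ⟨x / n % m, ha⟩] at h2
    obtain ⟨h3, h4⟩ := row_major_inj (Fin.is_lt _) p.2 h2
    have h5 : x / n % m = a := by rw [h3]; exact row_major_mod a.2
    have h6 : x / n / m = c := by rw [h3]; exact row_major_div a.2
    refine ⟨⟨x % n, hq⟩, ⟨?_, ?_⟩, ?_⟩
    · rw [← hM c hc]
      rw [h6] at h1
      simpa using h1
    · refine Fin.ext ?_
      rw [← h4]
      congr 2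
      exact Fin.ext h5.symm
    · rw [← h3, mul_comm]
      exact (Nat.div_add_mod x n).symm
  · rintro ⟨q, ⟨h1, h2⟩, rfl⟩
    rw [row_major_div q.2, row_major_mod q.2, row_major_div a.2, row_major_mod a.2, hT q a, h2]
    refine ⟨row_major_lt q.2 (row_major_lt a.2 hc), ?_, rfl⟩
    by_contra h3
    exact h1 ((hM c hc q).1 h3)

/-- The specification of the counting table. -/
def CntTable (A : Automaton (Fin n) (Fin m)) (k : ℕ) (C : ℕ → ℕ) : Prop :=
  ∀ c < (n + 1) ^ k, ∀ (a : Fin m) (p : Fin n),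
    (C ((c * m + a) * n + p) = 0 ↔ ∀ q ∉ decode n c, A.step q a ≠ p) ∧
    (1 < C ((c * m + a) * n + p) ↔ ∃ q₁ q₂, q₁ ≠ q₂ ∧ (q₁ ∉ decode n c ∧ A.step q₁ a = p) ∧
      q₂ ∉ decode n c ∧ A.step q₂ a = p)

theorem cntTable_of_card (hT : StepTable A T) (hM : MemTable n k M)
    (hC : ∀ y, C y = ((Finset.range ((n + 1) ^ k * m * n)).filter (fun x =>
        M (x / n / m * (n + 1) + x % n + 1) = 0 ∧
        x / n * n + T (x % n * m + x / n % m) = y)).card) : CntTable A k C := by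
  intro c hc a p
  have key := mem_cnt_filter hT hM hc a p
  rw [hC]
  constructor
  · rw [Finset.card_eq_zero, Finset.eq_empty_iff_forall_notMem]
    constructor
    · intro h q hq hqp
      exact h _ ((key _).2 ⟨q, ⟨hq, hqp⟩, rfl⟩)
    · intro h x hx
      obtain ⟨q, ⟨h1, h2⟩, -⟩ := (key x).1 hx
      exact h q h1 h2
  · rw [Finset.one_lt_card]
    constructor
    · rintro ⟨x, hx, y, hy, hne⟩
      obtain ⟨q₁, h1, rfl⟩ := (key x).1 hx
      obtain ⟨q₂, h2, rfl⟩ := (key y).1 hy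
      exact ⟨q₁, q₂, fun h => hne (by rw [h]), h1, h2⟩
    · rintro ⟨q₁, q₂, hne, h1, h2⟩
      refine ⟨_, (key _).2 ⟨q₁, h1, rfl⟩, _, (key _).2 ⟨q₂, h2, rfl⟩, fun h => hne ?_⟩
      exact Fin.ext (row_major_inj q₁.2 q₂.2 h).2

/-- The specification of the successor table. -/
def NextTable (A : Automaton (Fin n) (Fin m)) (k : ℕ) (S : ℕ → ℕ) : Prop :=
  ∀ c < (n + 1) ^ k, ∀ a : Fin m,
    ({p | ∀ q ∉ decode n c, A.step q a ≠ p}.ncard ≤ k → ∃ e < (n + 1) ^ k,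
      S (c * m + a) = e + 1 ∧ decode n e = {p | ∀ q ∉ decode n c, A.step q a ≠ p}) ∧
    (S (c * m + a) ≠ 0 → {p | ∀ q ∉ decode n c, A.step q a ≠ p}.ncard ≤ k)

theorem nextTable_of_spec (hC : CntTable A k C)
    (hS : ∀ y < (n + 1) ^ k * m, NextSpec n k (fun p => C (y * n + p)) (S y)) :
    NextTable A k S := by
  intro c hc a
  have hcard : ((Finset.range n).filter (fun p => C ((c * m + a) * n + p) = 0)).card =
      {p | ∀ q ∉ decode n c, A.step q a ≠ p}.ncard := by
    rw [card_filter_range_eq_ncard]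
    congr 1
    ext p
    exact (hC c hc a p).1
  obtain ⟨h1, h2⟩ := hS (c * m + a) (row_major_lt a.2 hc)
  rw [hcard] at h1 h2
  refine ⟨fun hle => ?_, fun h0 => not_lt.1 fun hlt => h0 (h2 hlt)⟩
  obtain ⟨e, he, hSe, hd⟩ := h1 hle
  refine ⟨e, he, hSe, ?_⟩
  ext p
  refine (hd _).trans ?_
  change _ ↔ ∀ q ∉ decode n c, A.step q a ≠ p
  rw [← (hC c hc a p).1]
  constructor
  · rintro ⟨p', -, h3, h4⟩
    obtain rfl : (p : ℕ) = p' := by omega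
    exact h3
  · exact fun h3 => ⟨p, p.2, h3, rfl⟩

/-! ## The search through the words -/

open Classical in
/-- The node that a word `w` and a state `q` lead to, when `c` codes the set of excluded states. -/
noncomputable def wordNode (A : Automaton (Fin n) (Fin m)) (c : ℕ) (w : List (Fin m))
    (q : Fin n) : ℕ :=
  (c * n + A.act q w) * 2 + if A.act q w ∈ A.dupl w then 1 else 0

theorem wordNode_div (c : ℕ) (w : List (Fin m)) (q : Fin n) :
    wordNode A c w q / 2 = c * n + A.act q w := by
  rw [wordNode, row_major_div]
  split_ifs <;> omega

open Classical in
theorem wordNode_mod (c : ℕ) (w : List (Fin m)) (q : Fin n) :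
    wordNode A c w q % 2 = if A.act q w ∈ A.dupl w then 1 else 0 := by
  rw [wordNode, row_major_mod]
  split_ifs <;> omega

theorem wordNode_lt {c : ℕ} (hc : c < (n + 1) ^ k) (w : List (Fin m)) (q : Fin n) :
    wordNode A c w q < (n + 1) ^ k * n * 2 := by
  rw [wordNode]
  refine row_major_lt ?_ (row_major_lt (Fin.is_lt _) hc)
  split_ifs <;> omega

/-- The link between arithmetic and words: the machine's successor of the node of `w` is the node of
`w ++ [a]`, for the same starting state `q`. -/
theorem succNode_wordNode (hT : StepTable A T) (hC : CntTable A k C) {c e : ℕ}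
    (hc : c < (n + 1) ^ k) {w : List (Fin m)} (hw : decode n c = A.excl w) (q : Fin n)
    (a : Fin m) (hS : S (c * m + a) = e + 1) :
    succNode n m T C S (wordNode A c w q) a = wordNode A e (w ++ [a]) q := by
  rw [succNode, wordNode_div, wordNode_mod, row_major_div (Fin.is_lt _),
    row_major_mod (Fin.is_lt _), hS, hT, Nat.add_sub_cancel, wordNode, A.act_mem_dupl_snoc,
    A.act_snoc, ← hw, ← (hC c hc a _).2]
  congr 1
  split_ifs <;> grind

/-- The specification of the search. -/
def VisitTable (A : Automaton (Fin n) (Fin m)) (k : ℕ) (V : ℕ → ℕ) : Prop :=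
  (∀ c < (n + 1) ^ k, ∀ d : Fin n, V ((c * n + d) * 2 + 1) ≠ 0 →
    ∃ w, decode n c = A.excl w ∧ d ∈ A.dupl w) ∧
  ∀ w, A.defect w ≤ k → ∃ c < (n + 1) ^ k, decode n c = A.excl w ∧
    ∀ d ∈ A.dupl w, V ((c * n + d) * 2 + 1) ≠ 0

/-- The nodes that words lead to. -/
def IsWordNode (A : Automaton (Fin n) (Fin m)) (k u : ℕ) : Prop :=
  ∃ c < (n + 1) ^ k, ∃ w q, decode n c = A.excl w ∧ u = wordNode A c w q

theorem decode_zero : decode n 0 = ∅ := by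
  ext p; simp [decode]

theorem wordNode_nil (q : Fin n) : wordNode A 0 [] q = q * 2 := by
  simp [wordNode, A.dupl_nil]

theorem isWordNode_seed {q : ℕ} (hq : q < n) : IsWordNode A k (q * 2) :=
  ⟨0, by positivity, [], ⟨q, hq⟩, by rw [decode_zero, A.excl_nil], (wordNode_nil (⟨q, hq⟩ : Fin n)).symm⟩

theorem IsWordNode.succ (hT : StepTable A T) (hC : CntTable A k C) (hS : NextTable A k S) {u : ℕ}
    (hu : IsWordNode A k u) {a : ℕ} (ha : a < m) (h0 : S (u / 2 / n * m + a) ≠ 0) :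
    IsWordNode A k (succNode n m T C S u a) := by
  obtain ⟨c, hc, w, q, hw, rfl⟩ := hu
  rw [wordNode_div, row_major_div (Fin.is_lt _)] at h0
  obtain ⟨e, he, hSe, hde⟩ := (hS c hc ⟨a, ha⟩).1 ((hS c hc ⟨a, ha⟩).2 h0)
  refine ⟨e, he, w ++ [⟨a, ha⟩], q, ?_, succNode_wordNode hT hC hc hw q ⟨a, ha⟩ hSe⟩
  rw [hde, A.excl_snoc, hw]

theorem succNode_lt (hn : 0 < n) (hT : StepTable A T) (hS : NextTable A k S) {u : ℕ}
    (hu : u < (n + 1) ^ k * n * 2) {a : ℕ} (ha : a < m) (h0 : S (u / 2 / n * m + a) ≠ 0) :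
    succNode n m T C S u a < (n + 1) ^ k * n * 2 := by
  have hc : u / 2 / n < (n + 1) ^ k := by
    rw [Nat.div_div_eq_div_mul]
    refine Nat.div_lt_of_lt_mul ?_
    calc u < _ := hu
      _ = _ := by ring
  obtain ⟨e, he, hSe, -⟩ := (hS _ hc ⟨a, ha⟩).1 ((hS _ hc ⟨a, ha⟩).2 h0)
  simp only at hSe
  have hT' := hT ⟨u / 2 % n, Nat.mod_lt _ hn⟩ ⟨a, ha⟩
  simp only at hT'
  rw [succNode, hSe, hT', Nat.add_sub_cancel]
  refine row_major_lt ?_ (row_major_lt (Fin.is_lt _) he)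
  split_ifs <;> omega

/-- A visited node with bit one comes from some word, which witnesses its duplicate state. For the
converse, induction on the word yields one code for all starting states at once; this matters
because a set has several codes, and all duplicates of `w` must appear with the same one. -/
theorem visitTable_of_closed {V : ℕ → ℕ} (hT : StepTable A T) (hC : CntTable A k C)
    (hS : NextTable A k S) (hV : ∀ u, V u ≠ 0 → IsWordNode A k u)
    (hseed : ∀ q < n, V (q * 2) ≠ 0)
    (hcl : ∀ u < (n + 1) ^ k * n * 2, V u ≠ 0 → ∀ a < m, S (u / 2 / n * m + a) ≠ 0 →
      V (succNode n m T C S u a) ≠ 0) : VisitTable A k V := by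
  refine ⟨fun c hc d hd => ?_, fun w hw => ?_⟩
  · obtain ⟨c', hc', w, q, hw, he⟩ := hV _ hd
    have h1 := congrArg (· / 2) he
    have h2 := congrArg (· % 2) he
    simp only [wordNode_div, wordNode_mod] at h1 h2
    rw [row_major_div (by omega)] at h1
    rw [row_major_mod (by omega)] at h2
    obtain ⟨rfl, h3⟩ := row_major_inj d.2 (Fin.is_lt _) h1
    refine ⟨w, hw, ?_⟩
    rw [Fin.ext h3]
    by_contra h4
    rw [if_neg h4] at h2
    exact one_ne_zero h2
  · have key : ∃ c < (n + 1) ^ k, decode n c = A.excl w ∧ ∀ q, V (wordNode A c w q) ≠ 0 := by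
      induction w using List.reverseRecOn with
      | nil =>
        refine ⟨0, by positivity, by rw [decode_zero, A.excl_nil], fun q => ?_⟩
        rw [wordNode_nil]
        exact hseed q q.2
      | append_singleton w a ih =>
        obtain ⟨c, hc, hcw, hvis⟩ := ih ((A.ncard_excl_le_snoc w a).trans hw)
        have hset : {p | ∀ q ∉ decode n c, A.step q a ≠ p} = A.excl (w ++ [a]) := by
          rw [A.excl_snoc, hcw]
        obtain ⟨e, he, hSe, hde⟩ := (hS c hc a).1 (by rw [hset]; exact hw)
        refine ⟨e, he, hde.trans hset, fun q => ?_⟩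
        rw [← succNode_wordNode hT hC hc hcw q a hSe]
        refine hcl _ (wordNode_lt hc w q) (hvis q) a a.2 ?_
        rw [wordNode_div, row_major_div (Fin.is_lt _), hSe]
        omega
    obtain ⟨c, hc, hcw, hvis⟩ := key
    refine ⟨c, hc, hcw, fun d hd => ?_⟩
    obtain ⟨q, q', hne, hq, hq'⟩ := hd
    have := hvis q
    rwa [wordNode, if_pos ⟨q, q', hne, rfl, hq'.trans hq.symm⟩, hq] at this

end Tables

/-! ## The levels -/

/-- The relation on the states that a table holds. -/
def tableRel (n : ℕ) (f : ℕ → ℕ) (p q : Fin n) : Prop := f (p * n + q) ≠ 0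

section Levels

variable {Γ : Setting} {n m k : ℕ} {A : Automaton (Fin n) (Fin m)}

theorem wp_markProg_marks (h : Γ.Std n m k) {s : Store} {J : ℕ} (hJ : 1 ≤ J) (hJk : J ≤ k)
    (hsJ : s.reg 15 = J) (hM : MemTable n k (s.arr 2)) (hV : VisitTable A k (s.arr 6)) :
    WP Γ markProg s (fun s' => Marks A J (tableRel n (s.arr 9)) (tableRel n (s.arr 8))
      (tableRel n (s'.arr 8))) := by
  refine wp_mono (wp_markProg h hJ hsJ) ?_
  rintro s' - - ⟨h1, h2, h3⟩
  refine ⟨fun p q => h1 _, fun p d hpd => ?_, fun w hw hR d hd => ?_⟩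
  · rcases h2 p p.2 d d.2 hpd with h4 | ⟨c, hc, hcard, hp, hrel, hvis⟩
    · exact Or.inl h4
    · obtain ⟨w, hw, hdw⟩ := hV.1 c hc d hvis
      rw [hM.card_members hc, hw] at hcard
      rw [hM.mem_members hc, hw] at hp
      refine Or.inr ⟨w, hcard, hp, fun r hr => ?_, hdw⟩
      rw [← hw, ← hM.mem_members hc] at hr
      exact hrel r hr
  · obtain ⟨c, hc, hcw, hvis⟩ := hV.2 w (hw.trans_le hJk)
    have hlt : ∀ p ∈ members n (s.arr 2) c, p < n := fun p hp => by
      simp only [members, Finset.mem_filter, Finset.mem_range] at hp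
      exact hp.1
    have hmem : ∀ p (hp : p ∈ members n (s.arr 2) c), (⟨p, hlt p hp⟩ : Fin n) ∈ A.excl w := by
      intro p hp
      rw [← hcw, ← hM.mem_members hc]
      exact hp
    obtain ⟨p, hp, hpd⟩ := h3 c hc (by rw [hM.card_members hc, hcw]; exact hw)
      (fun p hp q hq => hR _ (hmem p hp) _ (hmem q hq))
    exact ⟨_, hmem p hp, hpd d d.2 (hvis d hd)⟩

/-- Replace the relation in array `9` by the closure of the relation in array `8`. -/
def closeProg : Prog := .seq copyProg transProg

/-- The old closure supplies reflexivity and, because F is contained in the new relation, adds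
nothing beyond the new closure. -/
theorem wp_closeProg (h : Γ.Std n m k) {s : Store} {F : Fin n → Fin n → Prop}
    (h9 : ∀ p q, tableRel n (s.arr 9) p q ↔ ReflTransGen F p q)
    (hF : ∀ p q, F p q → tableRel n (s.arr 8) p q) :
    WP Γ closeProg s (fun s' => ∀ p q, tableRel n (s'.arr 9) p q ↔
      ReflTransGen (tableRel n (s.arr 8)) p q) := by
  refine wp_seq (wp_mono (wp_copyProg h) ?_)
  intro s₁ _ _ h1
  refine wp_mono (wp_transProg h (fun y z => ∃ (hy : y < n) (hz : z < n),
    ReflTransGen (tableRel n (s.arr 8)) ⟨y, hy⟩ ⟨z, hz⟩) ?_ ?_) ?_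
  · rintro x y z ⟨hx, hy, hxy⟩ ⟨_, hz, hyz⟩
    exact ⟨hx, hz, hxy.trans hyz⟩
  · intro y hy z hz hyz
    refine ⟨hy, hz, ?_⟩
    rcases (h1 y hy z hz).1 hyz with h2 | h2
    · exact ReflTransGen.mono hF _ _ ((h9 ⟨y, hy⟩ ⟨z, hz⟩).1 h2)
    · exact .single h2
  · rintro s' - - ⟨h2, h3, h4⟩ p q
    refine ⟨fun hpq => (h3 p p.2 q q.2 hpq).2.2, fun hpq => ?_⟩
    induction hpq with
    | refl => exact h2 _ ((h1 p p.2 p p.2).2 (Or.inl ((h9 p p).2 .refl)))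
    | @tail x y _ hxy ih =>
      exact h4 p p.2 x x.2 y y.2 ih (h2 _ ((h1 x x.2 y y.2).2 (Or.inr hxy)))

/-- The relation that generates the `j`-th graph; for `j = 0` it is empty. -/
def GeneratesUpTo (A : Automaton (Fin n) (Fin m)) (j : ℕ) (F : Fin n → Fin n → Prop) : Prop :=
  (j = 0 → ∀ p q, ¬ F p q) ∧ (1 ≤ j → Generates A j F)

theorem GeneratesUpTo.succ {j : ℕ} {F F' : Fin n → Fin n → Prop} (hF : GeneratesUpTo A j F)
    (h : Marks A (j + 1) (ReflTransGen F) F F') : Generates A (j + 1) F' := by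
  cases j with
  | zero => exact h.generates_one (fun _ => .refl) (hF.1 rfl)
  | succ j => exact h.generates_succ (hF.2 (by omega))

theorem GeneratesUpTo.vertexOf_eq {j : ℕ} {F : Fin n → Fin n → Prop} (hF : GeneratesUpTo A j F)
    (p q : Fin n) : vertexOf A (j + 1) p = vertexOf A (j + 1) q ↔
      ReflTransGen F p q ∧ ReflTransGen F q p := by
  cases j with
  | zero =>
    constructor
    · rintro (rfl : p = q)
      exact ⟨.refl, .refl⟩
    · rintro ⟨h, -⟩
      rcases ReflTransGen.cases_head h with rfl | ⟨x, hx, -⟩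
      · rfl
      · exact absurd hx (hF.1 rfl _ _)
  | succ j => rw [vertexOf_eq_iff, (hF.2 (by omega)).reach, (hF.2 (by omega)).reach]

/-- Process the levels `1, …, k - 1`. -/
def levelProg : Prog :=
  .forTo 16 9 (.seq (.assign 15 (Expr.reg 16 + 1)) (.seq markProg closeProg))

/-- Array `8` holds the generating relation and array `9` its reflexive transitive closure. The loop
stops before level `k`, which is only marked: its vertices are the classes of level `k - 1`, so no
further closure is needed. -/
theorem wp_levelProg (h : Γ.Std n m k) {s : Store} (hM : MemTable n k (s.arr 2))
    (hV : VisitTable A k (s.arr 6)) (h8 : ∀ i, s.arr 8 i = 0)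
    (h9 : ∀ y < n, ∀ z < n, s.arr 9 (y * n + z) ≠ 0 ↔ y = z) :
    WP Γ levelProg s (fun s' => GeneratesUpTo A (k - 1) (tableRel n (s'.arr 8)) ∧
      ∀ p q, tableRel n (s'.arr 9) p q ↔ ReflTransGen (tableRel n (s'.arr 8)) p q) := by
  have hX := Γ.two_lt
  have hβ : Γ.β 9 = k - 1 := by rw [h.β]; rfl
  refine wp_forTo (fun j s' => GeneratesUpTo A j (tableRel n (s'.arr 8)) ∧
      ∀ p q, tableRel n (s'.arr 9) p q ↔ ReflTransGen (tableRel n (s'.arr 8)) p q)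
    (by rw [h.lo]; omega) (by rw [h.lo]; omega)
    (by simp [writesReg, whenever, forTo, markProg, closeProg, copyProg, transProg]) ?_ ?_
    (fun s' _ _ hI => by rw [hβ] at hI; exact hI)
  · have hemp : ∀ p q, ¬ tableRel n (s.arr 8) p q := fun p q => by simp [tableRel, h8]
    refine ⟨⟨fun _ => hemp, fun h => by omega⟩, fun p q => ?_⟩
    simp only [tableRel, Store.setReg_arr]
    rw [h9 p p.2 q q.2]
    constructor
    · intro h
      rw [Fin.ext h]
    · intro h
      rcases ReflTransGen.cases_head h with rfl | ⟨x, hx, -⟩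
      · rfl
      · exact absurd hx (hemp _ _)
  · rintro j hj s₁ hw hr hf ⟨hgen, hrel⟩
    rw [hβ] at hj
    have h2 : s₁.arr 2 = s.arr 2 := hf.2 2
      (by simp [writesArr, whenever, forTo, markProg, closeProg, copyProg, transProg])
    have h6 : s₁.arr 6 = s.arr 6 := hf.2 6
      (by simp [writesArr, whenever, forTo, markProg, closeProg, copyProg, transProg])
    refine wp_seq (wp_assign (by rfl) (by rw [h.lo]; omega) (fun _ => ?_) ?_)
    · have := hw.1.1 9
      rw [hw.2 9 (by rw [h.lo]; omega), hβ] at this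
      simp [hr]; omega
    refine wp_seq (wp_mono (wp_markProg_marks (A := A) (J := j + 1) h (by omega) (by omega)
      (by simp [hr]) (by simpa [h2] using hM) (by simpa [h6] using hV)) ?_)
    intro s₂ hw₂ hf₂ hmarks
    simp only [Store.setReg_arr] at hmarks
    have h9' : s₂.arr 9 = s₁.arr 9 := by
      rw [hf₂.2 9 (by simp [writesArr, whenever, forTo, markProg])]; simp
    have heq : tableRel n (s₁.arr 9) = ReflTransGen (tableRel n (s₁.arr 8)) := by
      funext p q
      exact propext (hrel p q)
    rw [heq] at hmarks
    refine wp_mono (wp_closeProg h (F := tableRel n (s₁.arr 8)) (by rw [h9']; exact hrel)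
      hmarks.mono) ?_
    intro s₃ hw₃ hf₃ h3
    have h8' : s₃.arr 8 = s₂.arr 8 := hf₃.2 8
      (by simp [writesArr, whenever, forTo, closeProg, copyProg, transProg])
    simp only [Store.setReg_arr, h8']
    exact ⟨⟨fun h => by omega, fun _ => hgen.succ hmarks⟩, h3⟩

end Levels

/-! ## The whole program -/

/-- The part of the program that works with the constants in the registers `0, …, 9`. -/
def mainProg : Prog :=
  .seq memProg (.seq cntProg (.seq nextProg (.seq seedProg (.seq searchProg (.seq idProg
    (.seq levelProg (.seq (.assign 15 (.reg 2)) (.seq markProg (.seq classProg adjProg)))))))))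

theorem wp_mainProg {Γ : Setting} {n m k : ℕ} {A : Automaton (Fin n) (Fin m)} (h : Γ.Std n m k)
    (hk : 1 ≤ k) {s : Store} (hT : StepTable A (s.arr 0)) (hs : ∀ a, a ≠ 0 → ∀ i, s.arr a i = 0) :
    WP Γ mainProg s (fun s' => Holds (s'.setReg 0 (s'.reg 12)) (gamma A k)) := by
  refine wp_seq (wp_mono (wp_memProg h (hs 2 (by omega))) ?_)
  intro s₁ hw₁ hf₁ hmem
  have hM₁ : MemTable n k (s₁.arr 2) := memTable_of_digits hmem
  have e₁ : ∀ a, a ≠ 2 → s₁.arr a = s.arr a := fun a ha =>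
    hf₁.2 a (by simp [memProg, writesArr, forTo, whenever, ha])
  refine wp_seq (wp_mono (wp_cntProg h (by rw [e₁ 3 (by omega)]; exact hs 3 (by omega))) ?_)
  intro s₂ hw₂ hf₂ hcnt
  have hC₂ : CntTable A k (s₂.arr 3) :=
    cntTable_of_card (by rw [e₁ 0 (by omega)]; exact hT) hM₁ hcnt
  have e₂ : ∀ a, a ≠ 3 → s₂.arr a = s₁.arr a := fun a ha =>
    hf₂.2 a (by simp [cntProg, writesArr, forTo, whenever, ha])
  have e₂' : ∀ a, a ≠ 2 → a ≠ 3 → s₂.arr a = s.arr a := fun a h1 h2 => (e₂ a h2).trans (e₁ a h1)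
  refine wp_seq (wp_mono (wp_nextProg h
    (by rw [e₂' 4 (by omega) (by omega)]; exact hs 4 (by omega))) ?_)
  intro s₃ hw₃ hf₃ hnext
  have hS₃ : NextTable A k (s₃.arr 4) := nextTable_of_spec hC₂ hnext
  have e₃ : ∀ a, a ≠ 4 → s₃.arr a = s₂.arr a := fun a ha =>
    hf₃.2 a (by simp [nextProg, writesArr, forTo, whenever, ha])
  have hT₃ : StepTable A (s₃.arr 0) := by
    rw [e₃ 0 (by omega), e₂' 0 (by omega) (by omega)]; exact hT
  have hC₃ : CntTable A k (s₃.arr 3) := by rw [e₃ 3 (by omega)]; exact hC₂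
  have hM₃ : MemTable n k (s₃.arr 2) := by rw [e₃ 2 (by omega), e₂ 2 (by omega)]; exact hM₁
  have z₃ : ∀ a, a ≠ 0 → a ≠ 2 → a ≠ 3 → a ≠ 4 → ∀ i, s₃.arr a i = 0 := fun a h0 h2 h3 h4 => by
    rw [e₃ a h4, e₂' a h2 h3]; exact hs a h0
  clear hnext hcnt hmem hf₁ hf₂ hf₃ e₁ e₂ e₂' e₃
  refine wp_seq (wp_mono (wp_seedProg (Good := IsWordNode A k) h
    (z₃ 6 (by omega) (by omega) (by omega) (by omega)) (fun q hq => isWordNode_seed hq)) ?_)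
  rintro s₄ hw₄ hf₄ ⟨hinv, hseed⟩
  have e₄ : ∀ a, a ≠ 6 → a ≠ 7 → s₄.arr a = s₃.arr a := fun a h6 h7 =>
    hf₄.2 a (by simp [seedProg, pushProg, writesArr, forTo, whenever, h6, h7])
  rw [← e₄ 0 (by omega) (by omega)] at hT₃
  rw [← e₄ 2 (by omega) (by omega)] at hM₃
  rw [← e₄ 3 (by omega) (by omega)] at hC₃
  rw [← e₄ 4 (by omega) (by omega)] at hS₃
  refine wp_seq (wp_mono (wp_searchProg (Good := IsWordNode A k) h
    (fun u hu a ha h0 => succNode_lt h.n_pos hT₃ hS₃ hu ha h0)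
    (fun u hu a ha h0 hg => hg.succ hT₃ hC₃ hS₃ ha h0) hinv) ?_)
  rintro s₅ hw₅ hf₅ ⟨hmono, hgood, hcl⟩
  have hV₅ : VisitTable A k (s₅.arr 6) :=
    visitTable_of_closed hT₃ hC₃ hS₃ hgood (fun q hq => hmono _ (hseed q hq)) hcl
  have e₅ : ∀ a, a ≠ 6 → a ≠ 7 → s₅.arr a = s₄.arr a := fun a h6 h7 =>
    hf₅.2 a (by simp [searchProg, pushProg, writesArr, forTo, whenever, h6, h7])
  rw [← e₅ 2 (by omega) (by omega)] at hM₃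
  have z₅ : ∀ a, a ≠ 0 → a ≠ 2 → a ≠ 3 → a ≠ 4 → a ≠ 6 → a ≠ 7 → ∀ i, s₅.arr a i = 0 :=
    fun a h0 h2 h3 h4 h6 h7 => by rw [e₅ a h6 h7, e₄ a h6 h7]; exact z₃ a h0 h2 h3 h4
  clear hinv hseed hmono hgood hcl hf₄ hf₅ e₄ e₅ hT₃ hC₃ hS₃ z₃
  refine wp_seq (wp_mono (wp_idProg h
    (z₅ 9 (by omega) (by omega) (by omega) (by omega) (by omega) (by omega))) ?_)
  intro s₆ hw₆ hf₆ hid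
  have e₆ : ∀ a, a ≠ 9 → s₆.arr a = s₅.arr a := fun a ha =>
    hf₆.2 a (by simp [idProg, writesArr, forTo, ha])
  refine wp_seq (wp_mono (wp_levelProg (A := A) h (by rw [e₆ 2 (by omega)]; exact hM₃)
    (by rw [e₆ 6 (by omega)]; exact hV₅) (by
      rw [e₆ 8 (by omega)]
      exact z₅ 8 (by omega) (by omega) (by omega) (by omega) (by omega) (by omega)) hid) ?_)
  rintro s₇ hw₇ hf₇ ⟨hgen, hrel⟩
  have e₇ : ∀ a, a ≠ 8 → a ≠ 9 → s₇.arr a = s₅.arr a := fun a h8 h9 => by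
    rw [hf₇.2 a (by simp [levelProg, markProg, closeProg, copyProg, transProg, writesArr, forTo,
      whenever, h8, h9]), e₆ a h9]
  refine wp_seq (wp_assign (by rfl) (by rw [h.lo]; omega) (fun hw => hw.1.1 2) ?_)
  refine wp_seq (wp_mono (wp_markProg_marks (A := A) (J := k) h hk le_rfl (by simp [h.reg₂ hw₇])
    (by simpa [e₇ 2 (by omega) (by omega)] using hM₃)
    (by simpa [e₇ 6 (by omega) (by omega)] using hV₅)) ?_)
  intro s₈ hw₈ hf₈ hmarks
  simp only [Store.setReg_arr] at hmarks
  have e₈ : ∀ a, a ≠ 8 → s₈.arr a = s₇.arr a := fun a ha => by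
    rw [hf₈.2 a (by simp [markProg, writesArr, forTo, whenever, ha])]; simp
  have heq : tableRel n (s₇.arr 9) = ReflTransGen (tableRel n (s₇.arr 8)) := by
    funext p q
    exact propext (hrel p q)
  obtain ⟨j, rfl⟩ : ∃ j, k = j + 1 := ⟨k - 1, by omega⟩
  rw [Nat.add_sub_cancel] at hgen
  have hG : Generates A (j + 1) (tableRel n (s₈.arr 8)) :=
    hgen.succ (by rw [← heq]; exact hmarks)
  have h9' : s₈.arr 9 = s₇.arr 9 := e₈ 9 (by omega)
  refine wp_seq (wp_mono (wp_classProg h (fun y hy => ?_) (fun y hy x hx z hz h1 h2 => ?_)) ?_)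
  · rw [h9']
    exact (hrel ⟨y, hy⟩ ⟨y, hy⟩).2 .refl
  · rw [h9'] at h1 h2 ⊢
    exact (hrel ⟨y, hy⟩ ⟨z, hz⟩).2 (((hrel ⟨y, hy⟩ ⟨x, hx⟩).1 h1).trans
      ((hrel ⟨x, hx⟩ ⟨z, hz⟩).1 h2))
  rintro s₉ hw₉ hf₉ ⟨hcl, hlt, hsurj⟩
  have e₉ : ∀ a, a ≠ 0 → s₉.arr a = s₈.arr a := fun a ha =>
    hf₉.2 a (by simp [classProg, writesArr, forTo, whenever, ha])
  refine wp_mono (wp_adjProg h (by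
    rw [e₉ 1 (by omega), e₈ 1 (by omega), e₇ 1 (by omega) (by omega)]
    exact z₅ 1 (by omega) (by omega) (by omega) (by omega) (by omega) (by omega))) ?_
  intro s' hw' hf' hadj
  have h0 : s'.arr 0 = s₉.arr 0 := hf'.2 0 (by simp [adjProg, writesArr, forTo, whenever])
  have h12 : s'.reg 12 = s₉.reg 12 := hf'.1 12 (by simp [adjProg, writesReg, forTo, whenever])
  have hex : ∀ e, (∃ p q : Fin n, tableRel n (s₈.arr 8) p q ∧ s₉.arr 0 p ≠ s₉.arr 0 q ∧
      e = s₉.arr 0 p * s₉.reg 12 + s₉.arr 0 q) ↔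
      ∃ p < n, ∃ q < n, s₉.arr 8 (p * n + q) ≠ 0 ∧ s₉.arr 0 p ≠ s₉.arr 0 q ∧
        e = s₉.arr 0 p * s₉.reg 12 + s₉.arr 0 q := by
    intro e
    rw [e₉ 8 (by omega)]
    constructor
    · rintro ⟨p, q, h1⟩; exact ⟨p, p.2, q, q.2, h1⟩
    · rintro ⟨p, hp, q, hq, h1⟩; exact ⟨⟨p, hp⟩, ⟨q, hq⟩, h1⟩
  refine hG.holds ?_ ?_ ?_ ?_ ?_
  · intro p q
    simp only [Store.setReg_arr, h0]
    rw [hcl p p.2 q q.2, hgen.vertexOf_eq, ← hrel, ← hrel, h9']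
    rfl
  · intro p
    simpa [h0, h12] using hlt p p.2
  · intro i hi
    simp only [Store.setReg_arr, Store.setReg_reg, if_true, h0, h12] at hi ⊢
    obtain ⟨p, hp, hpi⟩ := hsurj i hi
    exact ⟨⟨p, hp⟩, hpi⟩
  · intro e he
    simp only [Store.setReg_arr, Store.setReg_reg, if_true, h0, h12] at he ⊢
    rw [hadj, if_pos ((hex e).1 he)]
  · intro e he
    simp only [Store.setReg_arr, Store.setReg_reg, if_true, h0, h12] at he ⊢
    rw [hadj, if_neg (fun h1 => he ((hex e).2 h1))]

/-! ## Computing the constants -/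

/-- Multiply register `4` by register `3` and increase register `2`, `k` times. -/
def powProg : ℕ → Prog
  | 0 => .skip
  | k + 1 => .seq (powProg k) (.seq (.assign 2 (Expr.reg 2 + 1))
      (.assign 4 (Expr.reg 4 * .reg 3)))

/-- Compute the constants in the registers `2, …, 9`. -/
def setupProg (k : ℕ) : Prog :=
  .seq (.assign 2 0) (.seq (.assign 4 1) (.seq (.assign 3 (Expr.reg 0 + 1)) (.seq (powProg k)
    (.seq (.assign 5 (Expr.reg 4 * .reg 3)) (.seq (.assign 6 (Expr.reg 4 * .reg 1))
    (.seq (.assign 7 (Expr.reg 6 * .reg 0)) (.seq (.assign 8 (Expr.reg 4 * .reg 0 * 2))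
    (.assign 9 (Expr.reg 2 - 1)))))))))

section Setup
variable {Γ : Setting} {n m k : ℕ}

/-- The recursion on `k` takes place in the program text. Register `2` reaches `k` by counting
because `Expr.Ok` admits only literals up to `2`. -/
theorem wp_powProg (hlo : Γ.lo = 0) (hk : k + 1 < Γ.X) (hX : (n + 1) ^ k < Γ.X) {s : Store}
    (h2 : s.reg 2 = 0) (h3 : s.reg 3 = n + 1) (h4 : s.reg 4 = 1) {j : ℕ} (hj : j ≤ k) :
    WP Γ (powProg j) s (fun s' => s'.arr = s.arr ∧ s'.reg 0 = s.reg 0 ∧ s'.reg 1 = s.reg 1 ∧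
      s'.reg 2 = j ∧ s'.reg 3 = n + 1 ∧ s'.reg 4 = (n + 1) ^ j) := by
  induction j with
  | zero => exact wp_skip ⟨rfl, rfl, rfl, h2, h3, h4⟩
  | succ j ih =>
    refine wp_seq (wp_mono (ih (by omega)) ?_)
    rintro s' - - ⟨ha, h0', h1', h2', h3', h4'⟩
    have hle : (n + 1) ^ (j + 1) ≤ (n + 1) ^ k := Nat.pow_le_pow_right (by omega) hj
    refine wp_seq (wp_assign (by rfl) (by omega) (fun _ => by simp [h2']; omega) ?_)
    refine wp_assign (by rfl) (by omega) (fun _ => ?_) ?_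
    · simp [h3', h4', ← pow_succ]; omega
    · simp [ha, h0', h1', h2', h3', h4', pow_succ]

theorem wp_setupProg (hlo : Γ.lo = 0) (hn : k < n)
    (h7 : (n + 1) ^ k * m * n + 1 < Γ.X) (h8 : (n + 1) ^ k * n * 2 + 1 < Γ.X) {s : Store}
    (h0 : s.reg 0 = n) (h1 : s.reg 1 = m) :
    WP Γ (setupProg k) s (fun s' => s'.arr = s.arr ∧ ∀ x < 10, s'.reg x = consts n m k x) := by
  have hX := Γ.two_lt
  have hN : 0 < (n + 1) ^ k := by positivity
  have a1 : (n + 1) ^ k ≤ (n + 1) ^ k * n := Nat.le_mul_of_pos_right _ (by omega)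
  have a2 : n ≤ (n + 1) ^ k * n := Nat.le_mul_of_pos_left _ hN
  have a3 : (n + 1) ^ k * m ≤ (n + 1) ^ k * m * n := Nat.le_mul_of_pos_right _ (by omega)
  have a4 : (n + 1) ^ k * (n + 1) = (n + 1) ^ k * n + (n + 1) ^ k := by ring
  refine wp_seq (wp_assign (by rfl) (by omega) (fun _ => by simp; omega) ?_)
  refine wp_seq (wp_assign (by rfl) (by omega) (fun _ => by simp; omega) ?_)
  refine wp_seq (wp_assign (by rfl) (by omega) (fun _ => by simp [h0]; omega) ?_)
  refine wp_seq (wp_mono (wp_powProg (n := n) (k := k) hlo (by omega) (by omega)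
    (by simp) (by simp [h0]) (by simp) le_rfl) ?_)
  rintro s' - - ⟨ha, h0', h1', h2', h3', h4'⟩
  simp [h0, h1] at ha h0' h1'
  refine wp_seq (wp_assign (by rfl) (by omega) (fun _ => by simp [h3', h4']; omega) ?_)
  refine wp_seq (wp_assign (by rfl) (by omega) (fun _ => by simp [h1', h4']; omega) ?_)
  refine wp_seq (wp_assign (by rfl) (by omega) (fun _ => by simp [h1', h4', h0']; omega) ?_)
  refine wp_seq (wp_assign (by rfl) (by omega) (fun _ => by simp [h4', h0']; omega) ?_)
  refine wp_assign (by rfl) (by omega) (fun _ => by simp [h2']; omega) ⟨by simp [ha], ?_⟩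
  intro x hx
  interval_cases x <;> simp [consts, h0', h1', h2', h3', h4']

end Setup

/-! ## Running times -/

section Cost
variable (e f : Expr)

theorem Expr.cost_zero : (0 : Expr).cost = 1 := rfl
theorem Expr.cost_one : (1 : Expr).cost = 1 := rfl
theorem Expr.cost_two : (2 : Expr).cost = 1 := rfl
theorem Expr.cost_reg (x : ℕ) : (Expr.reg x).cost = 1 := rfl
theorem Expr.cost_cell (a : ℕ) : (Expr.cell a e).cost = e.cost + 1 := rfl
theorem Expr.cost_add : (e + f).cost = e.cost + f.cost + 1 := rfl
theorem Expr.cost_sub : (e - f).cost = e.cost + f.cost + 1 := rfl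
theorem Expr.cost_mul : (e * f).cost = e.cost + f.cost + 1 := rfl
theorem Expr.cost_div : (e / f).cost = e.cost + f.cost + 1 := rfl
theorem Expr.cost_mod : (e % f).cost = e.cost + f.cost + 1 := rfl
theorem Expr.cost_eq : (e.eq f).cost = e.cost + f.cost + 1 := rfl
theorem Expr.cost_lt : (e.lt f).cost = e.cost + f.cost + 1 := rfl
theorem Expr.cost_not : e.not.cost = e.cost + 1 + 1 := rfl

end Cost

section Time

variable (β : ℕ → ℕ)

theorem time_forTo (i b : ℕ) (p : Prog) :
    (Prog.forTo i b p).time β = β b * (p.time β + 8) + 6 := by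
  change 2 + (β b * (p.time β + 4 + 4) + 4) = _
  ring

theorem time_powProg (k : ℕ) : (powProg k).time β = 8 * k + 1 := by
  induction k with
  | zero => rfl
  | succ k ih =>
    simp only [powProg, Prog.time, ih, Expr.cost_add, Expr.cost_mul, Expr.cost_reg, Expr.cost_one]
    ring

theorem time_setupProg (k : ℕ) : (setupProg k).time β = 8 * k + 31 := by
  simp only [setupProg, Prog.time, time_powProg, Expr.cost_add, Expr.cost_mul, Expr.cost_reg,
    Expr.cost_one, Expr.cost_zero, Expr.cost_two, Expr.cost_sub]
  ring

end Time

/-- All terms reduce to three bounds: (n+1)^k m n ≤ 2^k m n^(2k), n² ≤ m n^(2k), and (k-1) n³ ≤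
(k-1) m n^(2k). The last holds trivially for `k = 1`, where no closure is computed. The constant
`10000` is generous. -/
theorem time_mainProg_le {n m k : ℕ} (hk : 1 ≤ k) (hn : 1 ≤ n) (hm : 1 ≤ m) :
    mainProg.time (consts n m k) ≤ 10000 * (2 ^ k + 1) * k * (m * n ^ (2 * k)) := by
  obtain ⟨κ, rfl⟩ : ∃ κ, k = κ + 1 := ⟨k - 1, by omega⟩
  simp only [mainProg, memProg, cntProg, nextProg, seedProg, searchProg, idProg, levelProg,
    markProg, closeProg, copyProg, transProg, classProg, adjProg, pushProg, time_forTo,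
    Prog.whenever, Prog.time, Expr.cost_zero, Expr.cost_one, Expr.cost_two,
    Expr.cost_reg, Expr.cost_cell, Expr.cost_add, Expr.cost_sub, Expr.cost_mul, Expr.cost_div,
    Expr.cost_mod, Expr.cost_eq, Expr.cost_lt, Expr.cost_not, consts, Nat.add_sub_cancel]
  set N := (n + 1) ^ (κ + 1) with hN
  set D := 2 ^ (κ + 1) with hD
  set U := m * n ^ (2 * (κ + 1)) with hU
  have hpow : n ^ (2 * (κ + 1)) = n ^ (κ + 1) * n * n ^ κ := by ring
  have hNn : N ≤ D * n ^ (κ + 1) := by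
    rw [hN, hD, ← mul_pow]
    exact Nat.pow_le_pow_left (by omega) _
  have hnκ : 1 ≤ n ^ κ := Nat.one_le_pow _ _ hn
  have b1 : N * m * n ≤ D * U := by
    calc N * m * n ≤ (D * n ^ (κ + 1)) * m * n := by gcongr
      _ = D * (m * (n ^ (κ + 1) * n * 1)) := by ring
      _ ≤ D * (m * (n ^ (κ + 1) * n * n ^ κ)) := by gcongr
      _ = D * U := by rw [hU, hpow]
  have hNm : N * m ≤ N * m * n := Nat.le_mul_of_pos_right _ hn
  have hNn' : N * n ≤ N * m * n := by
    have : N * 1 * n ≤ N * m * n := by gcongr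
    simpa using this
  have hN1 : N ≤ N * n := Nat.le_mul_of_pos_right _ hn
  have hn2 : n * n ≤ U := by
    calc n * n = 1 * n ^ 2 := by ring
      _ ≤ m * n ^ (2 * (κ + 1)) := by gcongr; omega
  have hn1 : n ≤ n * n := Nat.le_mul_of_pos_right _ hn
  have hn3 : κ * (n * n * n) ≤ κ * U := by
    rcases Nat.eq_zero_or_pos κ with rfl | hκ
    · simp
    · refine Nat.mul_le_mul_left _ ?_
      calc n * n * n = 1 * n ^ 3 := by ring
        _ ≤ m * n ^ (2 * (κ + 1)) := by gcongr; omega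
  have c1 : κ * (N * n) ≤ κ * (D * U) := Nat.mul_le_mul_left _ (hNn'.trans b1)
  have c2 : κ * N ≤ κ * (D * U) := Nat.mul_le_mul_left _ (hN1.trans (hNn'.trans b1))
  have c3 : κ * (n * n) ≤ κ * U := Nat.mul_le_mul_left _ hn2
  have c4 : κ * n ≤ κ * U := Nat.mul_le_mul_left _ (hn1.trans hn2)
  have c5 : κ * 1 ≤ κ * U := Nat.mul_le_mul_left _ (hn.trans (hn1.trans hn2))
  clear_value N D U
  clear hpow hNn hN hD hU hnκ
  nlinarith only [b1, hNm, hNn', hN1, hn2, hn1, hn3, c1, c2, c3, c4, c5, hn, hm]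

end ReachDFA

/-! ### The theorem: word size and constants -/

open ReachDFA
/-- For each fixed `k ≥ 1` there is a program that, for every automaton with `n > k` states and
`m ≥ 1` letters, builds the graph `Γ_k(A)` in `O(m n^{2k} log n)` steps on a machine with words of
`O(log (n m))` bits; the constants depend only on `k`. -/
theorem theorem4 (k : ℕ) (hk : 1 ≤ k) :
    ∃ (p : Prog) (c : ℕ) (K : ℝ), ∀ (n m : ℕ), k < n → 1 ≤ m →
      ∀ A : Automaton (Fin n) (Fin m),
        ∃ (t : ℕ) (s : Store),
          Exec ((n * m) ^ c) p (inputStore A) t s ∧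
          Holds s (gamma A k) ∧
          (t : ℝ) ≤ K * ((m : ℝ) * (n : ℝ) ^ (2 * k) * Real.log n) := by
  set C : ℕ := 8 * k + 31 + 10000 * (2 ^ k + 1) * k + 2 with hC
  -- The last assignment delivers the number of vertices; during the main program register `0` is
  -- protected and holds `n`.
  refine ⟨.seq (setupProg k) (.seq mainProg (.assign 0 (.reg 12))), (2 * k + 3) * 20,
    C / Real.log 2, fun n m hn hm A => ?_⟩
  have hnm : 2 ≤ n * m := by
    calc 2 ≤ n * 1 := by omega
      _ ≤ n * m := Nat.mul_le_mul_left _ hm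
  have hnle : n ≤ n * m := Nat.le_mul_of_pos_right _ hm
  have hmle : m ≤ n * m := Nat.le_mul_of_pos_left _ (by omega)
  -- The power `Y` bounds the number of table cells, and two more factors `n * m ≥ 2` give `4 * Y ≤
  -- X`, enough room for `2 * Y + 1`.
  set X := (n * m) ^ (2 * k + 3) with hX
  set Y := (n * m) ^ (2 * k + 1) with hY
  have hY1 : n * m ≤ Y := Nat.le_self_pow (by omega) _
  have hXY : 4 * Y ≤ X := by
    calc 4 * Y = 2 ^ 2 * Y := by norm_num
      _ ≤ (n * m) ^ 2 * Y := by gcongr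
      _ = X := by rw [hX, hY, ← pow_add]; congr 1; omega
  have hN : (n + 1) ^ k ≤ n ^ (2 * k) := by
    rw [pow_mul]
    refine Nat.pow_le_pow_left ?_ _
    -- Since `n ≥ 2`, one has n + 1 ≤ n².
    nlinarith
  have hNmn : (n + 1) ^ k * m * n ≤ Y := by
    calc (n + 1) ^ k * m * n ≤ n ^ (2 * k) * m * n := by gcongr
      _ = n ^ (2 * k + 1) * m := by ring
      _ ≤ n ^ (2 * k + 1) * m ^ (2 * k + 1) := by gcongr; exact Nat.le_self_pow (by omega) _
      _ = Y := by rw [hY, mul_pow]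
  have hNn : (n + 1) ^ k * n * 2 ≤ Y * 2 := by
    refine Nat.mul_le_mul_right _ (le_trans ?_ hNmn)
    calc (n + 1) ^ k * n = (n + 1) ^ k * 1 * n := by ring
      _ ≤ _ := by gcongr
  have h7 : (n + 1) ^ k * m * n + 1 < X := by omega
  have h8 : (n + 1) ^ k * n * 2 + 1 < X := by omega
  have hB : X ^ 20 ≤ (n * m) ^ ((2 * k + 3) * 20) := by rw [hX, ← pow_mul]
  -- Two settings with the same bounds: during the setup no register is protected, since the
  -- constants are just being written; afterwards the first ten are.
  let Γ₀ : Setting := ⟨(n * m) ^ ((2 * k + 3) * 20), X, 0, fun _ => 0, by omega, hB⟩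
  let Γ : Setting := ⟨(n * m) ^ ((2 * k + 3) * 20), X, 10, consts n m k, by omega, hB⟩
  have hΓ : Γ.Std n m k := ⟨rfl, rfl, by omega, h7, h8⟩
  have hwf₀ : Γ₀.WF (inputStore A) := by
    refine ⟨⟨fun x => ?_, fun a i => ?_⟩, fun x hx => absurd hx (Nat.not_lt_zero x)⟩
    · change (if x = 0 then n else if x = 1 then m else 0) < X
      split_ifs <;> omega
    · simp only [inputStore]
      split_ifs
      · refine (Fin.is_lt _).trans ?_
        change n < X
        omega
      · change 0 < X
        omega
  obtain ⟨t₁, s₁, he₁, ht₁, hw₁, harr, hreg⟩ :=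
    wp_setupProg (Γ := Γ₀) (n := n) (m := m) (k := k) rfl hn h7 h8 rfl rfl hwf₀
  have hT : StepTable A (s₁.arr 0) := by
    intro q a
    rw [harr]
    have h1 : ((q : ℕ) * m + a) / m = q := row_major_div a.2
    have h2 : ((q : ℕ) * m + a) % m = a := row_major_mod a.2
    simp only [inputStore]
    rw [dif_pos ⟨trivial, by rw [h1]; exact q.2, hm⟩]
    simp only [h1, h2]
  obtain ⟨t₂, s₂, he₂, ht₂, hw₂, hholds⟩ := wp_mainProg (Γ := Γ) (A := A) hΓ hk hT
    (fun a ha i => by rw [harr]; simp [inputStore, ha]) ⟨hw₁.1, hreg⟩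
  refine ⟨_, _, .seq he₁ (.seq he₂ (.assign s₂ 0 (.reg 12) ?_)), hholds, ?_⟩
  · exact Setting.fits (Γ := Γ) hw₂ (by rfl)
  · have hU : 1 ≤ m * n ^ (2 * k) := Nat.mul_pos hm (Nat.pow_pos (by omega))
    have ht : t₁ + (t₂ + 2) ≤ C * (m * n ^ (2 * k)) := by
      have h1 : t₁ ≤ 8 * k + 31 := ht₁.trans_eq (time_setupProg _ k)
      have h2 : t₂ ≤ 10000 * (2 ^ k + 1) * k * (m * n ^ (2 * k)) :=
        ht₂.trans (time_mainProg_le hk (by omega) hm)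
      have h3 : 8 * k + 31 + 2 ≤ (8 * k + 31 + 2) * (m * n ^ (2 * k)) :=
        Nat.le_mul_of_pos_right _ hU
      calc t₁ + (t₂ + 2) ≤ (8 * k + 31 + 2) * (m * n ^ (2 * k)) +
            10000 * (2 ^ k + 1) * k * (m * n ^ (2 * k)) := by omega
        _ = C * (m * n ^ (2 * k)) := by rw [hC]; ring
    have hlog2 : 0 < Real.log 2 := Real.log_pos (by norm_num)
    -- The bound without logarithm is weakened here: `n ≥ 2` lets the factor `log n / log 2 ≥ 1` be
    -- inserted, which explains the choice of `K`.
    have hlog : Real.log 2 ≤ Real.log n :=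
      Real.log_le_log (by norm_num) (by exact_mod_cast (by omega : 2 ≤ n))
    calc ((t₁ + (t₂ + 2) : ℕ) : ℝ) ≤ ((C * (m * n ^ (2 * k)) : ℕ) : ℝ) := by exact_mod_cast ht
      _ = C / Real.log 2 * ((m : ℝ) * (n : ℝ) ^ (2 * k) * Real.log 2) := by
        push_cast
        field_simp
      _ ≤ C / Real.log 2 * ((m : ℝ) * (n : ℝ) ^ (2 * k) * Real.log n) := by gcongr
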